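/- Let $M$ be a smooth manifold (Hausdorff, $\sigma$-compact, without boundary) of dimension $d\ge 2$, and let $(E,\langle\cdot,\cdot\rangle,[\cdot,\cdot],\pi)$ be an exact Courant algebroid over $M$, i.e. a vector bundle with a nondegenerate symmetric pairing, an anchor $\pi:E\to TM$ and a Dorfman bracket, normalised by $2\langle[a,a],b\rangle=\pi(b)\langle a,a\rangle$, with $0\to T^*M\to E\to TM\to 0$ exact. Let $\mathcal G=\langle\mathcal G^{\mathrm{end}}\cdot,\cdot\rangle$ be a semi-Riemannian generalised metric ($\mathcal G^{\mathrm{end}}$ a symmetric involution with $\mathcal G|_{T^*M}$ nondegenerate), with eigenbundles $E_\pm$, and let $\mathrm{div}:\Gamma(E)\to C^\infty(M)$ be a divergence operator: $\mathbb R$-linear with $\mathrm{div}(fa)=f\,\mathrm{div}(a)+\pi(a)f$. The pair $(E,\mathcal G)$ determines a semi-Riemannian metric $g$ on $M$ by $g(\pi u,\pi v)=\langle u,v\rangle$ for $u,v\in E_+$, with Levi-Civita connection $\nabla$ and Riemann tensor $\mathrm{Rm}$; a three-form $H$ by $H(\pi a,\pi b,\pi c)=2\langle[a,b],c\rangle$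 for sections $a,b,c$ of $\mathcal G^{\mathrm{end}}(T^*M)$; and the metric divergence operator $\mathrm{div}^{\mathcal G}(a)=\mathrm{tr}(\nabla\pi a)$. Define $e\in\Gamma(E)$ by $\mathrm{div}=\mathrm{div}^{\mathcal G}-\langle e,\cdot\rangle$. A generalised connection $D$ on $E$ (a first-order operator $\Gamma(E)\to\Gamma(E^*\otimes E)$ with $D_a(fb)=(\pi(a)f)\,b+fD_ab$, preserving $\langle\cdot,\cdot\rangle$) is a generalised Levi-Civita connection of $\mathcal G$ if $D\mathcal G=0$ and $\langle D_ab-D_ba-[a,b],c\rangle+\langle D_ca,b\rangle=0$. The canonical one with metric divergence, $D^0$, is the one with $\pi D^0_ab=\nabla_{\pi a}\pi b\pm\frac16 g^{-1}H(\pi a,\pi b,\cdot)$ for $a,b\in\Gamma(E_\pm)$. Let $\mathfrak{so}(E)^{\langle1\rangle}_{\mathcal G}$ be the bundle of those $T\in E^*\otimes\mathfrak{so}(E)$ such that every $T_u$ commutes with $\mathcal G^{\mathrm{end}}$ and $\langle T_uv,w\rangle+\langle T_vw,u\rangle+\langle T_wu,v\rangle=0$, and put $(\mathrm{tr}\,T)(v)=\mathrm{tr}(u\mapsto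 T_uv)$. The canonical connection $D=D^{\mathcal G,\mathrm{div}}$ is the generalised Levi-Civita connection with $\mathrm{tr}(Da)=\mathrm{div}(a)$ for all $a$ such that $S=D-D^0$ is $\mathcal G$-orthogonal to $\ker\big(\mathrm{tr}:\mathfrak{so}(E)^{\langle1\rangle}_{\mathcal G}\to E^*\big)$. Its generalised Riemann tensor is $$\mathcal Rm^D(a,b,v,w)=\tfrac12\big\{\langle a,([D_v,D_w]-D_{[v,w]})b\rangle+\langle w,([D_b,D_a]-D_{[b,a]})v\rangle+\mathrm{tr}_E\,\langle Dv,w\rangle\langle Db,a\rangle\big\},$$ and its generalised Kretschmann scalar is the function $$|\mathcal Rm^D|^2_{\mathcal G}=\mathcal G^{II'}\mathcal G^{JJ'}\mathcal G^{KK'}\mathcal G^{LL'}\mathcal Rm^D_{IJKL}\,\mathcal Rm^D_{I'J'K'L'}$$ on $M$, summed over all components in a frame of $E$. Then $|\mathcal Rm^D|^2_{\mathcal G}$ is a geometric invariant of the pair $(\mathcal G,\mathrm{div})$, that is: 1. $D^{\mathcal G,\mathrm{div}}$ exists and is unique, $\mathcal Rm^D$ is a tensor, and $|\mathcal Rm^D|^2_{\mathcal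 G}$ does not depend on the frame. 2. If an isomorphism of exact Courant algebroids $E\to E'$ covering a diffeomorphism $f:M\to M'$ maps $(\mathcal G,\mathrm{div})$ to $(\mathcal G',\mathrm{div}')$, then $|\mathcal Rm^{D'}|^2_{\mathcal G'}\circ f=|\mathcal Rm^{D}|^2_{\mathcal G}$, where $D$ and $D'$ are the canonical connections of the two pairs. The invariant is non-trivial: 3. If $H=0$ and $e=0$, then $|\mathcal Rm^D|^2_{\mathcal G}=4|\mathrm{Rm}|^2_g$. 4. There is an exact Courant algebroid over $\mathbb R^2$ with a pair $(\mathcal G,\mathrm{div})$ for which $|\mathcal Rm^D|^2_{\mathcal G}$ is not constant. -/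

import Mathlib

open Bundle Manifold
open scoped ContDiff

noncomputable section

namespace GenGeom

/-! ### Full contraction of tensors with a scalar product -/

/-- The full contraction of two covariant `n`-tensors with the inverse of the bilinear form `B`,
computed in the basis `b`:
`∑ B^{i₁ j₁} ⋯ B^{iₙ jₙ} S(b_{i₁}, …, b_{iₙ}) T(b_{j₁}, …, b_{jₙ})`,
where `B^{ij}` is the inverse of the Gram matrix `B(b_i, b_j)`. -/
def contraction {V : Type*} [AddCommGroup V] [Module ℝ V] {ι : Type*} [Fintype ι] [DecidableEq ι]
    (b : Module.Basis ι ℝ V) (B : LinearMap.BilinForm ℝ V) (n : ℕ) (S T : (Fin n → V) → ℝ) : ℝ :=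
  ∑ I : Fin n → ι, ∑ J : Fin n → ι,
    (∏ k, (Matrix.of fun i j => B (b i) (b j))⁻¹ (I k) (J k)) *
      S (fun k => b (I k)) * T (fun k => b (J k))

/-- The full contraction of two covariant `n`-tensors with the inverse of `B`
(independent of the basis when `S` and `T` are multilinear). -/
def tensorInner {V : Type*} [AddCommGroup V] [Module ℝ V] [FiniteDimensional ℝ V]
    (B : LinearMap.BilinForm ℝ V) (n : ℕ) (S T : (Fin n → V) → ℝ) : ℝ :=
  contraction (Module.finBasis ℝ V) B n S T

/-! ### Smooth sections, vector fields -/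

/-- The space `Γ(E)` of smooth sections of a vector bundle `E → M`, `dim M = d`. -/
abbrev Sec (d : ℕ) {M : Type*} [TopologicalSpace M] [ChartedSpace (EuclideanSpace ℝ (Fin d)) M]
    (F : Type*) [NormedAddCommGroup F] [NormedSpace ℝ F] (E : M → Type*)
    [TopologicalSpace (TotalSpace F E)] [∀ x, TopologicalSpace (E x)] [FiberBundle F E] :=
  ContMDiffSection (𝓡 d) F ∞ E

/-- The space `C^∞(M)` of smooth real functions. -/
abbrev Fun (d : ℕ) (M : Type*) [TopologicalSpace M]
    [ChartedSpace (EuclideanSpace ℝ (Fin d)) M] :=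
  C^∞⟮𝓡 d, M; 𝓘(ℝ, ℝ), ℝ⟯

/-- The tangent space of the `d`-dimensional manifold `M` at `x`. -/
abbrev TM (d : ℕ) {M : Type*} [TopologicalSpace M]
    [ChartedSpace (EuclideanSpace ℝ (Fin d)) M] (x : M) :=
  TangentSpace (𝓡 d) x

/-- Smooth vector fields on `M`. -/
abbrev VF (d : ℕ) (M : Type*) [TopologicalSpace M]
    [ChartedSpace (EuclideanSpace ℝ (Fin d)) M] [IsManifold (𝓡 d) ∞ M] :=
  Sec d (EuclideanSpace ℝ (Fin d)) (fun x : M => TM d x)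

section Bundles

variable {d : ℕ} {M : Type*} [TopologicalSpace M] [ChartedSpace (EuclideanSpace ℝ (Fin d)) M]
  [IsManifold (𝓡 d) ∞ M]
  {F : Type*} [NormedAddCommGroup F] [NormedSpace ℝ F]
  {E : M → Type*} [∀ x, AddCommGroup (E x)] [∀ x, Module ℝ (E x)]
  [∀ x, TopologicalSpace (E x)] [TopologicalSpace (TotalSpace F E)]
  [FiberBundle F E] [VectorBundle ℝ F E]

/-- The product `f s` of a smooth function and a smooth section. -/
def fsmul (f : Fun d M) (s : Sec d F E) : Sec d F E :=
  ⟨fun x => f x • s x, ContMDiff.smul_section f.contMDiff s.contMDiff⟩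

/-- Every vector in a fibre is the value of a global smooth section. -/
theorem exists_section [T2Space M] [SigmaCompactSpace M] [ContMDiffVectorBundle ∞ F E (𝓡 d)]
    (x : M) (u : E x) : ∃ s : Sec d F E, s x = u := by
  classical
  have hconv : ∀ y, Convex ℝ {w : E y | ∀ h : y = x, h ▸ w = u} := by
    intro y
    by_cases h : y = x
    · subst h
      simp [convex_singleton]
    · have : {w : E y | ∀ h : y = x, h ▸ w = u} = Set.univ := by
        ext w; simp [h]
      rw [this]; exact convex_univ
  obtain ⟨s, hs⟩ := exists_contMDiffSection_forall_mem_convex_of_local (𝓡 d) (n := ⊤)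
    (F_fiber := F) E (fun y => {w : E y | ∀ h : y = x, h ▸ w = u}) hconv (by
      intro x₀
      by_cases h : x₀ = x
      · subst h
        obtain ⟨U, hU, hs⟩ := FiberBundle.exists_contMDiffOn_extend (k := ∞) (𝓡 d) F u
        refine ⟨U, hU, _, hs, ?_⟩
        intro y _ hy
        subst hy
        exact FiberBundle.extend_apply_self F u
      · refine ⟨{x}ᶜ, isOpen_compl_singleton.mem_nhds h, fun y => 0,
          (contMDiff_zeroSection ℝ E).contMDiffOn, ?_⟩
        intro y hy h'
        exact absurd h' hy)
  exact ⟨s, hs x rfl⟩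

/-- A global smooth section with prescribed value `u` at the point `x`. -/
def ext [T2Space M] [SigmaCompactSpace M] [ContMDiffVectorBundle ∞ F E (𝓡 d)]
    {x : M} (u : E x) : Sec d F E :=
  Classical.choose (exists_section (d := d) (F := F) x u)

theorem ext_apply [T2Space M] [SigmaCompactSpace M] [ContMDiffVectorBundle ∞ F E (𝓡 d)]
    {x : M} (u : E x) : (ext u : Sec d F E) x = u :=
  Classical.choose_spec (exists_section (d := d) (F := F) x u)

end Bundles

/-! ### Affine connections on `M` -/

section Affine

variable (d : ℕ) (M : Type*) [TopologicalSpace M] [ChartedSpace (EuclideanSpace ℝ (Fin d)) M]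
  [IsManifold (𝓡 d) ∞ M]

/-- An affine connection `∇` on `M`; `∇.toFun Y x u` is `∇_u Y ∈ T_x M`. -/
structure AffineConnection where
  toFun : VF d M → ∀ x : M, TM d x →ₗ[ℝ] TM d x
  smooth' : ∀ X Y : VF d M, ContMDiff (𝓡 d) ((𝓡 d).prod 𝓘(ℝ, EuclideanSpace ℝ (Fin d))) ∞
    (fun x : M => (⟨x, toFun Y x (X x)⟩ : TangentBundle (𝓡 d) M))
  add' : ∀ (Y Z : VF d M) (x : M), toFun (Y + Z) x = toFun Y x + toFun Z x
  leibniz' : ∀ (f : Fun d M) (Y : VF d M) (x : M) (u : TM d x),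
    toFun (fsmul f Y) x u = mvfderiv (𝓡 d) f x u • Y x + f x • toFun Y x u

variable {d M}

/-- The vector field `∇_X Y`. -/
def AffineConnection.deriv (N : AffineConnection d M) (X Y : VF d M) : VF d M :=
  ⟨fun x => N.toFun Y x (X x), N.smooth' X Y⟩

/-- `∇` is the Levi-Civita connection of `g`: it is metric and torsion-free. -/
def AffineConnection.IsLeviCivita (N : AffineConnection d M)
    (g : ∀ x : M, LinearMap.BilinForm ℝ (TM d x)) : Prop :=
  (∀ (Y Z : VF d M) (x : M) (u : TM d x),
    mvfderiv (𝓡 d) (fun y => g y (Y y) (Z y)) x u =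
      g x (N.toFun Y x u) (Z x) + g x (Y x) (N.toFun Z x u)) ∧
  ∀ (X Y : VF d M) (x : M),
    N.toFun Y x (X x) - N.toFun X x (Y x) = VectorField.mlieBracket (𝓡 d) X Y x

/-- The Riemann tensor `Rm(A, B, V, W) = g(A, (∇_V ∇_W - ∇_W ∇_V - ∇_{[V, W]}) B)`. -/
def AffineConnection.riem (N : AffineConnection d M)
    (g : ∀ x : M, LinearMap.BilinForm ℝ (TM d x)) (A B V W : VF d M) (x : M) : ℝ :=
  g x (A x) (N.toFun (N.deriv W B) x (V x) - N.toFun (N.deriv V B) x (W x)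
    - N.toFun B x (VectorField.mlieBracket (𝓡 d) V W x))

/-- The squared norm `|Rm|²_g = g^{ii'} g^{jj'} g^{kk'} g^{ll'} Rm_{ijkl} Rm_{i'j'k'l'}`. -/
def AffineConnection.riemNormSq [T2Space M] [SigmaCompactSpace M] (N : AffineConnection d M)
    (g : ∀ x : M, LinearMap.BilinForm ℝ (TM d x)) (x : M) : ℝ :=
  haveI : FiniteDimensional ℝ (TM d x) :=
    VectorBundle.finiteDimensional ℝ (EuclideanSpace ℝ (Fin d)) (fun x : M => TM d x) x
  let R : (Fin 4 → TM d x) → ℝ := fun u =>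
    N.riem g (ext (u 0)) (ext (u 1)) (ext (u 2)) (ext (u 3)) x
  tensorInner (g x) 4 R R

end Affine

/-! ### Courant algebroids -/

section Courant

variable (d : ℕ) {M : Type*} [TopologicalSpace M] [ChartedSpace (EuclideanSpace ℝ (Fin d)) M]
  [IsManifold (𝓡 d) ∞ M]
  (F : Type*) [NormedAddCommGroup F] [NormedSpace ℝ F]
  (E : M → Type*) [∀ x, AddCommGroup (E x)] [∀ x, Module ℝ (E x)]
  [∀ x, TopologicalSpace (E x)] [TopologicalSpace (TotalSpace F E)]
  [FiberBundle F E] [VectorBundle ℝ F E]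

/-- A Courant algebroid structure (scalar product, anchor, Dorfman bracket) on the smooth vector
bundle `E → M`. -/
structure CourantAlgebroid where
  /-- the scalar product `⟨·,·⟩` -/
  pairing : ∀ x, LinearMap.BilinForm ℝ (E x)
  pairing_symm : ∀ x u v, pairing x u v = pairing x v u
  pairing_nondeg : ∀ x u, (∀ v, pairing x u v = 0) → u = 0
  pairing_smooth : ∀ a b : Sec d F E,
    ContMDiff (𝓡 d) 𝓘(ℝ, ℝ) ∞ (fun x => pairing x (a x) (b x))
  /-- the anchor `π : E → TM` -/
  anchor : ∀ x, E x →ₗ[ℝ] TM d x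
  anchor_smooth : ∀ a : Sec d F E,
    ContMDiff (𝓡 d) ((𝓡 d).prod 𝓘(ℝ, EuclideanSpace ℝ (Fin d))) ∞
      (fun x : M => (⟨x, anchor x (a x)⟩ : TangentBundle (𝓡 d) M))
  /-- the Dorfman bracket -/
  bracket : Sec d F E →ₗ[ℝ] Sec d F E →ₗ[ℝ] Sec d F E
  jacobi : ∀ a b c, bracket a (bracket b c) = bracket (bracket a b) c + bracket b (bracket a c)
  anchor_bracket : ∀ (a b : Sec d F E) (x : M), anchor x (bracket a b x) =
    VectorField.mlieBracket (𝓡 d) (fun y => anchor y (a y)) (fun y => anchor y (b y)) x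
  bracket_fsmul : ∀ (a b : Sec d F E) (f : Fun d M) (x : M),
    bracket a (fsmul f b) x = mvfderiv (𝓡 d) f x (anchor x (a x)) • b x + f x • bracket a b x
  bracket_pairing : ∀ (a b c : Sec d F E) (x : M),
    mvfderiv (𝓡 d) (fun y => pairing y (b y) (c y)) x (anchor x (a x)) =
      pairing x (bracket a b x) (c x) + pairing x (b x) (bracket a c x)
  bracket_self : ∀ (a b : Sec d F E) (x : M),
    2 * pairing x (bracket a a x) (b x) =
      mvfderiv (𝓡 d) (fun y => pairing y (a y) (a y)) x (anchor x (b x))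

variable {d F E}

namespace CourantAlgebroid

variable (C : CourantAlgebroid d F E)

/-- The vector field `π(a)`. -/
def anchorSec (a : Sec d F E) : VF d M :=
  ⟨fun x => C.anchor x (a x), C.anchor_smooth a⟩

/-- Exactness of `0 → T*M → E → TM → 0`, where the first map is the dual of the anchor under the
identification `E ≅ E*` by the scalar product (it is injective once the anchor is onto). -/
structure IsExact : Prop where
  surjective : ∀ x, Function.Surjective (C.anchor x)
  ker_eq : ∀ x (u : E x), C.anchor x u = 0 ↔
    ∃ ξ : TM d x →ₗ[ℝ] ℝ, ∀ v, C.pairing x u v = ξ (C.anchor x v)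

/-- A semi-Riemannian generalised metric `𝒢 = ⟨𝒢^end ·, ·⟩`, given by the smooth field of
endomorphisms `𝒢^end`: a symmetric involution such that `𝒢` is nondegenerate on
`T*M = ker π`. Its eigenbundles for `±1` are denoted `E_±`. -/
structure GenMetric where
  endo : ∀ x, E x →ₗ[ℝ] E x
  endo_smooth : ∀ a : Sec d F E, ContMDiff (𝓡 d) ((𝓡 d).prod 𝓘(ℝ, F)) ∞
    (fun x => TotalSpace.mk' F x (endo x (a x)))
  endo_endo : ∀ x u, endo x (endo x u) = u
  endo_symm : ∀ x u v, C.pairing x (endo x u) v = C.pairing x u (endo x v)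
  nondeg_ker : ∀ x u, C.anchor x u = 0 →
    (∀ v, C.anchor x v = 0 → C.pairing x (endo x u) v = 0) → u = 0

/-- A divergence operator: an `ℝ`-linear map with `div(f a) = f div(a) + π(a) f`. -/
structure Divergence where
  toFun : Sec d F E →ₗ[ℝ] Fun d M
  leibniz : ∀ (f : Fun d M) (a : Sec d F E) (x : M),
    toFun (fsmul f a) x = f x * toFun a x + mvfderiv (𝓡 d) f x (C.anchor x (a x))

/-- A generalised connection `D` on `E`; `D.toFun b x u` is `D_u b ∈ E_x` for `u ∈ E_x`. -/
structure GenConnection where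
  toFun : Sec d F E → ∀ x, E x →ₗ[ℝ] E x
  smooth' : ∀ a b : Sec d F E, ContMDiff (𝓡 d) ((𝓡 d).prod 𝓘(ℝ, F)) ∞
    (fun x => TotalSpace.mk' F x (toFun b x (a x)))
  add' : ∀ (b c : Sec d F E) x, toFun (b + c) x = toFun b x + toFun c x
  leibniz' : ∀ (f : Fun d M) (b : Sec d F E) x (u : E x),
    toFun (fsmul f b) x u = mvfderiv (𝓡 d) f x (C.anchor x u) • b x + f x • toFun b x u
  pairing' : ∀ (b c : Sec d F E) x (u : E x),
    mvfderiv (𝓡 d) (fun y => C.pairing y (b y) (c y)) x (C.anchor x u) =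
      C.pairing x (toFun b x u) (c x) + C.pairing x (b x) (toFun c x u)

variable {C}

/-- The bilinear form `𝒢` on the fibre `E_x`. -/
def GenMetric.form (G : C.GenMetric) (x : M) : LinearMap.BilinForm ℝ (E x) :=
  (C.pairing x).comp (G.endo x) LinearMap.id

/-- The section `D_a b`. -/
def GenConnection.deriv (D : C.GenConnection) (a b : Sec d F E) : Sec d F E :=
  ⟨fun x => D.toFun b x (a x), D.smooth' a b⟩

/-- `D` is a generalised Levi-Civita connection of `𝒢`: `D𝒢 = 0`, and the torsion
`T(a,b,c) = ⟨D_a b - D_b a - [a,b], c⟩ + ⟨D_c a, b⟩` vanishes. -/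
structure GenConnection.IsLeviCivita (D : C.GenConnection) (G : C.GenMetric) : Prop where
  metric : ∀ (b c : Sec d F E) (x : M) (u : E x),
    mvfderiv (𝓡 d) (fun y => G.form y (b y) (c y)) x (C.anchor x u) =
      G.form x (D.toFun b x u) (c x) + G.form x (b x) (D.toFun c x u)
  torsion : ∀ (a b c : Sec d F E) (x : M),
    C.pairing x (D.toFun b x (a x) - D.toFun a x (b x) - C.bracket a b x) (c x) +
      C.pairing x (D.toFun a x (c x)) (b x) = 0

/-- `D` has divergence operator `div`: `div(a) = tr(D a)`. -/
def GenConnection.HasDivergence (D : C.GenConnection) (dv : C.Divergence) : Prop :=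
  ∀ (a : Sec d F E) (x : M), LinearMap.trace ℝ (E x) (D.toFun a x) = dv.toFun a x

variable (C) in
/-- The classical data determined by a generalised metric `𝒢`:
* the semi-Riemannian metric `g` on `M` with `g(πu, πv) = ⟨u, v⟩` for `u, v ∈ E_+`;
* the three-form `H` with `H(πa, πb, πc) = 2⟨[a,b],c⟩` for sections `a, b, c` of `𝒢^end(T*M)`,
  the isotropic complement of `T*M` in `E` defined by `𝒢`;
* the Levi-Civita connection `∇` of `g`. -/
structure InducedGeometry (G : C.GenMetric) where
  g : ∀ x : M, LinearMap.BilinForm ℝ (TM d x)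
  g_spec : ∀ x (u v : E x), G.endo x u = u → G.endo x v = v →
    g x (C.anchor x u) (C.anchor x v) = C.pairing x u v
  H : ∀ x : M, TM d x →ₗ[ℝ] TM d x →ₗ[ℝ] TM d x →ₗ[ℝ] ℝ
  H_spec : ∀ a b c : Sec d F E, (∀ x, C.anchor x (G.endo x (a x)) = 0) →
    (∀ x, C.anchor x (G.endo x (b x)) = 0) → (∀ x, C.anchor x (G.endo x (c x)) = 0) →
    ∀ x, H x (C.anchor x (a x)) (C.anchor x (b x)) (C.anchor x (c x)) =
      2 * C.pairing x (C.bracket a b x) (c x)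
  nabla : AffineConnection d M
  leviCivita : nabla.IsLeviCivita g

/-- The divergence operator is the metric divergence operator `div^𝒢`, that is,
`div(a) = div_g(πa) = tr(∇ πa)`. -/
def InducedGeometry.IsMetricDivergence {G : C.GenMetric} (Q : InducedGeometry C G)
    (dv : C.Divergence) : Prop :=
  ∀ (a : Sec d F E) (x : M),
    dv.toFun a x = LinearMap.trace ℝ (TM d x) (Q.nabla.toFun (C.anchorSec a) x)

/-- `D⁰` is the canonical generalised Levi-Civita connection of `𝒢` with metric divergence: the
generalised Levi-Civita connection whose pure-type parts are given by
`π D⁰_a b = ∇_{πa} πb ± (1/6) g⁻¹ H(πa, πb, ·)` for `a, b ∈ Γ(E_±)`. (As `⟨u, v⟩ = ± g(πu, πv)`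
on `E_±`, the sign is the same in both cases for the term involving `H` below.) -/
structure GenConnection.IsCanonicalZero (D₀ : C.GenConnection) (G : C.GenMetric) : Prop where
  leviCivita : D₀.IsLeviCivita G
  pure : ∃ Q : InducedGeometry C G, ∀ ε : ℝ, (ε = 1 ∨ ε = -1) → ∀ a b c : Sec d F E,
    (∀ x, G.endo x (a x) = ε • a x) → (∀ x, G.endo x (b x) = ε • b x) →
    (∀ x, G.endo x (c x) = ε • c x) → ∀ x,
      C.pairing x (D₀.toFun b x (a x)) (c x) =
        ε * Q.g x (Q.nabla.toFun (C.anchorSec b) x (C.anchor x (a x))) (C.anchor x (c x)) +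
        1 / 6 * Q.H x (C.anchor x (a x)) (C.anchor x (b x)) (C.anchor x (c x))

/-- Membership in the fibre of the generalised first prolongation `𝔰𝔬(E)^{⟨1⟩}_𝒢` at `x`: maps
`T : u ↦ T_u ∈ 𝔰𝔬(E_x)` with every `T_u` commuting with `𝒢^end` and with vanishing cyclic sum
`⟨T_u v, w⟩ + ⟨T_v w, u⟩ + ⟨T_w u, v⟩`. -/
structure GenMetric.InProlongation (G : C.GenMetric) (x : M) (T : E x →ₗ[ℝ] E x →ₗ[ℝ] E x) :
    Prop where
  skew : ∀ u v w, C.pairing x (T u v) w = -C.pairing x v (T u w)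
  comm : ∀ u v, T u (G.endo x v) = G.endo x (T u v)
  cyclic : ∀ u v w, C.pairing x (T u v) w + C.pairing x (T v w) u + C.pairing x (T w u) v = 0

variable [T2Space M] [SigmaCompactSpace M] [FiniteDimensional ℝ F]
  [ContMDiffVectorBundle ∞ F E (𝓡 d)]

/-- `D` is the canonical generalised Levi-Civita connection `D^{𝒢,div}`: a generalised Levi-Civita
connection with divergence operator `div`, of the form `D = D⁰ + S` where `D⁰` is the canonical
one with metric divergence, and the section `S` of `𝔰𝔬(E)^{⟨1⟩}_𝒢` is orthogonal
(for the scalar product induced by `𝒢`) to the kernel of `tr : 𝔰𝔬(E)^{⟨1⟩}_𝒢 → E*`,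
`(tr T)(v) = tr(u ↦ T_u v)`. -/
structure GenConnection.IsCanonical (D : C.GenConnection) (G : C.GenMetric)
    (dv : C.Divergence) : Prop where
  leviCivita : D.IsLeviCivita G
  divergence : D.HasDivergence dv
  orthogonal : ∃ D₀ : C.GenConnection, D₀.IsCanonicalZero G ∧
    ∀ (x : M) (T : E x →ₗ[ℝ] E x →ₗ[ℝ] E x), G.InProlongation x T →
      (∀ v, LinearMap.trace ℝ (E x) (T.flip v) = 0) →
      haveI : FiniteDimensional ℝ (E x) := VectorBundle.finiteDimensional ℝ F E x
      tensorInner (G.form x) 3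
        (fun u => C.pairing x
          (D.toFun (ext (u 1)) x (u 0) - D₀.toFun (ext (u 1)) x (u 0)) (u 2))
        (fun u => C.pairing x (T (u 0) (u 1)) (u 2)) = 0

/-- The generalised Riemann tensor
`2 ℛm(a,b,v,w) = ⟨a, ([D_v, D_w] - D_{[v,w]}) b⟩ + ⟨w, ([D_b, D_a] - D_{[b,a]}) v⟩
  + tr_E(⟨D v, w⟩ ⟨D b, a⟩)`,
where `tr_E` is the trace of a bilinear form with respect to `⟨·,·⟩`. -/
def GenConnection.rm (D : C.GenConnection) (a b v w : Sec d F E) (x : M) : ℝ :=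
  haveI : FiniteDimensional ℝ (E x) := VectorBundle.finiteDimensional ℝ F E x
  1 / 2 *
    (C.pairing x (a x) (D.toFun (D.deriv w b) x (v x) - D.toFun (D.deriv v b) x (w x)
        - D.toFun b x (C.bracket v w x)) +
      C.pairing x (w x) (D.toFun (D.deriv a v) x (b x) - D.toFun (D.deriv b v) x (a x)
        - D.toFun v x (C.bracket b a x)) +
      tensorInner (C.pairing x) 1
        (fun u => C.pairing x (D.toFun v x (u 0)) (w x))
        (fun u => C.pairing x (D.toFun b x (u 0)) (a x)))

/-- The generalised Riemann tensor as a function of four vectors of the fibre `E_x`. -/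
def GenConnection.rmAt (D : C.GenConnection) (x : M) (u : Fin 4 → E x) : ℝ :=
  D.rm (ext (u 0)) (ext (u 1)) (ext (u 2)) (ext (u 3)) x

/-- The generalised Kretschmann scalar
`|ℛm|²_𝒢 = 𝒢^{II'} 𝒢^{JJ'} 𝒢^{KK'} 𝒢^{LL'} ℛm_{IJKL} ℛm_{I'J'K'L'}`. -/
def GenConnection.kretschmann (D : C.GenConnection) (G : C.GenMetric) (x : M) : ℝ :=
  haveI : FiniteDimensional ℝ (E x) := VectorBundle.finiteDimensional ℝ F E x
  tensorInner (G.form x) 4 (D.rmAt x) (D.rmAt x)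

end CourantAlgebroid

end Courant

/-! ### Isomorphisms -/

section Iso

variable {d : ℕ}
  {M : Type*} [TopologicalSpace M] [ChartedSpace (EuclideanSpace ℝ (Fin d)) M]
  [IsManifold (𝓡 d) ∞ M]
  {F : Type*} [NormedAddCommGroup F] [NormedSpace ℝ F]
  {E : M → Type*} [∀ x, AddCommGroup (E x)] [∀ x, Module ℝ (E x)]
  [∀ x, TopologicalSpace (E x)] [TopologicalSpace (TotalSpace F E)]
  [FiberBundle F E] [VectorBundle ℝ F E]
  {M' : Type*} [TopologicalSpace M'] [ChartedSpace (EuclideanSpace ℝ (Fin d)) M']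
  [IsManifold (𝓡 d) ∞ M']
  {F' : Type*} [NormedAddCommGroup F'] [NormedSpace ℝ F']
  {E' : M' → Type*} [∀ x, AddCommGroup (E' x)] [∀ x, Module ℝ (E' x)]
  [∀ x, TopologicalSpace (E' x)] [TopologicalSpace (TotalSpace F' E')]
  [FiberBundle F' E'] [VectorBundle ℝ F' E']

/-- An isomorphism of smooth vector bundles `E → M`, `E' → M'` covering a diffeomorphism. -/
structure BundleIso (d : ℕ)
    {M : Type*} [TopologicalSpace M] [ChartedSpace (EuclideanSpace ℝ (Fin d)) M]
    (F : Type*) [NormedAddCommGroup F] [NormedSpace ℝ F]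
    (E : M → Type*) [∀ x, AddCommGroup (E x)] [∀ x, Module ℝ (E x)]
    [∀ x, TopologicalSpace (E x)] [TopologicalSpace (TotalSpace F E)] [FiberBundle F E]
    {M' : Type*} [TopologicalSpace M'] [ChartedSpace (EuclideanSpace ℝ (Fin d)) M']
    (F' : Type*) [NormedAddCommGroup F'] [NormedSpace ℝ F']
    (E' : M' → Type*) [∀ x, AddCommGroup (E' x)] [∀ x, Module ℝ (E' x)]
    [∀ x, TopologicalSpace (E' x)] [TopologicalSpace (TotalSpace F' E')] [FiberBundle F' E'] where
  base : Diffeomorph (𝓡 d) (𝓡 d) M M' ∞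
  total : Diffeomorph ((𝓡 d).prod 𝓘(ℝ, F)) ((𝓡 d).prod 𝓘(ℝ, F'))
    (TotalSpace F E) (TotalSpace F' E') ∞
  fib : ∀ x, E x ≃ₗ[ℝ] E' (base x)
  total_eq : ∀ x (u : E x), total (TotalSpace.mk' F x u) = TotalSpace.mk' F' (base x) (fib x u)

/-- The sections `a` of `E` and `a'` of `E'` correspond to each other under `Φ`. -/
def BundleIso.Related (Φ : BundleIso d F E F' E') (a : Sec d F E) (a' : Sec d F' E') : Prop :=
  ∀ x, a' (Φ.base x) = Φ.fib x (a x)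

/-- `Φ` is an isomorphism of Courant algebroids: it preserves scalar product, anchor, bracket. -/
structure BundleIso.IsCourantIso (Φ : BundleIso d F E F' E') (C : CourantAlgebroid d F E)
    (C' : CourantAlgebroid d F' E') : Prop where
  pairing : ∀ x u v, C'.pairing (Φ.base x) (Φ.fib x u) (Φ.fib x v) = C.pairing x u v
  anchor : ∀ x u, C'.anchor (Φ.base x) (Φ.fib x u) =
    mfderiv (𝓡 d) (𝓡 d) Φ.base x (C.anchor x u)
  bracket : ∀ a b a' b', Φ.Related a a' → Φ.Related b b' →
    Φ.Related (C.bracket a b) (C'.bracket a' b')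

/-- `Φ` maps the pair `(𝒢, div)` to the pair `(𝒢', div')`. -/
structure BundleIso.MapsPair (Φ : BundleIso d F E F' E') {C : CourantAlgebroid d F E}
    {C' : CourantAlgebroid d F' E'} (G : C.GenMetric) (dv : C.Divergence)
    (G' : C'.GenMetric) (dv' : C'.Divergence) : Prop where
  metric : ∀ x u v, G'.form (Φ.base x) (Φ.fib x u) (Φ.fib x v) = G.form x u v
  div : ∀ a a', Φ.Related a a' → ∀ x, dv'.toFun a' (Φ.base x) = dv.toFun a x

end Iso

end GenGeom

end

/-! The anchor restricts to isomorphisms `E_± ≅ TM`. The reflection ρ of `E` that is 1 on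
`𝒢^end(T*M)` and -1 on `T*M` (`GenMetric.refl`) commutes with the anchor, exchanges `E_+` and `E_-`,
and reverses the sign of the pairing. Since `E_+ ⊥ E_-`, the mixed bracket `[a_∓, b_±]_±`
(`GenMetric.mixed`) is tensorial in `a`. Seen on `TM`, the two mixed brackets are metric connections
whose difference is `H` (`GenMetric.flux`) and whose mean is `∇` (`GenMetric.baseNabla`). Weighting
them by 2/3 and 1/3 in the pure directions gives `∇ ± H/6`, hence an explicit `D⁰`
(`GenMetric.zeroConn`). Vanishing torsion and `D𝒢 = 0` force the mixed parts of any generalised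
Levi-Civita connection, so `D⁰` is unique (`IsLeviCivita.eq_of_pure`).

Two generalised Levi-Civita connections differ by a section of the prolongation. The elements
`GenMetric.weyl x e` have trace `(1 - d)⟨e, ·⟩` and are orthogonal to the kernel of the trace. As `d
≥ 2`, a suitable `e` corrects the divergence, which gives existence. Uniqueness requires `𝒢`, which
may be indefinite, to be nondegenerate on the trace kernel; this is tested against hook-shaped
tensors (`InProlongation.eq_zero`).

The Dorfman bracket is not tensorial up to a derivative in its left slot, but the defect in the
curvature cancels against the trace term of `ℛm` (`rm_fsmul_third`), so `ℛm` is a tensor and its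
contraction is frame independent. Invariance follows because every ingredient of the explicit
connection is natural.

If `H = 0` and the divergence is metric, then `D` is `∇` lifted to `E_+ ⊕ E_-`, and the components
of `ℛm` are those of `Rm` times half a sum of signs; the squares of these factors over the 16 sign
patterns add up to 4. For the last claim, the flat plane is given the divergence shifted by `f (∂₀ +
dx⁰)`. Where `f` vanishes, `ℛm` is linear in `df`, and `f` is chosen with `df = 0` at one zero and
`df ≠ 0` at another. -/

open Bundle Manifold
open scoped ContDiff
noncomputable section
set_option linter.unusedSectionVars false
namespace GenGeom

/-! ### Smooth sections: tensorial maps, smoothness criteria -/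

section Toolkit

open scoped Topology

variable {d : ℕ} {M : Type*} [TopologicalSpace M] [ChartedSpace (EuclideanSpace ℝ (Fin d)) M]
  [IsManifold (𝓡 d) ∞ M]
  {F : Type*} [NormedAddCommGroup F] [NormedSpace ℝ F]
  {E : M → Type*} [∀ x, AddCommGroup (E x)] [∀ x, Module ℝ (E x)]
  [∀ x, TopologicalSpace (E x)] [TopologicalSpace (TotalSpace F E)]
  [FiberBundle F E] [VectorBundle ℝ F E]

@[simp] theorem fsmul_apply (f : Fun d M) (s : Sec d F E) (x : M) : fsmul f s x = f x • s x := rfl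

@[simp] theorem Sec.add_apply (s t : Sec d F E) (x : M) : (s + t) x = s x + t x := rfl
@[simp] theorem Sec.sub_apply (s t : Sec d F E) (x : M) : (s - t) x = s x - t x := rfl
@[simp] theorem Sec.neg_apply (s : Sec d F E) (x : M) : (-s) x = -s x := rfl
@[simp] theorem Sec.smul_apply (r : ℝ) (s : Sec d F E) (x : M) : (r • s) x = r • s x := rfl
@[simp] theorem Sec.zero_apply (x : M) : (0 : Sec d F E) x = 0 := rfl

theorem Sec.sum_apply {ι : Type*} (t : Finset ι) (s : ι → Sec d F E) (x : M) :
    (∑ i ∈ t, s i) x = ∑ i ∈ t, s i x := by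
  classical
  induction t using Finset.induction_on with
  | empty => simp
  | insert i t hi h => simp [Finset.sum_insert hi, h]

theorem exists_bump [T2Space M] (x : M) {U : Set M} (hU : U ∈ 𝓝 x) :
    ∃ χ : Fun d M, χ x = 1 ∧ tsupport χ ⊆ U := by
  obtain ⟨f, -, hf⟩ := (SmoothBumpFunction.nhds_basis_tsupport (I := 𝓡 d) x).mem_iff.1 hU
  exact ⟨⟨f, f.contMDiff⟩, f.eq_one, hf⟩

variable [T2Space M] [FiniteDimensional ℝ F] [ContMDiffVectorBundle ∞ F E (𝓡 d)]

/-- Near every point, a smooth section is, up to multiplication with a function which is `1` at the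
point, a finite combination of fixed global sections which form a basis at the point. -/
theorem exists_frame (x : M) : ∃ (n : ℕ) (B : Fin n → Sec d F E) (χ : Fun d M)
    (b : Module.Basis (Fin n) ℝ (E x)), χ x = 1 ∧ (∀ i, B i x = b i) ∧
    ∀ s : Sec d F E, ∃ f : Fin n → Fun d M, (∀ i, f i x = b.repr (s x) i) ∧
      fsmul χ (fsmul χ s) = ∑ i, fsmul (f i) (B i) := by
  have : ContMDiffVectorBundle 1 F E (𝓡 d) := ContMDiffVectorBundle.of_le (n := ∞) (by simp)
  let e := trivializationAt F E x
  have hx : x ∈ e.baseSet := FiberBundle.mem_baseSet_trivializationAt F E x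
  let c := Module.finBasis ℝ F
  obtain ⟨χ, hχ, hsupp⟩ := exists_bump (d := d) x (e.open_baseSet.mem_nhds hx)
  have hloc := e.isLocalFrameOn_localFrame_baseSet (𝓡 d) ∞ c
  -- Frame and coefficients are each cut off by `χ`, so that both are globally smooth; this is why
  -- `s` has to be multiplied by `χ` twice.
  let B : Fin (Module.finrank ℝ F) → Sec d F E := fun i =>
    ⟨fun y => χ y • e.localFrame c i y, ContMDiffOn.smul_section_of_tsupport
      χ.contMDiff.contMDiffOn e.open_baseSet hsupp (hloc.contMDiffOn i)⟩
  refine ⟨_, B, χ, e.basisAt c hx, hχ, fun i => ?_, fun s => ?_⟩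
  · simp [B, hχ, hx]
  · have hco : ∀ i, ContMDiffOn (𝓡 d) 𝓘(ℝ, ℝ) ∞
        (fun y => e.localFrameCoeff (𝓡 d) c i y (s y)) e.baseSet := fun i =>
      contMDiffOn_baseSet_localFrameCoeff c s.contMDiff.contMDiffOn i
    have hsm : ∀ i, ContMDiff (𝓡 d) 𝓘(ℝ, ℝ) ∞
        (fun y => χ y • e.localFrameCoeff (𝓡 d) c i y (s y)) := fun i => by
      apply contMDiff_of_tsupport
      intro y hy
      have hy' : y ∈ e.baseSet := hsupp ((tsupport_smul_subset_left _ _) hy)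
      exact χ.contMDiff.contMDiffAt.smul ((hco i).contMDiffAt (e.open_baseSet.mem_nhds hy'))
    refine ⟨fun i => ⟨_, hsm i⟩, fun i => ?_, ?_⟩
    · change χ x • e.localFrameCoeff (𝓡 d) c i x (s x) = _
      rw [hχ, one_smul, e.localFrameCoeff_apply_of_mem_baseSet c hx]
    · ext y
      rw [Sec.sum_apply]
      change χ y • χ y • s y = ∑ i, (χ y • e.localFrameCoeff (𝓡 d) c i y (s y)) •
        (χ y • e.localFrame c i y)
      by_cases hy : y ∈ e.baseSet
      · conv_lhs => rw [e.eq_sum_localFrameCoeff_smul (I := 𝓡 d) (b := c) (s := s) hy]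
        simp only [Finset.smul_sum]
        refine Finset.sum_congr rfl fun i _ => ?_
        simp only [smul_smul, smul_eq_mul]
        congr 1; ring
      · have : χ y = 0 := by
          by_contra h
          exact hy (hsupp (subset_tsupport _ h))
        simp [this]

section Tensorial

variable {A : Type*} [AddCommGroup A] [Module ℝ A] {φ : Sec d F E → A} {x : M}

/-- An additive map on sections which is linear over functions at `x` only depends on the value
of the section at `x`. -/
theorem tensorial_congr (hadd : ∀ s t, φ (s + t) = φ s + φ t)
    (hsmul : ∀ (f : Fun d M) s, φ (fsmul f s) = f x • φ s) {s t : Sec d F E} (h : s x = t x) :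
    φ s = φ t := by
  obtain ⟨n, B, χ, b, hχ, hB, hf⟩ := exists_frame (d := d) (F := F) (E := E) x
  have key : ∀ s, φ s = ∑ i, (b.repr (s x) i) • φ (B i) := fun s => by
    obtain ⟨f, hfx, hs⟩ := hf s
    -- Both factors `χ` leave `φ` as constants, equal to 1 at `x`.
    have h1 : φ (fsmul χ (fsmul χ s)) = φ s := by simp [hsmul, hχ]
    rw [← h1, hs]
    have := map_sum (AddMonoidHom.mk' φ hadd) (fun i => fsmul (f i) (B i)) Finset.univ
    simp only [AddMonoidHom.mk'_apply] at this
    rw [this]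
    simp [hsmul, hfx]
  rw [key s, key t, h]

end Tensorial

/-- Let `λ_j` be finitely many linear functionals on the fibres, jointly injective at `x₀` and
smooth at `x₀` on smooth sections. A field of vectors is smooth at `x₀` if its images under all
the `λ_j` are smooth at `x₀`. -/
theorem contMDiffAt_of_functionals [SigmaCompactSpace M] {J : Type*} [Fintype J]
    (l : J → ∀ x, E x →ₗ[ℝ] ℝ) (x₀ : M)
    (hl : ∀ j (s : Sec d F E), ContMDiffAt (𝓡 d) 𝓘(ℝ, ℝ) ∞ (fun x => l j x (s x)) x₀)
    (hinj : ∀ u : E x₀, (∀ j, l j x₀ u = 0) → u = 0) (v : ∀ x, E x)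
    (hv : ∀ j, ContMDiffAt (𝓡 d) 𝓘(ℝ, ℝ) ∞ (fun x => l j x (v x)) x₀) :
    ContMDiffAt (𝓡 d) ((𝓡 d).prod 𝓘(ℝ, F)) ∞ (fun x => TotalSpace.mk' F x (v x)) x₀ := by
  classical
  have : ContMDiffVectorBundle 1 F E (𝓡 d) := ContMDiffVectorBundle.of_le (n := ∞) (by simp)
  let e := trivializationAt F E x₀
  have hx : x₀ ∈ e.baseSet := FiberBundle.mem_baseSet_trivializationAt F E x₀
  let c := Module.finBasis ℝ F
  have hloc := e.isLocalFrameOn_localFrame_baseSet (𝓡 d) ∞ c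
  let b : Fin (Module.finrank ℝ F) → ∀ x, E x := e.localFrame c
  -- the functionals are smooth on the local frame
  have hlb : ∀ j i, ContMDiffAt (𝓡 d) 𝓘(ℝ, ℝ) ∞ (fun x => l j x (b i x)) x₀ := fun j i => by
    -- The hypothesis only concerns global sections, so the frame is cut off by `χ` and the result
    -- divided by `χ` near `x₀`.
    obtain ⟨χ, hχ, hsupp⟩ := exists_bump (d := d) x₀ (e.open_baseSet.mem_nhds hx)
    let B : Sec d F E := ⟨fun y => χ y • b i y, ContMDiffOn.smul_section_of_tsupport
      χ.contMDiff.contMDiffOn e.open_baseSet hsupp (hloc.contMDiffOn i)⟩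
    have h1 := hl j B
    have h2 : ContMDiffAt (𝓡 d) 𝓘(ℝ, ℝ) ∞ (fun y => (χ y)⁻¹ * l j y (B y)) x₀ :=
      (χ.contMDiff.contMDiffAt.inv₀ (by rw [hχ]; exact one_ne_zero)).mul h1
    refine h2.congr_of_eventuallyEq ?_
    have : ∀ᶠ y in 𝓝 x₀, χ y ≠ 0 :=
      χ.contMDiff.continuous.continuousAt.eventually_ne (by rw [hχ]; exact one_ne_zero)
    filter_upwards [this] with y hy
    change _ = (χ y)⁻¹ * l j y (χ y • b i y)
    rw [map_smul, smul_eq_mul, inv_mul_cancel_left₀ hy]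
  -- There may be more functionals than the rank, so the coefficients of `v` are recovered from the
  -- normal equations: `m` is the Gram matrix of the matrix `l_j(b_i)`, and `y` is the corresponding
  -- right-hand side.
  let m : M → Matrix (Fin (Module.finrank ℝ F)) (Fin (Module.finrank ℝ F)) ℝ := fun x =>
    Matrix.of fun i k => ∑ j, l j x (b i x) * l j x (b k x)
  let y : M → Fin (Module.finrank ℝ F) → ℝ := fun x k => ∑ j, l j x (v x) * l j x (b k x)
  have hm : ∀ i k, ContMDiffAt (𝓡 d) 𝓘(ℝ, ℝ) ∞ (fun x => m x i k) x₀ := fun i k => by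
    change ContMDiffAt (𝓡 d) 𝓘(ℝ, ℝ) ∞ (fun x => ∑ j, l j x (b i x) * l j x (b k x)) x₀
    exact contMDiffAt_finsetSum fun j _ => (hlb j i).mul (hlb j k)
  have hy : ∀ k, ContMDiffAt (𝓡 d) 𝓘(ℝ, ℝ) ∞ (fun x => y x k) x₀ := fun k => 
    contMDiffAt_finsetSum fun j _ => (hv j).mul (hlb j k)
  have hdetsm : ∀ m : M → Matrix (Fin (Module.finrank ℝ F)) (Fin (Module.finrank ℝ F)) ℝ,
      (∀ i k, ContMDiffAt (𝓡 d) 𝓘(ℝ, ℝ) ∞ (fun x => m x i k) x₀) →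
      ContMDiffAt (𝓡 d) 𝓘(ℝ, ℝ) ∞ (fun x => (m x).det) x₀ := fun m hm => by
    simp only [Matrix.det_apply']
    exact contMDiffAt_finsetSum fun σ _ => contMDiffAt_const.mul
      (contMDiffAt_finsetProd fun i _ => hm _ _)
  have hadj : ∀ i k, ContMDiffAt (𝓡 d) 𝓘(ℝ, ℝ) ∞ (fun x => (m x).adjugate i k) x₀ := fun i k => by
    simp only [Matrix.adjugate_apply]
    refine hdetsm _ fun p q => ?_
    by_cases hp : p = k
    · subst hp; simpa using contMDiffAt_const
    · simpa [Matrix.updateRow_apply, hp] using hm p q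
  -- A null vector `w` of `m x₀` makes the sum of the squares `l_j(u)²` vanish for `u = ∑ w_i b_i`,
  -- so joint injectivity applies.
  have hdet : (m x₀).det ≠ 0 := by
    intro h0
    obtain ⟨w, hw, hw0⟩ := Matrix.exists_vecMul_eq_zero_iff.2 h0
    let u : E x₀ := ∑ i, w i • b i x₀
    have hu : ∑ j, l j x₀ u * l j x₀ u = 0 := by
      have : ∑ k, (Matrix.vecMul w (m x₀)) k * w k = 0 := by simp [hw0]
      rw [← this]
      simp only [Matrix.vecMul, dotProduct, m, Matrix.of_apply, u, map_sum, map_smul, smul_eq_mul,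
        Finset.sum_mul, Finset.mul_sum]
      rw [Finset.sum_comm]
      refine Finset.sum_congr rfl fun i _ => ?_
      rw [Finset.sum_comm]
      refine Finset.sum_congr rfl fun j _ => ?_
      refine Finset.sum_congr rfl fun k _ => ?_
      ring
    have hu0 : u = 0 := hinj u fun j => by
      have := (Finset.sum_eq_zero_iff_of_nonneg (fun j _ => mul_self_nonneg (l j x₀ u))).1 hu j
        (Finset.mem_univ j)
      exact mul_self_eq_zero.1 this
    exact hw (funext (Fintype.linearIndependent_iff.1 (hloc.linearIndependent hx) w hu0))
  have hnear : ∀ᶠ x in 𝓝 x₀, x ∈ e.baseSet ∧ (m x).det ≠ 0 :=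
    Filter.Eventually.and (e.open_baseSet.mem_nhds hx)
      ((hdetsm m hm).continuousAt.eventually_ne hdet)
  -- Cramer's rule for the normal equations.
  have hsol : ContMDiffAt (𝓡 d) ((𝓡 d).prod 𝓘(ℝ, F)) ∞ (fun x => TotalSpace.mk' F x
      (∑ i, (((m x).det)⁻¹ * ∑ k, y x k * (m x).adjugate k i) • b i x)) x₀ :=
    ContMDiffAt.sum_section fun i _ => ContMDiffAt.smul_section
      (((hdetsm m hm).inv₀ hdet).mul
        (contMDiffAt_finsetSum fun k _ => (hy k).mul (hadj k i)))
      (hloc.contMDiffAt e.open_baseSet hx i)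
  refine hsol.congr_of_eventuallyEq ?_
  filter_upwards [hnear] with x hxx
  congr 1
  have hvx := hloc.coeff_sum_eq v hxx.1
  set w : Fin (Module.finrank ℝ F) → ℝ := fun i => hloc.coeff i x (v x)
  have hyw : y x = Matrix.vecMul w (m x) := by
    funext k
    simp only [y, Matrix.vecMul, dotProduct, m, Matrix.of_apply]
    rw [hvx]
    simp only [map_sum, map_smul, smul_eq_mul, Finset.sum_mul, Finset.mul_sum]
    rw [Finset.sum_comm]
    refine Finset.sum_congr rfl fun i _ => Finset.sum_congr rfl fun j _ => ?_
    ring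
  conv_lhs => rw [hvx]
  refine Finset.sum_congr rfl fun i _ => ?_
  congr 1
  have : ∑ k, y x k * (m x).adjugate k i = (Matrix.vecMul (y x) (m x).adjugate) i := rfl
  rw [this, hyw, Matrix.vecMul_vecMul, Matrix.mul_adjugate, Matrix.vecMul_smul, Matrix.vecMul_one]
  simp [inv_mul_cancel_left₀ hxx.2, w]

/-- In a local frame the trace is the sum of the diagonal coefficients. It gives the smoothness of
`tr(D a)`, and through it that of the derivatives `π(a) f`. -/
theorem contMDiff_trace (L : ∀ x, E x →ₗ[ℝ] E x)
    (hL : ∀ s : Sec d F E, ContMDiff (𝓡 d) ((𝓡 d).prod 𝓘(ℝ, F)) ∞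
      (fun x => TotalSpace.mk' F x (L x (s x)))) :
    ContMDiff (𝓡 d) 𝓘(ℝ, ℝ) ∞ (fun x => LinearMap.trace ℝ (E x) (L x)) := by
  classical
  intro x₀
  have : ContMDiffVectorBundle 1 F E (𝓡 d) := ContMDiffVectorBundle.of_le (n := ∞) (by simp)
  let e := trivializationAt F E x₀
  have hx : x₀ ∈ e.baseSet := FiberBundle.mem_baseSet_trivializationAt F E x₀
  let c := Module.finBasis ℝ F
  have hloc := e.isLocalFrameOn_localFrame_baseSet (𝓡 d) ∞ c
  obtain ⟨χ, hχ, hsupp⟩ := exists_bump (d := d) x₀ (e.open_baseSet.mem_nhds hx)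
  let B : Fin (Module.finrank ℝ F) → Sec d F E := fun i =>
    ⟨fun y => χ y • e.localFrame c i y, ContMDiffOn.smul_section_of_tsupport
      χ.contMDiff.contMDiffOn e.open_baseSet hsupp (hloc.contMDiffOn i)⟩
  have h1 : ContMDiffAt (𝓡 d) 𝓘(ℝ, ℝ) ∞ (fun y => (χ y)⁻¹ *
      ∑ i, e.localFrameCoeff (𝓡 d) c i y (L y (B i y))) x₀ :=
    (χ.contMDiff.contMDiffAt.inv₀ (by rw [hχ]; exact one_ne_zero)).mul
      (contMDiffAt_finsetSum fun i _ => contMDiffAt_localFrameCoeff c hx (hL (B i) x₀) i)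
  refine h1.congr_of_eventuallyEq ?_
  have : ∀ᶠ y in 𝓝 x₀, χ y ≠ 0 :=
      χ.contMDiff.continuous.continuousAt.eventually_ne (by rw [hχ]; exact one_ne_zero)
  filter_upwards [this, e.open_baseSet.mem_nhds hx] with y hy hyb
  rw [LinearMap.trace_eq_matrix_trace ℝ (e.basisAt c hyb), Matrix.trace, Finset.mul_sum]
  refine Finset.sum_congr rfl fun i _ => ?_
  rw [Matrix.diag_apply, LinearMap.toMatrix_apply]
  change _ = (χ y)⁻¹ * (e.localFrameCoeff (𝓡 d) c i y (L y (χ y • e.localFrame c i y)))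
  rw [map_smul, map_smul, smul_eq_mul, inv_mul_cancel_left₀ hy,
    e.localFrame_apply_of_mem_baseSet c hyb]
  -- The coefficient lemma is phrased for sections; any section through the given vector serves,
  -- here one that is zero away from `y`.
  have h2 := e.localFrameCoeff_apply_of_mem_baseSet (I := 𝓡 d) c hyb
    (Function.update (fun _ => 0) y (L y (e.basisAt c hyb i))) i
  rw [Function.update_self] at h2
  exact h2.symm

end Toolkit

end GenGeom
end

open Bundle Manifold
open scoped ContDiff
noncomputable section
set_option linter.unusedSectionVars false
namespace GenGeom

/-! ### Contractions -/

section Contraction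

variable {V : Type*} [AddCommGroup V] [Module ℝ V] {ι : Type*} [Fintype ι] [DecidableEq ι]
  {ι' : Type*} [Fintype ι'] [DecidableEq ι']
  (b : Module.Basis ι ℝ V) (b' : Module.Basis ι' ℝ V) (B : LinearMap.BilinForm ℝ V)

/-- The basis dual to `b` with respect to the bilinear form `B`. -/
def dualVec (k : ι) : V := ∑ j, (Matrix.of fun i j => B (b i) (b j))⁻¹ k j • b j

variable {B} (hs : ∀ u v, B u v = B v u) (hn : ∀ u, (∀ v, B u v = 0) → u = 0)

include hn in
theorem isUnit_gram : IsUnit (Matrix.of fun i j => B (b i) (b j)).det := by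
  rw [isUnit_iff_ne_zero]
  intro h0
  obtain ⟨w, hw, hw0⟩ := Matrix.exists_vecMul_eq_zero_iff.2 h0
  have hu : ∑ i, w i • b i = 0 := hn _ fun v => by
    have : B (∑ i, w i • b i) = 0 := b.ext fun j => by
      have := congrFun hw0 j
      simpa [Matrix.vecMul, dotProduct] using this
    rw [this]; rfl
  exact hw (funext (Fintype.linearIndependent_iff.1 b.linearIndependent w hu))

include hn in
theorem dualVec_apply (i j : ι) : B (dualVec b B i) (b j) = if i = j then 1 else 0 := by
  have := congrFun (congrFun (Matrix.nonsing_inv_mul _ (isUnit_gram b hn)) i) j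
  simpa [Matrix.mul_apply, Matrix.one_apply, dualVec] using this

include hn in
theorem dualVec_eq_repr (i : ι) (v : V) : B (dualVec b B i) v = b.repr v i := by
  calc B (dualVec b B i) v = B (dualVec b B i) (∑ j, b.repr v j • b j) := by rw [b.sum_repr]
    _ = b.repr v i := by
      simp only [map_sum, map_smul, smul_eq_mul, dualVec_apply b hn]
      simp

include hn in
theorem sum_dualVec_smul (v : V) : ∑ i, B (dualVec b B i) v • b i = v := by
  simp [dualVec_eq_repr b hn, b.sum_repr]

include hn hs in
theorem sum_smul_dualVec (v : V) : ∑ i, B (b i) v • dualVec b B i = v := by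
  rw [← sub_eq_zero]
  refine hn _ fun w => ?_
  have : B (∑ i, B (b i) v • dualVec b B i - v) = 0 := b.ext fun j => by
    simp [dualVec_apply b hn, hs v]
  rw [this]; rfl

include hn in
theorem trace_eq_sum_dualVec (L : V →ₗ[ℝ] V) :
    LinearMap.trace ℝ V L = ∑ i, B (dualVec b B i) (L (b i)) := by
  rw [LinearMap.trace_eq_matrix_trace ℝ b, Matrix.trace]
  refine Finset.sum_congr rfl fun i _ => ?_
  rw [Matrix.diag_apply, LinearMap.toMatrix_apply, dualVec_eq_repr b hn]

/-- The inverse Gram matrices are absorbed into the dual vectors by multilinearity of `T`; nothing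
is needed of `S`. -/
theorem contraction_eq_sum {n : ℕ} (S : (Fin n → V) → ℝ)
    (T : MultilinearMap ℝ (fun _ : Fin n => V) ℝ) :
    contraction b B n S T = ∑ I : Fin n → ι, S (fun k => b (I k)) *
      T (fun k => dualVec b B (I k)) := by
  unfold contraction
  refine Finset.sum_congr rfl fun I _ => ?_
  have : T (fun k => dualVec b B (I k)) = ∑ J : Fin n → ι,
      (∏ k, (Matrix.of fun i j => B (b i) (b j))⁻¹ (I k) (J k)) * T (fun k => b (J k)) := by
    unfold dualVec
    rw [MultilinearMap.map_sum T (fun k j => (Matrix.of fun i j => B (b i) (b j))⁻¹ (I k) j • b j)]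
    simp only [MultilinearMap.map_smul_univ, smul_eq_mul]
  rw [this, Finset.mul_sum]
  refine Finset.sum_congr rfl fun J _ => ?_
  ring

include hn hs in
-- The change of basis for `b` and the one for the dual basis are contragredient (`hdelta`), so the
-- transition coefficients cancel slot by slot.
theorem contraction_basis_indep {n : ℕ} (S T : MultilinearMap ℝ (fun _ : Fin n => V) ℝ) :
    contraction b B n S T = contraction b' B n S T := by
  rw [contraction_eq_sum, contraction_eq_sum]
  have hS : ∀ I : Fin n → ι', S (fun k => b' (I k)) =
      ∑ J : Fin n → ι, (∏ k, B (dualVec b B (J k)) (b' (I k))) * S (fun k => b (J k)) := fun I => by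
    conv_lhs => enter [2, k]; rw [← sum_dualVec_smul b hn (b' (I k))]
    rw [MultilinearMap.map_sum S (fun k j => B (dualVec b B j) (b' (I k)) • b j)]
    simp only [MultilinearMap.map_smul_univ, smul_eq_mul]
  have hT : ∀ I : Fin n → ι', T (fun k => dualVec b' B (I k)) =
      ∑ J : Fin n → ι, (∏ k, B (b (J k)) (dualVec b' B (I k))) *
        T (fun k => dualVec b B (J k)) := fun I => by
    conv_lhs => enter [2, k]; rw [← sum_smul_dualVec b hs hn (dualVec b' B (I k))]
    rw [MultilinearMap.map_sum T (fun k j => B (b j) (dualVec b' B (I k)) • dualVec b B j)]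
    simp only [MultilinearMap.map_smul_univ, smul_eq_mul]
  have hdelta : ∀ p q : ι, ∑ i, B (dualVec b B p) (b' i) * B (b q) (dualVec b' B i) =
      if p = q then 1 else 0 := fun p q => by
    rw [← dualVec_apply b hn p q]
    conv_rhs => rw [← sum_dualVec_smul b' hn (b q)]
    simp only [map_sum, map_smul, smul_eq_mul]
    refine Finset.sum_congr rfl fun i _ => ?_
    rw [mul_comm, hs]
  have hprod : ∀ J K : Fin n → ι, ∑ I : Fin n → ι', (∏ k, B (dualVec b B (J k)) (b' (I k))) *
      (∏ k, B (b (K k)) (dualVec b' B (I k))) = if J = K then 1 else 0 := fun J K => by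
    -- A sum over multi-indices of a product over slots is the product over slots of single sums, to
    -- which `hdelta` applies.
    simp only [← Finset.prod_mul_distrib]
    have h := Finset.prod_univ_sum (fun _ : Fin n => (Finset.univ : Finset ι'))
      (fun k i => B (dualVec b B (J k)) (b' i) * B (b (K k)) (dualVec b' B i))
    rw [Fintype.piFinset_univ] at h
    rw [← h]
    simp only [hdelta]
    by_cases h : J = K
    · simp [h]
    · rw [if_neg h]
      obtain ⟨k, hk⟩ := Function.ne_iff.1 h
      exact Finset.prod_eq_zero (Finset.mem_univ k) (by simp [hk])
  symm
  calc ∑ I : Fin n → ι', S (fun k => b' (I k)) * T (fun k => dualVec b' B (I k))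
      = ∑ I : Fin n → ι', ∑ J : Fin n → ι, ∑ K : Fin n → ι,
        ((∏ k, B (dualVec b B (J k)) (b' (I k))) * (∏ k, B (b (K k)) (dualVec b' B (I k)))) *
          (S (fun k => b (J k)) * T (fun k => dualVec b B (K k))) := by
        refine Finset.sum_congr rfl fun I _ => ?_
        rw [hS, hT, Finset.sum_mul_sum]
        refine Finset.sum_congr rfl fun J _ => Finset.sum_congr rfl fun K _ => ?_
        ring
    _ = ∑ J : Fin n → ι, ∑ K : Fin n → ι, (if J = K then 1 else 0) *
          (S (fun k => b (J k)) * T (fun k => dualVec b B (K k))) := by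
        rw [Finset.sum_comm]
        refine Finset.sum_congr rfl fun J _ => ?_
        rw [Finset.sum_comm]
        refine Finset.sum_congr rfl fun K _ => ?_
        rw [← Finset.sum_mul, hprod]
    _ = _ := by simp

include hn hs in
theorem tensorInner_eq_contraction [FiniteDimensional ℝ V] {n : ℕ}
    (S T : MultilinearMap ℝ (fun _ : Fin n => V) ℝ) :
    tensorInner B n S T = contraction b B n S T :=
  contraction_basis_indep _ _ hs hn S T

/-- A linear map as a multilinear function of one variable. -/
def multi₁ (S : V →ₗ[ℝ] ℝ) : MultilinearMap ℝ (fun _ : Fin 1 => V) ℝ where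
  toFun u := S (u 0)
  map_update_add' u i v w := by fin_cases i; simp [Function.update]
  map_update_smul' u i c v := by fin_cases i; simp [Function.update]

/-- A trilinear map as a multilinear function of three variables. -/
def multi₃ (S : V →ₗ[ℝ] V →ₗ[ℝ] V →ₗ[ℝ] ℝ) : MultilinearMap ℝ (fun _ : Fin 3 => V) ℝ where
  toFun u := S (u 0) (u 1) (u 2)
  map_update_add' := by
    intro inst u i v w
    obtain rfl : inst = instDecidableEqFin 3 := Subsingleton.elim _ _
    fin_cases i <;> simp
  map_update_smul' := by
    intro inst u i v w
    obtain rfl : inst = instDecidableEqFin 3 := Subsingleton.elim _ _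
    fin_cases i <;> simp

theorem contraction_one (S T : V →ₗ[ℝ] ℝ) :
    contraction b B 1 (fun u => S (u 0)) (fun u => T (u 0)) =
      ∑ i, S (b i) * T (dualVec b B i) := by
  have := contraction_eq_sum b (B := B) (fun u : Fin 1 → V => S (u 0)) (multi₁ T)
  refine this.trans ?_
  rw [← (Equiv.funUnique (Fin 1) ι).symm.sum_comp]
  rfl

theorem contraction_three (S T : V →ₗ[ℝ] V →ₗ[ℝ] V →ₗ[ℝ] ℝ) :
    contraction b B 3 (fun u => S (u 0) (u 1) (u 2)) (fun u => T (u 0) (u 1) (u 2)) =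
      ∑ i, ∑ j, ∑ k, S (b i) (b j) (b k) *
        T (dualVec b B i) (dualVec b B j) (dualVec b B k) := by
  have := contraction_eq_sum b (B := B) (fun u : Fin 3 → V => S (u 0) (u 1) (u 2)) (multi₃ T)
  refine this.trans ?_
  rw [← (Fin.consEquiv (fun _ : Fin 3 => ι)).sum_comp, Fintype.sum_prod_type]
  refine Finset.sum_congr rfl fun i _ => ?_
  rw [← (Fin.consEquiv (fun _ : Fin 2 => ι)).sum_comp, Fintype.sum_prod_type]
  refine Finset.sum_congr rfl fun j _ => ?_
  rw [← (Fin.consEquiv (fun _ : Fin 1 => ι)).sum_comp, Fintype.sum_prod_type]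
  refine Finset.sum_congr rfl fun k _ => ?_
  simp only [Fintype.sum_unique]
  rfl

theorem contraction_map {V' : Type*} [AddCommGroup V'] [Module ℝ V'] (e : V ≃ₗ[ℝ] V')
    (B' : LinearMap.BilinForm ℝ V') (hB : ∀ u v, B' (e u) (e v) = B u v) {n : ℕ}
    {S T : (Fin n → V) → ℝ} {S' T' : (Fin n → V') → ℝ}
    (hS : ∀ u, S' (fun k => e (u k)) = S u) (hT : ∀ u, T' (fun k => e (u k)) = T u) :
    contraction (b.map e) B' n S' T' = contraction b B n S T := by
  unfold contraction
  simp only [Module.Basis.map_apply, hB, hS, hT]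

end Contraction

end GenGeom
end

open Bundle Manifold
open scoped ContDiff
noncomputable section
set_option linter.unusedSectionVars false
namespace GenGeom

/-! ### The splittings defined by a generalised metric -/

section Splitting

open scoped Topology

variable {d : ℕ} {M : Type*} [TopologicalSpace M] [ChartedSpace (EuclideanSpace ℝ (Fin d)) M]
  [IsManifold (𝓡 d) ∞ M]
  {F : Type*} [NormedAddCommGroup F] [NormedSpace ℝ F]
  {E : M → Type*} [∀ x, AddCommGroup (E x)] [∀ x, Module ℝ (E x)]
  [∀ x, TopologicalSpace (E x)] [TopologicalSpace (TotalSpace F E)]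
  [FiberBundle F E] [VectorBundle ℝ F E] [FiniteDimensional ℝ F]
  {C : CourantAlgebroid d F E}

namespace CourantAlgebroid

@[simp] theorem anchorSec_apply (a : Sec d F E) (x : M) : C.anchorSec a x = C.anchor x (a x) := rfl

theorem IsExact.ker_isotropic (hC : C.IsExact) {x : M} {u v : E x} (hu : C.anchor x u = 0)
    (hv : C.anchor x v = 0) : C.pairing x u v = 0 := by
  obtain ⟨ξ, hξ⟩ := (hC.ker_eq x u).1 hu
  rw [hξ, hv, map_zero]

variable (C) in
theorem exists_pairing_eq (x : M) (ξ : E x →ₗ[ℝ] ℝ) : ∃ u, ∀ v, C.pairing x u v = ξ v := by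
  have : FiniteDimensional ℝ (E x) := VectorBundle.finiteDimensional ℝ F E x
  have hinj : Function.Injective (C.pairing x : E x →ₗ[ℝ] E x →ₗ[ℝ] ℝ) := by
    rw [← LinearMap.ker_eq_bot, LinearMap.ker_eq_bot']
    exact fun u hu => C.pairing_nondeg x u fun v => by rw [hu]; rfl
  have hsurj := (LinearMap.injective_iff_surjective_of_finrank_eq_finrank
    (Subspace.dual_finrank_eq (K := ℝ) (V := E x)).symm).1 hinj
  obtain ⟨u, hu⟩ := hsurj ξ
  exact ⟨u, fun v => by rw [hu]⟩

theorem IsExact.exists_ker (hC : C.IsExact) {x : M} (ξ : TM d x →ₗ[ℝ] ℝ) :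
    ∃ u, C.anchor x u = 0 ∧ ∀ v, C.pairing x u v = ξ (C.anchor x v) := by
  obtain ⟨u, hu⟩ := C.exists_pairing_eq x (ξ ∘ₗ C.anchor x)
  exact ⟨u, (hC.ker_eq x u).2 ⟨ξ, hu⟩, hu⟩

variable (G : C.GenMetric)

/-- `T*M` and its image under `𝒢^end` meet in zero: as `T*M` is isotropic, a common vector lies in
the radical of `𝒢` on `T*M`. -/
theorem GenMetric.eq_zero (hC : C.IsExact) {x : M} {v : E x} (h1 : C.anchor x v = 0)
    (h2 : C.anchor x (G.endo x v) = 0) : v = 0 :=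
  G.nondeg_ker x v h1 fun _ hw => hC.ker_isotropic h2 hw

/-- Duality: a covector `ξ` that annihilates `π(𝒢^end(T*M))`, viewed in `E`, is `𝒢`-orthogonal to
`T*M` and hence zero. -/
theorem GenMetric.exists_lift (hC : C.IsExact) (x : M) (X : TM d x) :
    ∃ v, C.anchor x v = X ∧ C.anchor x (G.endo x v) = 0 := by
  suffices h : LinearMap.range ((C.anchor x ∘ₗ G.endo x).domRestrict (LinearMap.ker (C.anchor x)))
      = ⊤ by
    have hX : X ∈ (⊤ : Submodule ℝ (TM d x)) := trivial
    rw [← h] at hX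
    obtain ⟨⟨u, hu⟩, hX⟩ := hX
    exact ⟨G.endo x u, hX, by rw [G.endo_endo]; exact hu⟩
  by_contra hne
  obtain ⟨ξ, hξ, hle⟩ := Submodule.exists_le_ker_of_lt_top _ (lt_top_iff_ne_top.2 hne)
  obtain ⟨w, hw, hwξ⟩ := hC.exists_ker ξ
  have hw0 : w = 0 := G.nondeg_ker x w hw fun v hv => by
    rw [G.endo_symm, hwξ]
    exact hle ⟨⟨v, hv⟩, rfl⟩
  apply hξ
  ext X
  obtain ⟨v, rfl⟩ := hC.surjective x X
  rw [← hwξ, hw0]; simp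

/-- The right inverse `TM → E` of the anchor with values in `𝒢^end(T*M)`. -/
def GenMetric.lift (hC : C.IsExact) (x : M) : TM d x →ₗ[ℝ] E x where
  toFun X := Classical.choose (G.exists_lift hC x X)
  map_add' X Y := by
    have hX := Classical.choose_spec (G.exists_lift hC x X)
    have hY := Classical.choose_spec (G.exists_lift hC x Y)
    have hXY := Classical.choose_spec (G.exists_lift hC x (X + Y))
    rw [← sub_eq_zero]
    refine G.eq_zero hC ?_ ?_
    · rw [map_sub, map_add, hX.1, hY.1, hXY.1, sub_self]
    · rw [map_sub, map_sub, map_add, map_add, hX.2, hY.2, hXY.2]; simp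
  map_smul' r X := by
    have hX := Classical.choose_spec (G.exists_lift hC x X)
    have hrX := Classical.choose_spec (G.exists_lift hC x (r • X))
    rw [← sub_eq_zero]
    refine G.eq_zero hC ?_ ?_
    · rw [map_sub, RingHom.id_apply, map_smul, hX.1, hrX.1, sub_self]
    · rw [map_sub, map_sub, RingHom.id_apply, map_smul, map_smul, hX.2, hrX.2]; simp

variable (hC : C.IsExact)

@[simp] theorem GenMetric.anchor_lift (x : M) (X : TM d x) : C.anchor x (G.lift hC x X) = X :=
  (Classical.choose_spec (G.exists_lift hC x X)).1

@[simp] theorem GenMetric.anchor_endo_lift (x : M) (X : TM d x) :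
    C.anchor x (G.endo x (G.lift hC x X)) = 0 :=
  (Classical.choose_spec (G.exists_lift hC x X)).2

theorem GenMetric.eq_lift {x : M} {v : E x} (h : C.anchor x (G.endo x v) = 0) :
    v = G.lift hC x (C.anchor x v) := by
  rw [← sub_eq_zero]
  exact G.eq_zero hC (by simp) (by simp [h])

theorem GenMetric.pairing_endo_endo (x : M) (u v : E x) :
    C.pairing x (G.endo x u) (G.endo x v) = C.pairing x u v := by
  rw [G.endo_symm, G.endo_endo]

theorem GenMetric.pairing_lift_lift (x : M) (X Y : TM d x) :
    C.pairing x (G.lift hC x X) (G.lift hC x Y) = 0 := by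
  rw [← G.pairing_endo_endo]
  exact hC.ker_isotropic (by simp) (by simp)

/-- Reflects that `𝒢^end` interchanges the two summands of `E = 𝒢^end(T*M) ⊕ T*M`: applying it to
the first component of `u` gives the `T*M`-component of `𝒢^end u`. -/
theorem GenMetric.endo_lift_add (x : M) (u : E x) :
    G.endo x (G.lift hC x (C.anchor x u)) + G.lift hC x (C.anchor x (G.endo x u)) =
      G.endo x u := by
  have := G.eq_lift hC (v := G.endo x u - G.endo x (G.lift hC x (C.anchor x u)))
    (by simp [G.endo_endo])
  rw [map_sub, G.anchor_endo_lift, sub_zero, sub_eq_iff_eq_add'] at this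
  exact this.symm

/-- The projection `(1 + ε 𝒢^end) / 2`; for `ε = ± 1` this is the projection to `E_±`. -/
def GenMetric.proj (ε : ℝ) (x : M) : E x →ₗ[ℝ] E x :=
  (1 / 2 : ℝ) • (LinearMap.id + ε • G.endo x)

theorem GenMetric.proj_apply (ε : ℝ) (x : M) (u : E x) :
    G.proj ε x u = (1 / 2 : ℝ) • (u + ε • G.endo x u) := rfl

theorem GenMetric.endo_proj {ε : ℝ} (hε : ε * ε = 1) (x : M) (u : E x) :
    G.endo x (G.proj ε x u) = ε • G.proj ε x u := by
  simp only [G.proj_apply, map_smul, map_add, G.endo_endo, smul_add, smul_smul]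
  rw [mul_left_comm, hε, add_comm, mul_comm ε]; simp

theorem GenMetric.proj_eq_self {ε : ℝ} (hε : ε * ε = 1) {x : M} {u : E x}
    (hu : G.endo x u = ε • u) : G.proj ε x u = u := by
  rw [G.proj_apply, hu, smul_smul, hε, one_smul, ← two_smul ℝ, smul_smul]; norm_num

theorem GenMetric.proj_eq_zero {ε : ℝ} (hε : ε * ε = 1) {x : M} {u : E x}
    (hu : G.endo x u = (-ε) • u) : G.proj ε x u = 0 := by
  rw [G.proj_apply, hu, smul_smul, mul_neg, hε]; simp

theorem GenMetric.proj_neg_eq_zero {ε : ℝ} (hε : ε * ε = 1) {x : M} {u : E x}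
    (hu : G.endo x u = ε • u) : G.proj (-ε) x u = 0 := by
  rw [G.proj_apply, hu, smul_smul, neg_mul, hε]; simp

theorem GenMetric.proj_add_proj (ε : ℝ) (x : M) (u : E x) :
    G.proj ε x u + G.proj (-ε) x u = u := by
  simp only [G.proj_apply]; module

theorem GenMetric.pairing_proj (ε : ℝ) (x : M) (u v : E x) :
    C.pairing x (G.proj ε x u) v = C.pairing x u (G.proj ε x v) := by
  simp [G.proj_apply, G.endo_symm]

theorem GenMetric.pairing_eq_zero {ε : ℝ} (hε : ε * ε = 1) {x : M} {u v : E x}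
    (hu : G.endo x u = ε • u) (hv : G.endo x v = (-ε) • v) : C.pairing x u v = 0 := by
  have h := G.pairing_endo_endo x u v
  rw [hu, hv] at h
  simp only [map_smul, LinearMap.smul_apply, smul_eq_mul] at h
  linear_combination (-1 / 2) * h - (1 / 2) * hε * C.pairing x u v

/-- The reflection of `E` which is `1` on `𝒢^end(T*M)` and `-1` on `T*M`. It interchanges `E_+` and
`E_-` and is compatible with the anchor. -/
def GenMetric.refl (x : M) : E x →ₗ[ℝ] E x :=
  (2 : ℝ) • (G.lift hC x ∘ₗ C.anchor x) - LinearMap.id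

theorem GenMetric.refl_apply (x : M) (u : E x) :
    G.refl hC x u = (2 : ℝ) • G.lift hC x (C.anchor x u) - u := rfl

@[simp] theorem GenMetric.anchor_refl (x : M) (u : E x) :
    C.anchor x (G.refl hC x u) = C.anchor x u := by
  rw [G.refl_apply, map_sub, map_smul, G.anchor_lift, two_smul, add_sub_cancel_right]

theorem GenMetric.refl_refl (x : M) (u : E x) : G.refl hC x (G.refl hC x u) = u := by
  conv_lhs => rw [G.refl_apply, G.anchor_refl, G.refl_apply]
  abel

/-- Since `𝒢^end` swaps the eigenspaces of the reflection, the two anticommute. -/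
theorem GenMetric.endo_refl (x : M) (u : E x) :
    G.endo x (G.refl hC x u) = -G.refl hC x (G.endo x u) := by
  have := G.endo_lift_add hC x u
  rw [G.refl_apply, G.refl_apply, map_sub, map_smul]
  rw [← eq_sub_iff_add_eq] at this
  rw [this]; module

/-- Both eigenspaces of the reflection are isotropic, so only pairings between opposite eigenvalues
survive. Together with `refl_refl` this makes the reflection an anti-isometry. -/
theorem GenMetric.pairing_refl (x : M) (u v : E x) :
    C.pairing x (G.refl hC x u) v = -C.pairing x u (G.refl hC x v) := by
  have h1 : C.pairing x (u - G.lift hC x (C.anchor x u)) (v - G.lift hC x (C.anchor x v)) = 0 :=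
    hC.ker_isotropic (by simp) (by simp)
  have h2 := G.pairing_lift_lift hC x (C.anchor x u) (C.anchor x v)
  simp only [G.refl_apply, map_sub, map_smul, LinearMap.sub_apply, LinearMap.smul_apply,
    smul_eq_mul] at h1 ⊢
  linear_combination -2 * h1 + 2 * h2

theorem GenMetric.endo_refl_of_mem {ε : ℝ} {x : M} {u : E x} (hu : G.endo x u = ε • u) :
    G.endo x (G.refl hC x u) = (-ε) • G.refl hC x u := by
  rw [G.endo_refl, hu, map_smul, neg_smul]

include hC in
theorem GenMetric.eq_of_anchor_eq {ε : ℝ} {x : M} {u v : E x}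
    (hu : G.endo x u = ε • u) (hv : G.endo x v = ε • v) (h : C.anchor x u = C.anchor x v) :
    u = v := by
  rw [← sub_eq_zero]
  exact G.eq_zero hC (by simp [h]) (by simp [hu, hv, h])

/-- The inverse `TM → E_±` of the anchor, for `ε = ± 1`. -/
def GenMetric.liftE (ε : ℝ) (x : M) : TM d x →ₗ[ℝ] E x :=
  G.lift hC x + ε • (G.endo x ∘ₗ G.lift hC x)

theorem GenMetric.liftE_apply (ε : ℝ) (x : M) (X : TM d x) :
    G.liftE hC ε x X = G.lift hC x X + ε • G.endo x (G.lift hC x X) := rfl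

@[simp] theorem GenMetric.anchor_liftE (ε : ℝ) (x : M) (X : TM d x) :
    C.anchor x (G.liftE hC ε x X) = X := by
  simp [G.liftE_apply]

theorem GenMetric.endo_liftE {ε : ℝ} (hε : ε * ε = 1) (x : M) (X : TM d x) :
    G.endo x (G.liftE hC ε x X) = ε • G.liftE hC ε x X := by
  simp only [G.liftE_apply, map_add, map_smul, G.endo_endo, smul_add, smul_smul, hε, one_smul]
  rw [add_comm]

theorem GenMetric.eq_liftE {ε : ℝ} (hε : ε * ε = 1) {x : M} {u : E x}
    (hu : G.endo x u = ε • u) : u = G.liftE hC ε x (C.anchor x u) :=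
  G.eq_of_anchor_eq hC hu (G.endo_liftE hC hε x _) (by simp)

theorem GenMetric.refl_liftE (ε : ℝ) (x : M) (X : TM d x) :
    G.refl hC x (G.liftE hC ε x X) = G.liftE hC (-ε) x X := by
  rw [G.refl_apply, G.anchor_liftE, G.liftE_apply, G.liftE_apply]; module

theorem GenMetric.form_apply (x : M) (u v : E x) :
    G.form x u v = C.pairing x (G.endo x u) v := rfl

theorem GenMetric.form_symm (x : M) (u v : E x) : G.form x u v = G.form x v u := by
  rw [G.form_apply, G.form_apply, G.endo_symm, C.pairing_symm]

theorem GenMetric.form_nondeg (x : M) (u : E x) (h : ∀ v, G.form x u v = 0) : u = 0 := by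
  have := C.pairing_nondeg x (G.endo x u) h
  rw [← G.endo_endo x u, this, map_zero]

/-! #### The corresponding operations on sections -/

/-- The section `𝒢^end a`. -/
def GenMetric.endoSec (a : Sec d F E) : Sec d F E := ⟨fun x => G.endo x (a x), G.endo_smooth a⟩

@[simp] theorem GenMetric.endoSec_apply (a : Sec d F E) (x : M) :
    G.endoSec a x = G.endo x (a x) := rfl

/-- The component of a section in `E_±`. -/
def GenMetric.projSec (ε : ℝ) (a : Sec d F E) : Sec d F E := (1 / 2 : ℝ) • (a + ε • G.endoSec a)

@[simp] theorem GenMetric.projSec_apply (ε : ℝ) (a : Sec d F E) (x : M) :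
    G.projSec ε a x = G.proj ε x (a x) := rfl

variable [T2Space M] [SigmaCompactSpace M] [ContMDiffVectorBundle ∞ F E (𝓡 d)]

/-- The lift is tested by the frame components of `π` and of `π ∘ 𝒢^end`. They are jointly injective
by `GenMetric.eq_zero` and take on the lift the components of `X` and 0. -/
theorem GenMetric.lift_smooth (X : VF d M) : ContMDiff (𝓡 d) ((𝓡 d).prod 𝓘(ℝ, F)) ∞
    (fun x => TotalSpace.mk' F x (G.lift hC x (X x))) := by
  classical
  intro x₀
  let e := trivializationAt (EuclideanSpace ℝ (Fin d)) (fun x : M => TM d x) x₀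
  have hx : x₀ ∈ e.baseSet := FiberBundle.mem_baseSet_trivializationAt _ _ x₀
  have : IsManifold (𝓡 d) 1 M := IsManifold.of_le (n := ∞) (by simp)
  have : ContMDiffVectorBundle 1 (EuclideanSpace ℝ (Fin d)) (fun x : M => TM d x) (𝓡 d) :=
    ContMDiffVectorBundle.of_le (n := ∞) (by simp)
  let c := Module.finBasis ℝ (EuclideanSpace ℝ (Fin d))
  let co := e.localFrameCoeff (𝓡 d) c
  have hco : ∀ Y : VF d M, ∀ i, ContMDiffAt (𝓡 d) 𝓘(ℝ, ℝ) ∞ (fun x => co i x (Y x)) x₀ :=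
    fun Y i => contMDiffAt_localFrameCoeff c hx Y.contMDiff.contMDiffAt i
  have hco0 : ∀ Y : TM d x₀, (∀ i, co i x₀ Y = 0) → Y = 0 := fun Y hY => by
    refine (e.basisAt c hx).ext_elem fun i => ?_
    have h2 := e.localFrameCoeff_apply_of_mem_baseSet (I := 𝓡 d) c hx
      (Function.update (fun _ => 0) x₀ Y) i
    rw [Function.update_self] at h2
    rw [← h2, map_zero]
    exact hY i
  refine contMDiffAt_of_functionals (d := d)
    (fun j : Fin (Module.finrank ℝ (EuclideanSpace ℝ (Fin d))) × Bool => fun x =>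
      co j.1 x ∘ₗ C.anchor x ∘ₗ (if j.2 then LinearMap.id else G.endo x)) x₀ ?_ ?_ _ ?_
  · rintro ⟨i, b⟩ s
    cases b
    · exact hco (C.anchorSec (G.endoSec s)) i
    · exact hco (C.anchorSec s) i
  · intro u hu
    exact G.eq_zero hC (hco0 _ fun i => hu (i, true)) (hco0 _ fun i => hu (i, false))
  · rintro ⟨i, b⟩
    cases b
    · simpa using contMDiffAt_const
    · simpa using hco X i

/-- The section of `𝒢^end(T*M)` over a vector field. -/
def GenMetric.liftSec (X : VF d M) : Sec d F E := ⟨fun x => G.lift hC x (X x), G.lift_smooth hC X⟩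

@[simp] theorem GenMetric.liftSec_apply (X : VF d M) (x : M) :
    G.liftSec hC X x = G.lift hC x (X x) := rfl

/-- The section of `E_±` over a vector field. -/
def GenMetric.liftESec (ε : ℝ) (X : VF d M) : Sec d F E :=
  G.liftSec hC X + ε • G.endoSec (G.liftSec hC X)

@[simp] theorem GenMetric.liftESec_apply (ε : ℝ) (X : VF d M) (x : M) :
    G.liftESec hC ε X x = G.liftE hC ε x (X x) := rfl

/-- The reflection applied to a section. -/
def GenMetric.reflSec (a : Sec d F E) : Sec d F E := (2 : ℝ) • G.liftSec hC (C.anchorSec a) - a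

@[simp] theorem GenMetric.reflSec_apply (a : Sec d F E) (x : M) :
    G.reflSec hC a x = G.refl hC x (a x) := rfl

end CourantAlgebroid

end Splitting

end GenGeom
end

open Bundle Manifold
open scoped ContDiff
noncomputable section
set_option linter.unusedSectionVars false
namespace GenGeom

/-! ### The Dorfman bracket and the generalised metric -/

section Bracket

variable {d : ℕ} {M : Type*} [TopologicalSpace M] [ChartedSpace (EuclideanSpace ℝ (Fin d)) M]
  [IsManifold (𝓡 d) ∞ M]
  {F : Type*} [NormedAddCommGroup F] [NormedSpace ℝ F]
  {E : M → Type*} [∀ x, AddCommGroup (E x)] [∀ x, Module ℝ (E x)]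
  [∀ x, TopologicalSpace (E x)] [TopologicalSpace (TotalSpace F E)]
  [FiberBundle F E] [VectorBundle ℝ F E]

namespace CourantAlgebroid

variable (C : CourantAlgebroid d F E)

/-- The function `⟨a, b⟩` of two sections. -/
def pair (a b : Sec d F E) : Fun d M := ⟨fun x => C.pairing x (a x) (b x), C.pairing_smooth a b⟩

@[simp] theorem pair_apply (a b : Sec d F E) (x : M) : C.pair a b x = C.pairing x (a x) (b x) := rfl

theorem fun_mdiff (f : Fun d M) (x : M) : MDifferentiableAt (𝓡 d) 𝓘(ℝ, ℝ) f x :=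
  f.contMDiff.mdifferentiableAt (by simp)

theorem mvfderiv_fun_mul' (f h : Fun d M) (x : M) (u : TM d x) :
    mvfderiv (𝓡 d) (fun y => f y * h y) x u =
      f x * mvfderiv (𝓡 d) h x u + h x * mvfderiv (𝓡 d) f x u := by
  rw [mvfderiv_fun_mul (fun_mdiff f x) (fun_mdiff h x)]; rfl

theorem mvfderiv_fun_add' (f h : Fun d M) (x : M) (u : TM d x) :
    mvfderiv (𝓡 d) (fun y => f y + h y) x u =
      mvfderiv (𝓡 d) f x u + mvfderiv (𝓡 d) h x u := by
  rw [mvfderiv_fun_add (fun_mdiff f x) (fun_mdiff h x)]; rfl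

theorem mvfderiv_fun_neg' (f : M → ℝ) (x : M) (u : TM d x) :
    mvfderiv (𝓡 d) (fun y => -f y) x u = -mvfderiv (𝓡 d) f x u := by
  rw [mvfderiv_fun_neg]; rfl

theorem bracket_pairing_eq (a b c : Sec d F E) (x : M) :
    mvfderiv (𝓡 d) (C.pair b c) x (C.anchor x (a x)) =
      C.pairing x (C.bracket a b x) (c x) + C.pairing x (b x) (C.bracket a c x) :=
  C.bracket_pairing a b c x

/-- Polarisation of `bracket_self`. -/
theorem bracket_symm (a b c : Sec d F E) (x : M) :
    C.pairing x (C.bracket a b x) (c x) + C.pairing x (C.bracket b a x) (c x) =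
      mvfderiv (𝓡 d) (C.pair a b) x (C.anchor x (c x)) := by
  have h := C.bracket_self (a + b) c x
  have ha := C.bracket_self a c x
  have hb := C.bracket_self b c x
  have e : (fun y => C.pairing y ((a + b) y) ((a + b) y)) =
      fun y => (C.pair a a + C.pair b b : Fun d M) y + (C.pair a b + C.pair a b : Fun d M) y := by
    funext y
    simp [C.pairing_symm y (b y) (a y)]; ring
  rw [e, mvfderiv_fun_add', show ⇑(C.pair a a + C.pair b b : Fun d M) = fun y =>
    C.pair a a y + C.pair b b y from rfl, mvfderiv_fun_add',
    show ⇑(C.pair a b + C.pair a b : Fun d M) = fun y => C.pair a b y + C.pair a b y from rfl,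
    mvfderiv_fun_add'] at h
  change 2 * _ = mvfderiv (𝓡 d) (C.pair a a) x (C.anchor x (c x)) at ha
  change 2 * _ = mvfderiv (𝓡 d) (C.pair b b) x (C.anchor x (c x)) at hb
  simp only [map_add, LinearMap.add_apply, Sec.add_apply] at h
  linarith

variable {C} in
/-- If `⟨a, b⟩ = 0` then `[a, b] = -[b, a]`. -/
theorem bracket_skew {a b : Sec d F E} (h : ∀ x, C.pairing x (a x) (b x) = 0) (c : Sec d F E)
    (x : M) : C.pairing x (C.bracket a b x) (c x) = -C.pairing x (C.bracket b a x) (c x) := by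
  have h1 := C.bracket_symm a b c x
  rw [show ⇑(C.pair a b) = fun _ => (0 : ℝ) from funext h, mvfderiv_const] at h1
  simp at h1
  linarith

variable {C} in
/-- If `⟨b, c⟩ = 0` then `⟨[a, b], c⟩ = -⟨b, [a, c]⟩`. -/
theorem bracket_pairing_skew {b c : Sec d F E} (h : ∀ x, C.pairing x (b x) (c x) = 0)
    (a : Sec d F E) (x : M) :
    C.pairing x (C.bracket a b x) (c x) = -C.pairing x (C.bracket a c x) (b x) := by
  have h1 := C.bracket_pairing_eq a b c x
  rw [show ⇑(C.pair b c) = fun _ => (0 : ℝ) from funext h, mvfderiv_const,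
    C.pairing_symm x (b x)] at h1
  simp at h1
  linarith

/-- The Leibniz rule of the right slot is carried to the left one by `bracket_symm`. The last term,
which is no ordinary Leibniz term, is the obstruction to tensoriality of the curvature. -/
theorem pairing_fsmul_bracket (f : Fun d M) (a b c : Sec d F E) (x : M) :
    C.pairing x (C.bracket (fsmul f a) b x) (c x) = f x * C.pairing x (C.bracket a b x) (c x)
      - mvfderiv (𝓡 d) f x (C.anchor x (b x)) * C.pairing x (a x) (c x)
      + mvfderiv (𝓡 d) f x (C.anchor x (c x)) * C.pairing x (a x) (b x) := by
  have h1 := C.bracket_symm (fsmul f a) b c x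
  have h2 := C.bracket_symm a b c x
  rw [C.bracket_fsmul, show ⇑(C.pair (fsmul f a) b) = fun y => f y * C.pair a b y by
    funext y; simp, mvfderiv_fun_mul'] at h1
  simp only [map_add, map_smul, LinearMap.add_apply, LinearMap.smul_apply, smul_eq_mul,
    pair_apply] at h1
  linear_combination h1 - f x * h2

variable {C} in
-- Compatibility with the pairing reduces the claim to `⟨b, [a, c]⟩ = ξ(π[a, c])`, and `π[a, c] =
-- [πa, πc]` vanishes with `πa`.
theorem IsExact.bracket_ker (hC : C.IsExact) {a b : Sec d F E} (ha : ∀ x, C.anchor x (a x) = 0)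
    (hb : ∀ x, C.anchor x (b x) = 0) (c : Sec d F E) (x : M) :
    C.pairing x (C.bracket a b x) (c x) = 0 := by
  have h := C.bracket_pairing_eq a b c x
  rw [ha, map_zero] at h
  have h2 : C.pairing x (b x) (C.bracket a c x) = 0 := by
    obtain ⟨ξ, hξ⟩ := (hC.ker_eq x (b x)).1 (hb x)
    rw [hξ, C.anchor_bracket, show (fun y => C.anchor y (a y)) = 0 from funext ha,
      VectorField.mlieBracket_zero_left]
    simp
  linarith

variable {C}

theorem pairing_ext (x : M) {u v : E x} (h : ∀ w, C.pairing x u w = C.pairing x v w) : u = v := by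
  rw [← sub_eq_zero]
  exact C.pairing_nondeg x _ fun w => by rw [map_sub, LinearMap.sub_apply, h, sub_self]

variable [T2Space M] [SigmaCompactSpace M] [FiniteDimensional ℝ F]
  [ContMDiffVectorBundle ∞ F E (𝓡 d)]

theorem pairing_ext_sec (x : M) {u v : E x}
    (h : ∀ c : Sec d F E, C.pairing x u (c x) = C.pairing x v (c x)) : u = v :=
  pairing_ext x fun w => by
    have := h (GenGeom.ext w)
    rwa [ext_apply] at this

variable (G : C.GenMetric) (hC : C.IsExact)

/-- `a` is a section of the eigenbundle of `𝒢^end` for the eigenvalue `ε`. -/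
def GenMetric.IsPure (ε : ℝ) (a : Sec d F E) : Prop := ∀ x, G.endo x (a x) = ε • a x

variable {G} {ε : ℝ}

theorem GenMetric.isPure_projSec (hε : ε * ε = 1) (a : Sec d F E) : G.IsPure ε (G.projSec ε a) :=
  fun x => G.endo_proj hε x (a x)

theorem GenMetric.IsPure.projSec (hε : ε * ε = 1) {a : Sec d F E} (ha : G.IsPure ε a) :
    G.projSec ε a = a := by
  ext x; exact G.proj_eq_self hε (ha x)

theorem GenMetric.IsPure.projSec_neg (hε : ε * ε = 1) {a : Sec d F E} (ha : G.IsPure ε a) :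
    G.projSec (-ε) a = 0 := by
  ext x; exact G.proj_neg_eq_zero hε (ha x)

theorem GenMetric.IsPure.projSec_zero (hε : ε * ε = 1) {a : Sec d F E} (ha : G.IsPure (-ε) a) :
    G.projSec ε a = 0 := by
  ext x; exact G.proj_eq_zero hε (ha x)

theorem GenMetric.IsPure.reflSec {a : Sec d F E} (ha : G.IsPure ε a) :
    G.IsPure (-ε) (G.reflSec hC a) :=
  fun x => G.endo_refl_of_mem hC (ha x)

theorem GenMetric.IsPure.reflSec' {a : Sec d F E} (ha : G.IsPure (-ε) a) :
    G.IsPure ε (G.reflSec hC a) := by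
  have := ha.reflSec hC
  rwa [neg_neg] at this

theorem GenMetric.isPure_liftESec (hε : ε * ε = 1) (X : VF d M) :
    G.IsPure ε (G.liftESec hC ε X) :=
  fun x => G.endo_liftE hC hε x (X x)

theorem GenMetric.IsPure.eq_liftESec (hε : ε * ε = 1) {a : Sec d F E} (ha : G.IsPure ε a) :
    a = G.liftESec hC ε (C.anchorSec a) := by
  ext x; exact G.eq_liftE hC hε (ha x)

theorem GenMetric.reflSec_liftESec (ε : ℝ) (X : VF d M) :
    G.reflSec hC (G.liftESec hC ε X) = G.liftESec hC (-ε) X := by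
  ext x; exact G.refl_liftE hC ε x (X x)

@[simp] theorem GenMetric.reflSec_reflSec (a : Sec d F E) :
    G.reflSec hC (G.reflSec hC a) = a := by
  ext x; exact G.refl_refl hC x (a x)

theorem GenMetric.IsPure.pairing_eq_zero (hε : ε * ε = 1) {a b : Sec d F E} (ha : G.IsPure ε a)
    (hb : G.IsPure (-ε) b) (x : M) : C.pairing x (a x) (b x) = 0 :=
  G.pairing_eq_zero hε (ha x) (hb x)

theorem GenMetric.IsPure.pairing_eq_zero' (hε : ε * ε = 1) {a b : Sec d F E}
    (ha : G.IsPure (-ε) a) (hb : G.IsPure ε b) (x : M) : C.pairing x (a x) (b x) = 0 := by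
  rw [C.pairing_symm]; exact hb.pairing_eq_zero hε ha x

variable (G) in
theorem GenMetric.projSec_add_projSec (ε : ℝ) (a : Sec d F E) :
    a = G.projSec ε a + G.projSec (-ε) a := by
  ext x; exact (G.proj_add_proj ε x (a x)).symm

section PureBracket

variable {a b c : Sec d F E} (ha : G.IsPure ε a) (hb : G.IsPure ε b) (hc : G.IsPure ε c)

include ha hb hc in
/-- The bracket of pure sections in terms of mixed brackets. -/
theorem bracket_pure (hε : ε * ε = 1) (x : M) :
    C.pairing x (C.bracket a b x) (c x) =
      C.pairing x (C.bracket (G.reflSec hC a) b x) (c x)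
      - C.pairing x (C.bracket (G.reflSec hC b) a x) (c x)
      - C.pairing x (C.bracket c (G.reflSec hC a) x) (G.reflSec hC b x) := by
  -- The differences `a - ρa` and `b - ρb` lie in `T*M`. Expanding their vanishing bracket expresses
  -- `[a, b]` by `[a, ρb]`, `[ρa, b]` and `[ρa, ρb]`, and orthogonality turns each of these into a
  -- mixed bracket.
  have h0 := hC.bracket_ker (a := a - G.reflSec hC a) (b := b - G.reflSec hC b)
    (fun y => by simp) (fun y => by simp) c x
  have h1 := bracket_skew (ha.pairing_eq_zero hε (hb.reflSec hC)) c x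
  have h2 := bracket_pairing_skew ((hb.reflSec hC).pairing_eq_zero' hε hc) (G.reflSec hC a) x
  have h3 := bracket_skew ((ha.reflSec hC).pairing_eq_zero' hε hc) (G.reflSec hC b) x
  simp only [map_sub, LinearMap.sub_apply, Sec.sub_apply] at h0
  linarith

variable (G) in
/-- The three-form `H`, evaluated on sections of `E_±`. -/
def GenMetric.flux (a b c : Sec d F E) (x : M) : ℝ :=
  C.pairing x (C.bracket (G.reflSec hC a) b x) (c x) +
    C.pairing x (C.bracket a (G.reflSec hC b) x) (G.reflSec hC c x)

include hb hc in
-- Both summands come from metric derivatives along `πa`; as `⟨ρb, ρc⟩ = -⟨b, c⟩`, the derivative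
-- terms cancel.
theorem GenMetric.flux_skew_right (x : M) : G.flux hC a b c x = -G.flux hC a c b x := by
  have h1 := C.bracket_pairing_eq (G.reflSec hC a) b c x
  have h2 := C.bracket_pairing_eq a (G.reflSec hC b) (G.reflSec hC c) x
  have h3 : ⇑(C.pair (G.reflSec hC b) (G.reflSec hC c)) = fun y => -C.pair b c y := by
    funext y
    simp [G.pairing_refl, G.refl_refl]
  rw [h3, mvfderiv_fun_neg'] at h2
  simp only [GenMetric.reflSec_apply, GenMetric.anchor_refl] at h1
  rw [C.pairing_symm x (b x)] at h1
  rw [C.pairing_symm x (G.reflSec hC b x)] at h2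
  simp only [GenMetric.flux]
  linarith

include ha hb hc in
-- The symmetrisation in `a, b` is `⟨[ρa, b] + [ρb, a], c - ρc⟩`. Since `c - ρc` lies in `T*M`, it
-- only sees the anchors of the brackets, which are `[πa, πb]` and `[πb, πa]`.
theorem GenMetric.flux_skew_left (hε : ε * ε = 1) (x : M) :
    G.flux hC a b c x = -G.flux hC b a c x := by
  have h1 := bracket_skew (ha.pairing_eq_zero hε (hb.reflSec hC)) (G.reflSec hC c) x
  have h2 := bracket_skew (hb.pairing_eq_zero hε (ha.reflSec hC)) (G.reflSec hC c) x
  have hk : C.anchor x (c x - G.reflSec hC c x) = 0 := by simp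
  obtain ⟨ξ, hξ⟩ := (hC.ker_eq x _).1 hk
  have h3 := hξ (C.bracket (G.reflSec hC a) b x)
  have h4 := hξ (C.bracket (G.reflSec hC b) a x)
  have e : ∀ a : Sec d F E, (fun y => C.anchor y (G.reflSec hC a y)) = fun y => C.anchor y (a y) :=
    fun a => by funext y; simp
  rw [C.anchor_bracket, e] at h3
  rw [C.anchor_bracket, e, VectorField.mlieBracket_swap, Pi.neg_apply, map_neg] at h4
  simp only [map_sub, LinearMap.sub_apply, C.pairing_symm x (c x),
    C.pairing_symm x (G.reflSec hC c x)] at h3 h4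
  simp only [GenMetric.flux]
  linarith

end PureBracket

/-! #### The mixed connections -/

theorem GenMetric.projSec_add (ε : ℝ) (a b : Sec d F E) :
    G.projSec ε (a + b) = G.projSec ε a + G.projSec ε b := by ext x; simp
theorem GenMetric.projSec_fsmul (ε : ℝ) (f : Fun d M) (a : Sec d F E) :
    G.projSec ε (fsmul f a) = fsmul f (G.projSec ε a) := by ext x; simp
theorem GenMetric.reflSec_add (a b : Sec d F E) :
    G.reflSec hC (a + b) = G.reflSec hC a + G.reflSec hC b := by ext x; simp
theorem GenMetric.reflSec_fsmul (f : Fun d M) (a : Sec d F E) :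
    G.reflSec hC (fsmul f a) = fsmul f (G.reflSec hC a) := by ext x; simp

variable (G) in
/-- The operator `(a, b) ↦ [a_∓, b_±]_±`. -/
def GenMetric.mixed (ε : ℝ) (a b : Sec d F E) : Sec d F E :=
  G.projSec ε (C.bracket (G.projSec (-ε) a) (G.projSec ε b))

theorem GenMetric.mixed_add_left (ε : ℝ) (a a' b : Sec d F E) :
    G.mixed ε (a + a') b = G.mixed ε a b + G.mixed ε a' b := by
  simp [GenMetric.mixed, GenMetric.projSec_add]

theorem GenMetric.mixed_add_right (ε : ℝ) (a b b' : Sec d F E) :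
    G.mixed ε a (b + b') = G.mixed ε a b + G.mixed ε a b' := by
  simp [GenMetric.mixed, GenMetric.projSec_add]

theorem neg_mul_neg_one (hε : ε * ε = 1) : -ε * -ε = 1 := by rwa [neg_mul_neg]

/-- Both derivative terms of `pairing_fsmul_bracket` carry a pairing of `E_+` with `E_-` and vanish.
-/
theorem GenMetric.mixed_fsmul_left (hε : ε * ε = 1) (f : Fun d M) (a b : Sec d F E) :
    G.mixed ε (fsmul f a) b = fsmul f (G.mixed ε a b) := by
  ext x
  refine pairing_ext_sec (d := d) (F := F) (C := C) x fun c => ?_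
  have hm := isPure_projSec (G := G) (neg_mul_neg_one hε) a
  have h := C.pairing_fsmul_bracket f (G.projSec (-ε) a) (G.projSec ε b) (G.projSec ε c) x
  rw [hm.pairing_eq_zero' hε (isPure_projSec hε b), hm.pairing_eq_zero' hε (isPure_projSec hε c)]
    at h
  simp only [GenMetric.mixed, GenMetric.projSec_fsmul, fsmul_apply, GenMetric.projSec_apply,
    G.pairing_proj, map_smul, LinearMap.smul_apply, smul_eq_mul] at h ⊢
  linarith

theorem GenMetric.mixed_fsmul_right (hε : ε * ε = 1) (f : Fun d M) (a b : Sec d F E) (x : M) :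
    G.mixed ε a (fsmul f b) x = mvfderiv (𝓡 d) f x (C.anchor x (G.proj (-ε) x (a x))) •
      G.proj ε x (b x) + f x • G.mixed ε a b x := by
  simp only [GenMetric.mixed, GenMetric.projSec_fsmul, GenMetric.projSec_apply, C.bracket_fsmul,
    map_add, map_smul]
  rw [← G.projSec_apply ε b x, G.proj_eq_self hε (isPure_projSec hε b x)]

theorem GenMetric.mixed_metric (ε : ℝ) (a b c : Sec d F E) (x : M) :
    C.pairing x (G.mixed ε a b x) (c x) + C.pairing x (b x) (G.mixed ε a c x) =
      mvfderiv (𝓡 d) (C.pair (G.projSec ε b) (G.projSec ε c)) x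
        (C.anchor x (G.proj (-ε) x (a x))) := by
  have h := C.bracket_pairing_eq (G.projSec (-ε) a) (G.projSec ε b) (G.projSec ε c) x
  rw [G.projSec_apply (-ε) a] at h
  rw [h]
  simp only [GenMetric.mixed, GenMetric.projSec_apply]
  rw [G.pairing_proj, G.pairing_proj]

theorem GenMetric.isPure_mixed (hε : ε * ε = 1) (a b : Sec d F E) : G.IsPure ε (G.mixed ε a b) :=
  isPure_projSec hε _

end CourantAlgebroid

end Bracket

end GenGeom
end

open Bundle Manifold
open scoped ContDiff
noncomputable section
set_option linter.unusedSectionVars false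
namespace GenGeom

/-! ### The canonical generalised Levi-Civita connection with metric divergence -/

section CanonicalZero

variable {d : ℕ} {M : Type*} [TopologicalSpace M] [ChartedSpace (EuclideanSpace ℝ (Fin d)) M]
  [IsManifold (𝓡 d) ∞ M] [T2Space M] [SigmaCompactSpace M]
  {F : Type*} [NormedAddCommGroup F] [NormedSpace ℝ F] [FiniteDimensional ℝ F]
  {E : M → Type*} [∀ x, AddCommGroup (E x)] [∀ x, Module ℝ (E x)]
  [∀ x, TopologicalSpace (E x)] [TopologicalSpace (TotalSpace F E)]
  [FiberBundle F E] [VectorBundle ℝ F E] [ContMDiffVectorBundle ∞ F E (𝓡 d)]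

/-- The linear map on a fibre defined by a tensorial operation on sections. -/
def tensorialLin {A : Type*} [AddCommGroup A] [Module ℝ A] (φ : Sec d F E → A) (x : M)
    (hadd : ∀ s t, φ (s + t) = φ s + φ t)
    (hsmul : ∀ (f : Fun d M) s, φ (fsmul f s) = f x • φ s) : E x →ₗ[ℝ] A where
  toFun u := φ (ext u)
  map_add' u v := by
    rw [← hadd]
    exact tensorial_congr hadd hsmul (by simp [ext_apply])
  map_smul' r u := by
    have h := hsmul ⟨fun _ => r, contMDiff_const⟩ (ext u)
    refine Eq.trans (tensorial_congr hadd hsmul ?_) h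
    change (ext (r • u) : Sec d F E) x = r • (ext u : Sec d F E) x
    rw [ext_apply, ext_apply]

theorem tensorialLin_apply {A : Type*} [AddCommGroup A] [Module ℝ A] (φ : Sec d F E → A) (x : M)
    (hadd : ∀ s t, φ (s + t) = φ s + φ t)
    (hsmul : ∀ (f : Fun d M) s, φ (fsmul f s) = f x • φ s) (s : Sec d F E) :
    tensorialLin φ x hadd hsmul (s x) = φ s :=
  tensorial_congr hadd hsmul (by simp [ext_apply])

namespace CourantAlgebroid

variable {C : CourantAlgebroid d F E} 

/-- A generalised connection from the operation `(a, b) ↦ D_a b` on sections. -/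
def GenConnection.ofSec (D : Sec d F E → Sec d F E → Sec d F E)
    (hadd : ∀ a a' b, D (a + a') b = D a b + D a' b)
    (hsmul : ∀ (f : Fun d M) a b, D (fsmul f a) b = fsmul f (D a b))
    (hadd' : ∀ a b b', D a (b + b') = D a b + D a b')
    (hleib : ∀ (f : Fun d M) (a b : Sec d F E) (x : M), D a (fsmul f b) x =
      mvfderiv (𝓡 d) f x (C.anchor x (a x)) • b x + f x • D a b x)
    (hmet : ∀ (a b c : Sec d F E) (x : M), mvfderiv (𝓡 d) (C.pair b c) x (C.anchor x (a x)) =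
      C.pairing x (D a b x) (c x) + C.pairing x (b x) (D a c x)) : C.GenConnection :=
  have h1 : ∀ (b : Sec d F E) (x : M) (s t : Sec d F E), D (s + t) b x = D s b x + D t b x :=
    fun b x s t => by rw [hadd]; rfl
  have h2 : ∀ (b : Sec d F E) (x : M) (f : Fun d M) (s : Sec d F E),
      D (fsmul f s) b x = f x • D s b x := fun b x f s => by rw [hsmul]; rfl
  { toFun b x := tensorialLin (fun a => D a b x) x (h1 b x) (h2 b x)
    smooth' a b := by
      simp only [tensorialLin_apply]
      exact (D a b).contMDiff
    add' b c x := by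
      ext u
      change D (GenGeom.ext u) (b + c) x = D (GenGeom.ext u) b x + D (GenGeom.ext u) c x
      rw [hadd']; rfl
    leibniz' f b x u := by
      change D (GenGeom.ext u) (fsmul f b) x = _ + _ • D (GenGeom.ext u) b x
      rw [hleib, ext_apply]
    pairing' b c x u := by
      change _ = C.pairing x (D (GenGeom.ext u) b x) (c x) +
        C.pairing x (b x) (D (GenGeom.ext u) c x)
      rw [← hmet, ext_apply]; rfl }

theorem GenConnection.ofSec_apply (D : Sec d F E → Sec d F E → Sec d F E) (h1 h2 h3 h4 h5)
    (a b : Sec d F E) (x : M) :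
    (GenConnection.ofSec (C := C) D h1 h2 h3 h4 h5).toFun b x (a x) = D a b x :=
  tensorialLin_apply (fun a => D a b x) x (fun s t => by rw [h1]; rfl)
    (fun f s => by rw [h2]; rfl) a

variable (G : C.GenMetric) (hC : C.IsExact)

/-- The component in `E_±` of the canonical connection. -/
def GenMetric.partConn (ε : ℝ) (a b : Sec d F E) : Sec d F E :=
  -- The first term handles the `E_∓`-part of `a`, the other two its `E_±`-part. There they are the
  -- connections `∇ ± H/2` and `∇ ∓ H/2`, and the weights 2/3 and 1/3 produce `∇ ± H/6`.
  G.mixed ε a b + (2 / 3 : ℝ) • G.mixed ε (G.reflSec hC a) b +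
    (1 / 3 : ℝ) • G.reflSec hC (G.mixed (-ε) a (G.reflSec hC b))

variable {ε : ℝ}

theorem GenMetric.partConn_add_left (a a' b : Sec d F E) : G.partConn hC ε (a + a') b =
    G.partConn hC ε a b + G.partConn hC ε a' b := by
  simp only [GenMetric.partConn, G.mixed_add_left, G.reflSec_add]; module

theorem GenMetric.partConn_add_right (a b b' : Sec d F E) : G.partConn hC ε a (b + b') =
    G.partConn hC ε a b + G.partConn hC ε a b' := by
  simp only [GenMetric.partConn, G.mixed_add_right, G.reflSec_add]; module

theorem GenMetric.partConn_fsmul_left (hε : ε * ε = 1) (f : Fun d M) (a b : Sec d F E) :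
    G.partConn hC ε (fsmul f a) b = fsmul f (G.partConn hC ε a b) := by
  simp only [GenMetric.partConn, G.mixed_fsmul_left hε, G.mixed_fsmul_left (neg_mul_neg_one hε),
    G.reflSec_fsmul]
  ext x
  simp only [Sec.add_apply, Sec.smul_apply, fsmul_apply]; module

theorem GenMetric.proj_refl (x : M) (u : E x) :
    G.proj ε x (G.refl hC x u) = G.refl hC x (G.proj (-ε) x u) := by
  simp only [G.proj_apply, map_smul, map_add, G.endo_refl]; module

/-- The weights in either direction add up to 1, so the derivative of `f` is taken along the whole
of `π(a)`. -/
theorem GenMetric.partConn_fsmul_right (hε : ε * ε = 1) (f : Fun d M) (a b : Sec d F E) (x : M) :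
    G.partConn hC ε a (fsmul f b) x = mvfderiv (𝓡 d) f x (C.anchor x (a x)) • G.proj ε x (b x) +
      f x • G.partConn hC ε a b x := by
  have h : C.anchor x (a x) = C.anchor x (G.proj ε x (a x)) + C.anchor x (G.proj (-ε) x (a x)) := by
    rw [← map_add, G.proj_add_proj]
  simp only [GenMetric.partConn, Sec.add_apply, Sec.smul_apply, G.mixed_fsmul_right hε, 
    G.mixed_fsmul_right (neg_mul_neg_one hε), G.reflSec_fsmul, G.reflSec_apply, map_add, map_smul,
    G.proj_refl, G.anchor_refl, neg_neg, G.refl_refl, h]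
  module

/-- The reflected term is metric as well: the sign of `pairing_refl` and the sign of `⟨ρb, ρc⟩`
compensate each other. -/
theorem GenMetric.partConn_metric (a b c : Sec d F E) (x : M) :
    C.pairing x (G.partConn hC ε a b x) (c x) + C.pairing x (b x) (G.partConn hC ε a c x) =
      mvfderiv (𝓡 d) (C.pair (G.projSec ε b) (G.projSec ε c)) x (C.anchor x (a x)) := by
  have h1 := G.mixed_metric ε a b c x
  have h2 := G.mixed_metric ε (G.reflSec hC a) b c x
  have h3 := G.mixed_metric (-ε) a (G.reflSec hC b) (G.reflSec hC c) x
  have e : ⇑(C.pair (G.projSec (-ε) (G.reflSec hC b)) (G.projSec (-ε) (G.reflSec hC c))) =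
      fun y => -C.pair (G.projSec ε b) (G.projSec ε c) y := by
    funext y
    simp [G.proj_refl, G.pairing_refl, G.refl_refl]
  have h : C.anchor x (a x) = C.anchor x (G.proj ε x (a x)) + C.anchor x (G.proj (-ε) x (a x)) := by
    rw [← map_add, G.proj_add_proj]
  rw [e, mvfderiv_fun_neg', neg_neg] at h3
  rw [G.reflSec_apply, G.proj_refl, G.anchor_refl, neg_neg] at h2
  have h4 := G.pairing_refl hC x (G.mixed (-ε) a (G.reflSec hC b) x) (c x)
  have h5 := G.pairing_refl hC x (b x) (G.mixed (-ε) a (G.reflSec hC c) x)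
  rw [h, map_add]
  simp only [GenMetric.partConn, Sec.add_apply, Sec.smul_apply, G.reflSec_apply, map_add, map_smul,
    LinearMap.add_apply, LinearMap.smul_apply, smul_eq_mul] at h3 h4 h5 ⊢
  linear_combination h1 + (2 / 3) * h2 - (1 / 3) * h3 + (1 / 3) * h4 + (1 / 3) * h5

theorem GenMetric.isPure_partConn (hε : ε * ε = 1) (a b : Sec d F E) :
    G.IsPure ε (G.partConn hC ε a b) := fun x => by
  have h1 := G.isPure_mixed hε a b x
  have h2 := G.isPure_mixed hε (G.reflSec hC a) b x
  have h3 := (G.isPure_mixed (neg_mul_neg_one hε) a (G.reflSec hC b)).reflSec' hC x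
  simp only [GenMetric.partConn, Sec.add_apply, Sec.smul_apply, map_add, map_smul, h1, h2, h3]
  module

/-- The operation `(a, b) ↦ D⁰_a b`. -/
def GenMetric.zeroSec (a b : Sec d F E) : Sec d F E :=
  G.partConn hC 1 a b + G.partConn hC (-1) a b

theorem GenMetric.mvfderiv_pair (b c : Sec d F E) (x : M) (u : TM d x) :
    mvfderiv (𝓡 d) (C.pair b c) x u =
      mvfderiv (𝓡 d) (C.pair (G.projSec 1 b) (G.projSec 1 c)) x u +
      mvfderiv (𝓡 d) (C.pair (G.projSec (-1) b) (G.projSec (-1) c)) x u := by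
  rw [← mvfderiv_fun_add']
  congr 2
  funext y
  have h1 := G.proj_add_proj 1 y (b y)
  have h2 := G.pairing_eq_zero (one_mul 1) (G.endo_proj (one_mul 1) y (b y))
    (G.endo_proj (ε := -1) (by norm_num) y (c y))
  have h3 := G.pairing_eq_zero (one_mul 1) (G.endo_proj (one_mul 1) y (c y))
    (G.endo_proj (ε := -1) (by norm_num) y (b y))
  rw [C.pairing_symm] at h3
  simp only [pair_apply, G.projSec_apply]
  conv_lhs => rw [← G.proj_add_proj 1 y (b y), ← G.proj_add_proj 1 y (c y)]
  simp only [map_add, LinearMap.add_apply]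
  linarith

/-- The canonical generalised Levi-Civita connection `D⁰` with metric divergence. -/
def GenMetric.zeroConn : C.GenConnection :=
  GenConnection.ofSec (G.zeroSec hC)
    (fun a a' b => by simp only [GenMetric.zeroSec, G.partConn_add_left]; abel)
    (fun f a b => by
      simp only [GenMetric.zeroSec, G.partConn_fsmul_left hC (one_mul 1),
        G.partConn_fsmul_left hC (neg_mul_neg_one (one_mul 1))]
      ext x; simp)
    (fun a b b' => by simp only [GenMetric.zeroSec, G.partConn_add_right]; abel)
    (fun f a b x => by
      simp only [GenMetric.zeroSec, Sec.add_apply, G.partConn_fsmul_right hC (one_mul 1),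
        G.partConn_fsmul_right hC (neg_mul_neg_one (one_mul 1))]
      conv_rhs => rw [← G.proj_add_proj 1 x (b x)]
      module)
    (fun a b c x => by
      rw [G.mvfderiv_pair, ← G.partConn_metric hC, ← G.partConn_metric hC]
      simp only [GenMetric.zeroSec, Sec.add_apply, map_add, LinearMap.add_apply]
      ring)

theorem GenMetric.zeroConn_apply (a b : Sec d F E) (x : M) :
    (G.zeroConn hC).toFun b x (a x) = G.zeroSec hC a b x :=
  GenConnection.ofSec_apply ..

theorem GenMetric.zeroConn_metric (b c : Sec d F E) (x : M) (u : E x) :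
    mvfderiv (𝓡 d) (fun y => G.form y (b y) (c y)) x (C.anchor x u) =
      G.form x ((G.zeroConn hC).toFun b x u) (c x) +
        G.form x (b x) ((G.zeroConn hC).toFun c x u) := by
  obtain ⟨a, rfl⟩ := exists_section (d := d) (F := F) x u
  have h : (1 : ℝ) * 1 = 1 := one_mul 1
  have e : (fun y => G.form y (b y) (c y)) = fun y => C.pair (G.projSec 1 b) (G.projSec 1 c) y +
      (-C.pair (G.projSec (-1) b) (G.projSec (-1) c) : Fun d M) y := by
    funext y
    have h1 := G.proj_add_proj 1 y (b y)
    have h2 := G.pairing_eq_zero h (G.endo_proj h y (b y))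
      (G.endo_proj (neg_mul_neg_one h) y (c y))
    have h3 := G.pairing_eq_zero h (G.endo_proj h y (c y))
      (G.endo_proj (neg_mul_neg_one h) y (b y))
    rw [C.pairing_symm] at h3
    rw [G.form_apply]
    conv_lhs => rw [← G.proj_add_proj 1 y (b y), ← G.proj_add_proj 1 y (c y)]
    change _ = C.pairing y (G.proj 1 y (b y)) (G.proj 1 y (c y)) +
      -C.pairing y (G.proj (-1) y (b y)) (G.proj (-1) y (c y))
    simp only [map_add, map_smul, LinearMap.add_apply, LinearMap.smul_apply, smul_eq_mul,
      G.endo_proj h, G.endo_proj (neg_mul_neg_one h)]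
    linarith
  rw [e, mvfderiv_fun_add', show ⇑(-C.pair (G.projSec (-1) b) (G.projSec (-1) c) : Fun d M) =
    fun y => -C.pair (G.projSec (-1) b) (G.projSec (-1) c) y from rfl, mvfderiv_fun_neg',
    ← G.partConn_metric hC, ← G.partConn_metric hC, G.zeroConn_apply, G.zeroConn_apply]
  have h4 : ∀ b, G.endo x (G.zeroSec hC a b x) =
      G.partConn hC 1 a b x - G.partConn hC (-1) a b x := fun b => by
    rw [GenMetric.zeroSec, Sec.add_apply, map_add, G.isPure_partConn hC h a b x,
      G.isPure_partConn hC (neg_mul_neg_one h) a b x]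
    module
  rw [G.form_apply, G.form_apply, h4, G.endo_symm x (b x), h4]
  simp only [map_sub, LinearMap.sub_apply]
  ring

theorem GenMetric.zeroSec_pure (hε : ε = 1 ∨ ε = -1) (a : Sec d F E) {b : Sec d F E}
    (hb : G.IsPure ε b) : G.zeroSec hC a b = G.partConn hC ε a b := by
  have hε' : ε * ε = 1 := by rcases hε with rfl | rfl <;> norm_num
  have hz : G.partConn hC (-ε) a b = 0 := by
    simp only [GenMetric.partConn, GenMetric.mixed, hb.projSec_neg hε', neg_neg,
      (hb.reflSec hC).projSec_zero hε', map_zero]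
    ext x
    simp
  rcases hε with rfl | rfl
  · rw [GenMetric.zeroSec, hz, add_zero]
  · rw [neg_neg] at hz
    rw [GenMetric.zeroSec, hz, zero_add]

/-- The minus sign arises from moving the reflection across the pairing. -/
theorem GenMetric.zeroSec_pairing_pure (hε : ε = 1 ∨ ε = -1) {a b c : Sec d F E}
    (ha : G.IsPure ε a) (hb : G.IsPure ε b) (hc : G.IsPure ε c) (x : M) :
    C.pairing x (G.zeroSec hC a b x) (c x) =
      2 / 3 * C.pairing x (C.bracket (G.reflSec hC a) b x) (c x)
        - 1 / 3 * C.pairing x (C.bracket a (G.reflSec hC b) x) (G.reflSec hC c x) := by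
  have hε' : ε * ε = 1 := by rcases hε with rfl | rfl <;> norm_num
  rw [G.zeroSec_pure hC hε a hb]
  simp only [GenMetric.partConn, GenMetric.mixed, ha.projSec_neg hε', neg_neg, hb.projSec hε',
    ha.projSec hε', (ha.reflSec hC).projSec (neg_mul_neg_one hε'),
    (hb.reflSec hC).projSec (neg_mul_neg_one hε'), map_zero, Sec.add_apply, Sec.smul_apply,
    G.projSec_apply, map_add, map_smul, LinearMap.add_apply, LinearMap.smul_apply, smul_eq_mul,
    G.reflSec_apply, LinearMap.zero_apply, Sec.zero_apply]
  rw [G.pairing_refl, G.pairing_proj, G.pairing_proj, ← G.projSec_apply ε c, hc.projSec hε',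
    ← G.reflSec_apply, ← G.projSec_apply (-ε), (hc.reflSec hC).projSec (neg_mul_neg_one hε')]
  simp only [G.reflSec_apply]
  ring

theorem GenMetric.zeroSec_pairing_mixed (hε : ε = 1 ∨ ε = -1) {a b c : Sec d F E}
    (ha : G.IsPure (-ε) a) (hb : G.IsPure ε b) (hc : G.IsPure ε c) (x : M) :
    C.pairing x (G.zeroSec hC a b x) (c x) = C.pairing x (C.bracket a b x) (c x) := by
  have hε' : ε * ε = 1 := by rcases hε with rfl | rfl <;> norm_num
  rw [G.zeroSec_pure hC hε a hb]
  simp only [GenMetric.partConn, GenMetric.mixed, ha.projSec_zero hε', neg_neg, hb.projSec hε',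
    ha.projSec (neg_mul_neg_one hε'), (ha.reflSec' hC).projSec_neg hε',
    (hb.reflSec hC).projSec (neg_mul_neg_one hε'), map_zero, Sec.add_apply, Sec.smul_apply,
    G.projSec_apply, map_add, map_smul, LinearMap.add_apply, LinearMap.smul_apply, smul_eq_mul,
    G.reflSec_apply, LinearMap.zero_apply, Sec.zero_apply]
  rw [G.pairing_proj, ← G.projSec_apply ε c, hc.projSec hε']
  ring

theorem GenMetric.zeroSec_pairing_zero (hε : ε = 1 ∨ ε = -1) (a : Sec d F E) {b c : Sec d F E}
    (hb : G.IsPure ε b) (hc : G.IsPure (-ε) c) (x : M) :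
    C.pairing x (G.zeroSec hC a b x) (c x) = 0 := by
  have hε' : ε * ε = 1 := by rcases hε with rfl | rfl <;> norm_num
  rw [G.zeroSec_pure hC hε a hb]
  exact (G.isPure_partConn hC hε' a b).pairing_eq_zero hε' hc x

/-! ### Vanishing of the torsion of `D⁰` -/

/-- The torsion of `D⁰`. -/
def GenMetric.zeroTorsion (a b c : Sec d F E) (x : M) : ℝ :=
  C.pairing x (G.zeroSec hC a b x - G.zeroSec hC b a x - C.bracket a b x) (c x) +
      C.pairing x (G.zeroSec hC c a x) (b x)

/-- In pure type, `bracket_pure` rewrites the torsion in terms of mixed brackets, and total skewness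
of the flux cancels them; the weight 2/3 is what this requires. With `c` of the opposite type, only
the mixed bracket remains, which is skew by orthogonality. -/
theorem GenMetric.zeroTorsion_pure (hε : ε = 1 ∨ ε = -1) {a b c : Sec d F E}
    (ha : G.IsPure ε a) (hb : G.IsPure ε b) (hc : G.IsPure ε c ∨ G.IsPure (-ε) c) (x : M) :
    G.zeroTorsion hC a b c x = 0 := by
  have hε' : ε * ε = 1 := by rcases hε with rfl | rfl <;> norm_num
  simp only [GenMetric.zeroTorsion, map_sub, LinearMap.sub_apply]
  rcases hc with hc | hc
  · rw [G.zeroSec_pairing_pure hC hε ha hb hc, G.zeroSec_pairing_pure hC hε hb ha hc,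
      G.zeroSec_pairing_pure hC hε hc ha hb, bracket_pure hC ha hb hc hε']
    have h1 := G.flux_skew_left hC ha hb hc hε' x
    have h2 := G.flux_skew_left hC ha hc hb hε' x
    have h3 := G.flux_skew_right hC (a := a) hb hc x
    simp only [GenMetric.flux] at h1 h2 h3
    linarith
  · rw [G.zeroSec_pairing_zero hC hε _ hb hc, G.zeroSec_pairing_zero hC hε _ ha hc,
      G.zeroSec_pairing_mixed hC hε hc ha hb]
    have h1 := bracket_pairing_skew (hb.pairing_eq_zero hε' hc) a x
    have h2 := bracket_skew (ha.pairing_eq_zero hε' hc) b x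
    linarith

theorem GenMetric.zeroTorsion_pure' (hε : ε = 1 ∨ ε = -1) {a b c : Sec d F E}
    (ha : G.IsPure ε a) (hb : G.IsPure (-ε) b) (hc : G.IsPure ε c) (x : M) :
    G.zeroTorsion hC a b c x = 0 := by
  have hε' : ε * ε = 1 := by rcases hε with rfl | rfl <;> norm_num
  simp only [GenMetric.zeroTorsion, map_sub, LinearMap.sub_apply]
  have hε2 : -ε = 1 ∨ -ε = -1 := by rcases hε with rfl | rfl <;> simp
  rw [G.zeroSec_pairing_zero hC hε2 _ hb (by rwa [neg_neg]),
    G.zeroSec_pairing_mixed hC hε hb ha hc, G.zeroSec_pairing_zero hC hε _ ha hb]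
  have h2 := bracket_skew (ha.pairing_eq_zero hε' hb) c x
  linarith

theorem GenMetric.zeroTorsion_pure'' (hε : ε = 1 ∨ ε = -1) {a b c : Sec d F E}
    (ha : G.IsPure (-ε) a) (hb : G.IsPure ε b) (hc : G.IsPure ε c) (x : M) :
    G.zeroTorsion hC a b c x = 0 := by
  simp only [GenMetric.zeroTorsion, map_sub, LinearMap.sub_apply]
  have hε2 : -ε = 1 ∨ -ε = -1 := by rcases hε with rfl | rfl <;> simp
  rw [G.zeroSec_pairing_zero hC hε2 _ ha (by rwa [neg_neg]),
    G.zeroSec_pairing_mixed hC hε ha hb hc, G.zeroSec_pairing_zero hC hε2 _ ha (by rwa [neg_neg])]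
  ring

theorem GenMetric.zeroTorsion_eq_zero (a b c : Sec d F E) (x : M) :
    G.zeroTorsion hC a b c x = 0 := by
  have hz1 : ∀ a a' b, G.zeroSec hC (a + a') b = G.zeroSec hC a b + G.zeroSec hC a' b :=
    fun a a' b => by simp only [GenMetric.zeroSec, G.partConn_add_left]; abel
  have hz2 : ∀ a b b', G.zeroSec hC a (b + b') = G.zeroSec hC a b + G.zeroSec hC a b' :=
    fun a b b' => by simp only [GenMetric.zeroSec, G.partConn_add_right]; abel
  have h1 : ∀ a a' b c, G.zeroTorsion hC (a + a') b c x =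
      G.zeroTorsion hC a b c x + G.zeroTorsion hC a' b c x := fun a a' b c => by
    simp only [GenMetric.zeroTorsion, hz1, hz2, map_add, map_sub, LinearMap.add_apply,
      LinearMap.sub_apply, Sec.add_apply]
    ring
  have h2 : ∀ a b b' c, G.zeroTorsion hC a (b + b') c x =
      G.zeroTorsion hC a b c x + G.zeroTorsion hC a b' c x := fun a b b' c => by
    simp only [GenMetric.zeroTorsion, hz1, hz2, map_add, map_sub, LinearMap.add_apply,
      LinearMap.sub_apply, Sec.add_apply]
    ring
  have h3 : ∀ a b c c', G.zeroTorsion hC a b (c + c') x =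
      G.zeroTorsion hC a b c x + G.zeroTorsion hC a b c' x := fun a b c c' => by
    simp only [GenMetric.zeroTorsion, hz1, map_add, map_sub, LinearMap.add_apply,
      LinearMap.sub_apply, Sec.add_apply]
    ring
  have hp : ∀ a : Sec d F E, G.IsPure 1 (G.projSec 1 a) := isPure_projSec (one_mul 1)
  have hm : ∀ a : Sec d F E, G.IsPure (-1) (G.projSec (-1) a) :=
    isPure_projSec (neg_mul_neg_one (one_mul 1))
  have hp' : ∀ a : Sec d F E, G.IsPure (- -1) (G.projSec 1 a) := by
    rw [neg_neg]; exact hp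
  have l : (1 : ℝ) = 1 ∨ (1 : ℝ) = -1 := Or.inl rfl
  have r : (-1 : ℝ) = 1 ∨ (-1 : ℝ) = -1 := Or.inr rfl
  rw [G.projSec_add_projSec 1 a, G.projSec_add_projSec 1 b, G.projSec_add_projSec 1 c]
  simp only [h1, h2, h3]
  rw [G.zeroTorsion_pure hC l (hp a) (hp b) (Or.inl (hp c)),
    G.zeroTorsion_pure hC l (hp a) (hp b) (Or.inr (hm c)),
    G.zeroTorsion_pure' hC l (hp a) (hm b) (hp c),
    G.zeroTorsion_pure'' hC r (hp' a) (hm b) (hm c),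
    G.zeroTorsion_pure'' hC l (hm a) (hp b) (hp c),
    G.zeroTorsion_pure' hC r (hm a) (hp' b) (hm c),
    G.zeroTorsion_pure hC r (hm a) (hm b) (Or.inr (hp' c)),
    G.zeroTorsion_pure hC r (hm a) (hm b) (Or.inl (hm c))]
  norm_num

theorem GenMetric.zeroConn_isLeviCivita : (G.zeroConn hC).IsLeviCivita G where
  metric := G.zeroConn_metric hC
  torsion a b c x := by
    rw [G.zeroConn_apply, G.zeroConn_apply, G.zeroConn_apply]
    exact G.zeroTorsion_eq_zero hC a b c x

end CourantAlgebroid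

end CanonicalZero

end GenGeom
end

open Bundle Manifold
open scoped ContDiff
noncomputable section
set_option linter.unusedSectionVars false
namespace GenGeom

/-! ### The induced geometry on the base -/

section Induced

variable {d : ℕ} {M : Type*} [TopologicalSpace M] [ChartedSpace (EuclideanSpace ℝ (Fin d)) M]
  [IsManifold (𝓡 d) ∞ M] [T2Space M] [SigmaCompactSpace M]
  {F : Type*} [NormedAddCommGroup F] [NormedSpace ℝ F] [FiniteDimensional ℝ F]
  {E : M → Type*} [∀ x, AddCommGroup (E x)] [∀ x, Module ℝ (E x)]
  [∀ x, TopologicalSpace (E x)] [TopologicalSpace (TotalSpace F E)]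
  [FiberBundle F E] [VectorBundle ℝ F E] [ContMDiffVectorBundle ∞ F E (𝓡 d)]

theorem AffineConnection.ext' {N N' : AffineConnection d M}
    (h : ∀ (X Y : VF d M) (x : M), N.toFun Y x (X x) = N'.toFun Y x (X x)) : N = N' := by
  have : N.toFun = N'.toFun := by
    funext Y x
    ext u : 1
    have := h (GenGeom.ext u) Y x
    rwa [ext_apply] at this
  cases N; cases N'; congr

/-- The Levi-Civita connection of a nondegenerate metric is unique. -/
theorem AffineConnection.IsLeviCivita.unique {N N' : AffineConnection d M}
    {g : ∀ x : M, LinearMap.BilinForm ℝ (TM d x)} (hs : ∀ x u v, g x u v = g x v u)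
    (hn : ∀ x u, (∀ v, g x u v = 0) → u = 0)
    (h : N.IsLeviCivita g) (h' : N'.IsLeviCivita g) : N = N' := by
  refine AffineConnection.ext' fun X Y x => ?_
  rw [← sub_eq_zero]
  refine hn x _ fun w => ?_
  obtain ⟨Z, rfl⟩ := exists_section (d := d) (F := EuclideanSpace ℝ (Fin d)) x w
  -- The difference tensor is skew in its last two arguments (`key`) and symmetric in its first two
  -- (`sym`), which forces it to vanish.
  have key : ∀ X Y Z : VF d M, g x (N.toFun Y x (X x) - N'.toFun Y x (X x)) (Z x) =
      -g x (N.toFun Z x (X x) - N'.toFun Z x (X x)) (Y x) := fun X Y Z => by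
    have h1 := h.1 Y Z x (X x)
    have h2 := h'.1 Y Z x (X x)
    rw [hs x (Y x)] at h1 h2
    simp only [map_sub, LinearMap.sub_apply]
    linarith
  have sym : ∀ X Y Z : VF d M, g x (N.toFun Y x (X x) - N'.toFun Y x (X x)) (Z x) =
      g x (N.toFun X x (Y x) - N'.toFun X x (Y x)) (Z x) := fun X Y Z => by
    have h1 := h.2 X Y x
    have h2 := h'.2 X Y x
    congr 2
    rw [sub_eq_sub_iff_sub_eq_sub, h1, h2]
  have e1 := key X Y Z
  have e2 := key Z X Y
  have e3 := key Y Z X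
  have s1 := sym X Y Z
  have s2 := sym X Z Y
  have s3 := sym Y Z X
  linarith

namespace CourantAlgebroid

variable {C : CourantAlgebroid d F E} (G : C.GenMetric) (hC : C.IsExact) {ε : ℝ}

/-- The metric on the base. -/
def GenMetric.baseMetric (x : M) : LinearMap.BilinForm ℝ (TM d x) :=
  (C.pairing x).comp (G.liftE hC 1 x) (G.liftE hC 1 x)

theorem GenMetric.baseMetric_apply (x : M) (X Y : TM d x) : G.baseMetric hC x X Y =
    C.pairing x (G.liftE hC 1 x X) (G.liftE hC 1 x Y) := rfl

theorem GenMetric.baseMetric_symm (x : M) (X Y : TM d x) :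
    G.baseMetric hC x X Y = G.baseMetric hC x Y X := C.pairing_symm x _ _

theorem GenMetric.pairing_liftE (hε : ε = 1 ∨ ε = -1) (x : M) (X Y : TM d x) :
    C.pairing x (G.liftE hC ε x X) (G.liftE hC ε x Y) = ε * G.baseMetric hC x X Y := by
  rcases hε with rfl | rfl
  · rw [one_mul]; rfl
  · rw [← G.refl_liftE, ← G.refl_liftE, G.pairing_refl, G.refl_refl, G.baseMetric_apply]
    ring

theorem GenMetric.pairing_pure (hε : ε = 1 ∨ ε = -1) {x : M} {u v : E x}
    (hu : G.endo x u = ε • u) (hv : G.endo x v = ε • v) :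
    C.pairing x u v = ε * G.baseMetric hC x (C.anchor x u) (C.anchor x v) := by
  have hε' : ε * ε = 1 := by rcases hε with rfl | rfl <;> norm_num
  conv_lhs => rw [G.eq_liftE hC hε' hu, G.eq_liftE hC hε' hv]
  exact G.pairing_liftE hC hε x _ _

theorem GenMetric.baseMetric_nondeg (x : M) (X : TM d x) (h : ∀ Y, G.baseMetric hC x X Y = 0) :
    X = 0 := by
  have h0 : G.liftE hC 1 x X = 0 := C.pairing_nondeg x _ fun v => by
    rw [← G.proj_add_proj 1 x v, map_add,
      G.pairing_eq_zero (one_mul 1) (G.endo_liftE hC (one_mul 1) x X)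
      (G.endo_proj (neg_mul_neg_one (one_mul 1)) x v),
      G.pairing_pure hC (Or.inl rfl) (G.endo_liftE hC (one_mul 1) x X)
      (G.endo_proj (one_mul 1) x v), G.anchor_liftE, h]
    norm_num
  rw [← G.anchor_liftE hC 1 x X, h0, map_zero]

/-! ### The three-form on the base -/

/-- The three-form of the induced geometry on vector fields. -/
def GenMetric.fluxVF (X Y Z : VF d M) (x : M) : ℝ :=
  G.flux hC (G.liftESec hC 1 X) (G.liftESec hC 1 Y) (G.liftESec hC 1 Z) x

theorem GenMetric.liftESec_add (ε : ℝ) (X Y : VF d M) :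
    G.liftESec hC ε (X + Y) = G.liftESec hC ε X + G.liftESec hC ε Y := by ext x; simp
theorem GenMetric.liftESec_fsmul (ε : ℝ) (f : Fun d M) (X : VF d M) :
    G.liftESec hC ε (fsmul f X) = fsmul f (G.liftESec hC ε X) := by ext x; simp

theorem GenMetric.fluxVF_swap_left (X Y Z : VF d M) (x : M) :
    G.fluxVF hC X Y Z x = -G.fluxVF hC Y X Z x :=
  have h := fun X => isPure_liftESec (G := G) hC (one_mul 1) X
  G.flux_skew_left hC (h X) (h Y) (h Z) (one_mul 1) x

theorem GenMetric.fluxVF_swap_right (X Y Z : VF d M) (x : M) :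
    G.fluxVF hC X Y Z x = -G.fluxVF hC X Z Y x :=
  have h := fun X => isPure_liftESec (G := G) hC (one_mul 1) X
  G.flux_skew_right hC (h Y) (h Z) x

theorem GenMetric.fluxVF_add_right (X Y Z Z' : VF d M) (x : M) :
    G.fluxVF hC X Y (Z + Z') x = G.fluxVF hC X Y Z x + G.fluxVF hC X Y Z' x := by
  simp only [GenMetric.fluxVF, GenMetric.flux, G.liftESec_add, G.reflSec_add, Sec.add_apply,
    map_add]
  ring

theorem GenMetric.fluxVF_fsmul_right (X Y Z : VF d M) (f : Fun d M) (x : M) :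
    G.fluxVF hC X Y (fsmul f Z) x = f x • G.fluxVF hC X Y Z x := by
  simp only [GenMetric.fluxVF, GenMetric.flux, G.liftESec_fsmul, G.reflSec_fsmul, fsmul_apply,
    map_smul, smul_eq_mul]
  ring

/-- The three-form of the induced geometry at a point, as a function of vectors. -/
def GenMetric.fluxAt (x : M) (u v w : TM d x) : ℝ :=
  G.fluxVF hC (GenGeom.ext u) (GenGeom.ext v) (GenGeom.ext w) x

theorem GenMetric.fluxAt_swap_left (x : M) (u v w : TM d x) :
    G.fluxAt hC x u v w = -G.fluxAt hC x v u w := G.fluxVF_swap_left hC _ _ _ x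

theorem GenMetric.fluxAt_swap_right (x : M) (u v w : TM d x) :
    G.fluxAt hC x u v w = -G.fluxAt hC x u w v := G.fluxVF_swap_right hC _ _ _ x

theorem GenMetric.fluxAt_add (x : M) (u v w w' : TM d x) :
    G.fluxAt hC x u v (w + w') = G.fluxAt hC x u v w + G.fluxAt hC x u v w' :=
  (tensorialLin (fun Z => G.fluxVF hC (GenGeom.ext u) (GenGeom.ext v) Z x) x
    (fun _ _ => G.fluxVF_add_right hC _ _ _ _ _) (fun _ _ => G.fluxVF_fsmul_right hC _ _ _ _ _)
    ).map_add w w'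

theorem GenMetric.fluxAt_smul (x : M) (u v w : TM d x) (r : ℝ) :
    G.fluxAt hC x u v (r • w) = r * G.fluxAt hC x u v w :=
  (tensorialLin (fun Z => G.fluxVF hC (GenGeom.ext u) (GenGeom.ext v) Z x) x
    (fun _ _ => G.fluxVF_add_right hC _ _ _ _ _) (fun _ _ => G.fluxVF_fsmul_right hC _ _ _ _ _)
    ).map_smul r w

/-- Tensoriality is only checked in the last slot; skew-symmetry moves the other slots there. -/
theorem GenMetric.fluxAt_apply (X Y Z : VF d M) (x : M) :
    G.fluxAt hC x (X x) (Y x) (Z x) = G.fluxVF hC X Y Z x := by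
  have key : ∀ X Y Z Z' : VF d M, Z x = Z' x → G.fluxVF hC X Y Z x = G.fluxVF hC X Y Z' x :=
    fun X Y Z Z' h => tensorial_congr (φ := fun Z => G.fluxVF hC X Y Z x)
      (fun _ _ => G.fluxVF_add_right hC X Y _ _ _)
      (fun _ _ => G.fluxVF_fsmul_right hC X Y _ _ _) h
  have key2 : ∀ X Y Y' Z : VF d M, Y x = Y' x → G.fluxVF hC X Y Z x = G.fluxVF hC X Y' Z x :=
    fun X Y Y' Z h => by
      rw [G.fluxVF_swap_right, key X Z Y Y' h, ← G.fluxVF_swap_right]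
  have key3 : ∀ X X' Y Z : VF d M, X x = X' x → G.fluxVF hC X Y Z x = G.fluxVF hC X' Y Z x :=
    fun X X' Y Z h => by
      rw [G.fluxVF_swap_left, key2 Y X X' Z h, ← G.fluxVF_swap_left]
  unfold GenMetric.fluxAt
  rw [key3 _ X _ _ (ext_apply _), key2 _ _ Y _ (ext_apply _), key _ _ _ Z (ext_apply _)]

/-- The three-form of the induced geometry. -/
def GenMetric.baseFlux (x : M) : TM d x →ₗ[ℝ] TM d x →ₗ[ℝ] TM d x →ₗ[ℝ] ℝ where
  toFun u := LinearMap.mk₂ ℝ (G.fluxAt hC x u)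
    (fun v v' w => by
      rw [G.fluxAt_swap_right, G.fluxAt_add, neg_add, ← G.fluxAt_swap_right,
        ← G.fluxAt_swap_right])
    (fun r v w => by
      rw [G.fluxAt_swap_right, G.fluxAt_smul, ← mul_neg, ← G.fluxAt_swap_right, smul_eq_mul])
    (fun v w w' => G.fluxAt_add hC x u v w w')
    (fun r v w => G.fluxAt_smul hC x u v w r)
  map_add' u u' := by
    ext v w
    simp only [LinearMap.mk₂_apply, LinearMap.add_apply]
    rw [G.fluxAt_swap_left, G.fluxAt_swap_right, G.fluxAt_add, G.fluxAt_swap_left hC x u,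
      G.fluxAt_swap_left hC x u', G.fluxAt_swap_right hC x v u, G.fluxAt_swap_right hC x v u']
    ring
  map_smul' r u := by
    ext v w
    simp only [LinearMap.mk₂_apply, LinearMap.smul_apply, RingHom.id_apply, smul_eq_mul]
    rw [G.fluxAt_swap_left, G.fluxAt_swap_right, G.fluxAt_smul, G.fluxAt_swap_left hC x u,
      G.fluxAt_swap_right hC x v u]
    ring

theorem GenMetric.baseFlux_vf (X Y Z : VF d M) (x : M) :
    G.baseFlux hC x (X x) (Y x) (Z x) = G.fluxVF hC X Y Z x := G.fluxAt_apply hC X Y Z x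

/-- Reflecting all three arguments merely interchanges the two summands of the flux, so `E_+` and
`E_-` define the same form, with the same sign. -/
theorem GenMetric.baseFlux_apply (hε : ε = 1 ∨ ε = -1) {a b c : Sec d F E} (ha : G.IsPure ε a)
    (hb : G.IsPure ε b) (hc : G.IsPure ε c) (x : M) :
    G.baseFlux hC x (C.anchor x (a x)) (C.anchor x (b x)) (C.anchor x (c x)) =
      G.flux hC a b c x := by
  have h : ∀ {a b c : Sec d F E}, G.IsPure 1 a → G.IsPure 1 b → G.IsPure 1 c →
      G.baseFlux hC x (C.anchor x (a x)) (C.anchor x (b x)) (C.anchor x (c x)) =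
      G.flux hC a b c x := fun {a b c} ha hb hc => by
    refine (G.baseFlux_vf hC (C.anchorSec a) (C.anchorSec b) (C.anchorSec c) x).trans ?_
    rw [GenMetric.fluxVF, ← ha.eq_liftESec hC (one_mul 1), ← hb.eq_liftESec hC (one_mul 1),
      ← hc.eq_liftESec hC (one_mul 1)]
  rcases hε with rfl | rfl
  · exact h ha hb hc
  · have := h (ha.reflSec' hC) (hb.reflSec' hC) (hc.reflSec' hC)
    simp only [G.reflSec_apply, G.anchor_refl] at this
    rw [this]
    simp only [GenMetric.flux, G.reflSec_reflSec]
    ring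

/-! ### The Levi-Civita connection of the base -/

/-- The operation `(X, Y) ↦ ∇_X Y` of the Levi-Civita connection of the induced metric. -/
def GenMetric.nablaSec (X Y : VF d M) : VF d M :=
  -- The mean of the two metric connections given by the mixed brackets; their torsions are opposite
  -- and cancel.
  (1 / 2 : ℝ) • C.anchorSec (G.mixed 1 (G.liftESec hC (-1) X) (G.liftESec hC 1 Y) +
    G.mixed (-1) (G.liftESec hC 1 X) (G.liftESec hC (-1) Y))

theorem GenMetric.nablaSec_apply (X Y : VF d M) (x : M) : G.nablaSec hC X Y x =
    (1 / 2 : ℝ) • (C.anchor x (G.mixed 1 (G.liftESec hC (-1) X) (G.liftESec hC 1 Y) x) +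
      C.anchor x (G.mixed (-1) (G.liftESec hC 1 X) (G.liftESec hC (-1) Y) x)) := by
  rw [← map_add]; rfl

theorem GenMetric.nablaSec_add_left (X X' Y : VF d M) (x : M) :
    G.nablaSec hC (X + X') Y x = G.nablaSec hC X Y x + G.nablaSec hC X' Y x := by
  simp only [G.nablaSec_apply, G.liftESec_add, G.mixed_add_left, Sec.add_apply, map_add]; module

theorem GenMetric.nablaSec_fsmul_left (f : Fun d M) (X Y : VF d M) (x : M) :
    G.nablaSec hC (fsmul f X) Y x = f x • G.nablaSec hC X Y x := by
  simp only [G.nablaSec_apply, G.liftESec_fsmul, G.mixed_fsmul_left (one_mul 1),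
    G.mixed_fsmul_left (neg_mul_neg_one (one_mul 1)), fsmul_apply, map_smul]; module

theorem GenMetric.nablaSec_fsmul_right (f : Fun d M) (X Y : VF d M) (x : M) :
    G.nablaSec hC X (fsmul f Y) x =
      mvfderiv (𝓡 d) f x (X x) • Y x + f x • G.nablaSec hC X Y x := by
  have h : (1 : ℝ) * 1 = 1 := one_mul 1
  have h' : (-1 : ℝ) * -1 = 1 := neg_mul_neg_one h
  have p1 : ∀ X, G.proj 1 x (G.liftE hC 1 x X) = G.liftE hC 1 x X :=
    fun X => G.proj_eq_self h (G.endo_liftE hC h x X)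
  have p2 : ∀ X, G.proj (-1) x (G.liftE hC (-1) x X) = G.liftE hC (-1) x X :=
    fun X => G.proj_eq_self h' (G.endo_liftE hC h' x X)
  simp only [G.nablaSec_apply, G.liftESec_fsmul, G.mixed_fsmul_right h, G.mixed_fsmul_right h',
    map_smul, map_add, G.liftESec_apply, neg_neg, p1, p2, G.anchor_liftE]
  module

/-- The Levi-Civita connection of the induced metric. -/
def GenMetric.baseNabla : AffineConnection d M where
  toFun Y x := tensorialLin (fun X => G.nablaSec hC X Y x) x
    (fun X X' => G.nablaSec_add_left hC X X' Y x) (fun f X => G.nablaSec_fsmul_left hC f X Y x)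
  smooth' X Y := by
    simp only [tensorialLin_apply]
    exact (G.nablaSec hC X Y).contMDiff
  add' Y Z x := by
    ext u : 1
    change G.nablaSec hC (GenGeom.ext u) (Y + Z) x = G.nablaSec hC (GenGeom.ext u) Y x +
      G.nablaSec hC (GenGeom.ext u) Z x
    simp only [G.nablaSec_apply, G.liftESec_add, G.mixed_add_right, Sec.add_apply, map_add]; module
  leibniz' f Y x u := by
    change G.nablaSec hC (GenGeom.ext u) (fsmul f Y) x = _ • _ +
      _ • G.nablaSec hC (GenGeom.ext u) Y x
    rw [G.nablaSec_fsmul_right, ext_apply]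

theorem GenMetric.baseNabla_apply (X Y : VF d M) (x : M) :
    (G.baseNabla hC).toFun Y x (X x) = G.nablaSec hC X Y x :=
  tensorialLin_apply (fun X => G.nablaSec hC X Y x) x
    (fun X X' => G.nablaSec_add_left hC X X' Y x) (fun f X => G.nablaSec_fsmul_left hC f X Y x) X

theorem GenMetric.baseMetric_anchor (hε : ε = 1 ∨ ε = -1) {a : Sec d F E} (ha : G.IsPure ε a)
    (x : M) (Z : TM d x) : G.baseMetric hC x (C.anchor x (a x)) Z =
      ε * C.pairing x (a x) (G.liftE hC ε x Z) := by
  have hε' : ε * ε = 1 := by rcases hε with rfl | rfl <;> norm_num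
  rw [G.pairing_pure hC hε (ha x) (G.endo_liftE hC hε' x Z), ← mul_assoc, hε', one_mul,
    G.anchor_liftE]

theorem GenMetric.baseMetric_nablaSec (X Y : VF d M) (x : M) (Z : TM d x) :
    G.baseMetric hC x (G.nablaSec hC X Y x) Z = 1 / 2 *
      (C.pairing x (G.mixed 1 (G.liftESec hC (-1) X) (G.liftESec hC 1 Y) x) (G.liftE hC 1 x Z) -
      C.pairing x (G.mixed (-1) (G.liftESec hC 1 X) (G.liftESec hC (-1) Y) x)
        (G.liftE hC (-1) x Z)) := by
  rw [G.nablaSec_apply]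
  simp only [map_smul, map_add, LinearMap.add_apply, LinearMap.smul_apply, smul_eq_mul]
  rw [G.baseMetric_anchor hC (Or.inl rfl) (G.isPure_mixed (one_mul 1) _ _),
    G.baseMetric_anchor hC (Or.inr rfl) (G.isPure_mixed (neg_mul_neg_one (one_mul 1)) _ _)]
  ring

theorem bracket_eq_neg {a b : Sec d F E} (h : ∀ x, C.pairing x (a x) (b x) = 0) :
    C.bracket a b = -C.bracket b a := by
  ext x
  refine pairing_ext_sec (d := d) (F := F) (C := C) x fun c => ?_
  rw [bracket_skew h]; simp

/-- Metricity is inherited from both mixed brackets. For the torsion, the `E_+`- and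
`E_-`-components of one bracket `[X_-, Y_+]` enter the two halves, and their anchors add up to `[X,
Y]`. -/
theorem GenMetric.baseNabla_isLeviCivita : (G.baseNabla hC).IsLeviCivita (G.baseMetric hC) := by
  have h : (1 : ℝ) * 1 = 1 := one_mul 1
  have h' : (-1 : ℝ) * -1 = 1 := neg_mul_neg_one h
  have hp : ∀ X : VF d M, G.IsPure 1 (G.liftESec hC 1 X) := isPure_liftESec hC h
  have hm : ∀ X : VF d M, G.IsPure (-1) (G.liftESec hC (-1) X) := isPure_liftESec hC h'
  constructor
  · intro Y Z x u
    obtain ⟨X, rfl⟩ := exists_section (d := d) (F := EuclideanSpace ℝ (Fin d)) x u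
    rw [G.baseNabla_apply, G.baseNabla_apply, G.baseMetric_nablaSec,
      G.baseMetric_symm, G.baseMetric_nablaSec]
    have h1 := G.mixed_metric 1 (G.liftESec hC (-1) X) (G.liftESec hC 1 Y) (G.liftESec hC 1 Z) x
    have h2 := G.mixed_metric (-1) (G.liftESec hC 1 X) (G.liftESec hC (-1) Y)
      (G.liftESec hC (-1) Z) x
    rw [(hp Y).projSec h, (hp Z).projSec h, ← G.projSec_apply (-1), (hm X).projSec h',
      C.pairing_symm x _ (G.mixed 1 (G.liftESec hC (-1) X) (G.liftESec hC 1 Z) x)] at h1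
    rw [(hm Y).projSec h', (hm Z).projSec h', ← G.projSec_apply (- -1), neg_neg,
      (hp X).projSec h,
      C.pairing_symm x _ (G.mixed (-1) (G.liftESec hC 1 X) (G.liftESec hC (-1) Z) x),
      show ⇑(C.pair (G.liftESec hC (-1) Y) (G.liftESec hC (-1) Z)) = fun y =>
        -C.pair (G.liftESec hC 1 Y) (G.liftESec hC 1 Z) y by
          funext y
          simp only [pair_apply, G.liftESec_apply, G.pairing_liftE hC (Or.inr rfl)]
          rw [G.baseMetric_apply]; ring, mvfderiv_fun_neg'] at h2
    simp only [G.liftESec_apply, G.anchor_liftE] at h1 h2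
    change mvfderiv (𝓡 d) (C.pair (G.liftESec hC 1 Y) (G.liftESec hC 1 Z)) x (X x) = _
    linarith
  · intro X Y x
    rw [G.baseNabla_apply, G.baseNabla_apply, G.nablaSec_apply, G.nablaSec_apply]
    -- By orthogonality `[Y_+, X_-] = -[X_-, Y_+]`, so the difference is the anchor of all of `[X_-,
    -- Y_+]`. The torsion is half the sum of this for `(X, Y)` and its negative for `(Y, X)`.
    have e : ∀ X Y : VF d M, C.anchor x (G.mixed 1 (G.liftESec hC (-1) X) (G.liftESec hC 1 Y) x) -
        C.anchor x (G.mixed (-1) (G.liftESec hC 1 Y) (G.liftESec hC (-1) X) x) =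
        VectorField.mlieBracket (𝓡 d) X Y x := fun X Y => by
      simp only [GenMetric.mixed, (hm X).projSec h', (hp Y).projSec h, neg_neg]
      rw [bracket_eq_neg ((hp Y).pairing_eq_zero h (hm X)), ← map_sub]
      simp only [G.projSec_apply, Sec.neg_apply, map_neg, sub_neg_eq_add]
      rw [G.proj_add_proj, C.anchor_bracket]
      simp
    have e1 := e X Y
    have e2 := e Y X
    rw [VectorField.mlieBracket_swap, Pi.neg_apply] at e2
    rw [← smul_sub]
    have e3 : VectorField.mlieBracket (𝓡 d) X Y x = (1 / 2 : ℝ) •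
        (VectorField.mlieBracket (𝓡 d) X Y x - -VectorField.mlieBracket (𝓡 d) X Y x) := by module
    rw [e3]
    nth_rewrite 1 [← e1]
    rw [← e2]
    congr 1
    abel

theorem GenMetric.lift_eq (x : M) (X : TM d x) :
    G.lift hC x X = (1 / 2 : ℝ) • (G.liftE hC 1 x X + G.liftE hC (-1) x X) := by
  rw [G.liftE_apply, G.liftE_apply]; module

/-- A section of `𝒢^end(T*M)` is half the sum of its lifts to `E_+` and `E_-`. Of the eight
resulting brackets the two pure ones are reduced to mixed ones by `bracket_pure`, and skewness of
the flux collects the rest. -/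
theorem GenMetric.baseFlux_spec (a b c : Sec d F E) (ha : ∀ x, C.anchor x (G.endo x (a x)) = 0)
    (hb : ∀ x, C.anchor x (G.endo x (b x)) = 0) (hc : ∀ x, C.anchor x (G.endo x (c x)) = 0)
    (x : M) : G.baseFlux hC x (C.anchor x (a x)) (C.anchor x (b x)) (C.anchor x (c x)) =
      2 * C.pairing x (C.bracket a b x) (c x) := by
  have h : (1 : ℝ) * 1 = 1 := one_mul 1
  have h' : (-1 : ℝ) * -1 = 1 := neg_mul_neg_one h
  have hp : ∀ X : VF d M, G.IsPure 1 (G.liftESec hC 1 X) := isPure_liftESec hC h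
  have hm : ∀ X : VF d M, G.IsPure (-1) (G.liftESec hC (-1) X) := isPure_liftESec hC h'
  have e : ∀ a : Sec d F E, (∀ x, C.anchor x (G.endo x (a x)) = 0) → a = (1 / 2 : ℝ) •
      (G.liftESec hC 1 (C.anchorSec a) + G.liftESec hC (-1) (C.anchorSec a)) := fun a ha => by
    ext x
    exact (G.eq_lift hC (ha x)).trans (G.lift_eq hC x _)
  have r1 : ∀ X : VF d M, G.reflSec hC (G.liftESec hC 1 X) = G.liftESec hC (-1) X :=
    fun X => reflSec_liftESec hC 1 X
  have r2 : ∀ X : VF d M, G.reflSec hC (G.liftESec hC (-1) X) = G.liftESec hC 1 X :=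
    fun X => by rw [reflSec_liftESec, neg_neg]
  refine (G.baseFlux_vf hC (C.anchorSec a) (C.anchorSec b) (C.anchorSec c) x).trans ?_
  conv_rhs => rw [e a ha, e b hb, e c hc]
  generalize C.anchorSec a = X
  generalize C.anchorSec b = Y
  generalize C.anchorSec c = Z
  have b1 := bracket_pure hC (hp X) (hp Y) (hp Z) h x
  have b2 := bracket_pure hC (hm X) (hm Y) (hm Z) h' x
  have k1 := bracket_skew ((hp X).pairing_eq_zero h (hm Y)) (G.liftESec hC 1 Z) x
  have k2 := bracket_skew ((hp Y).pairing_eq_zero h (hm X)) (G.liftESec hC (-1) Z) x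
  have k3 := bracket_pairing_skew ((hp Y).pairing_eq_zero h (hm Z)) (G.liftESec hC 1 X) x
  have k4 := bracket_pairing_skew ((hm Y).pairing_eq_zero' h (hp Z)) (G.liftESec hC (-1) X) x
  have k5 := bracket_skew ((hp X).pairing_eq_zero h (hm Z)) (G.liftESec hC 1 Y) x
  have k6 := bracket_skew ((hp Z).pairing_eq_zero h (hm X)) (G.liftESec hC (-1) Y) x
  have s1 := G.fluxVF_swap_left hC X Y Z x
  have s2 := G.fluxVF_swap_right hC X Y Z x
  have s3 := G.fluxVF_swap_left hC X Z Y x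
  simp only [GenMetric.fluxVF, GenMetric.flux, r1, r2] at b1 b2 s1 s2 s3 ⊢
  simp only [map_add, map_smul, LinearMap.add_apply, LinearMap.smul_apply, Sec.add_apply,
    Sec.smul_apply, smul_eq_mul]
  linarith

/-- The induced geometry of a generalised metric. -/
def GenMetric.induced : InducedGeometry C G where
  g := G.baseMetric hC
  g_spec x u v hu hv := by
    rw [G.baseMetric_apply,
      ← G.eq_liftE hC (one_mul 1) (hu.trans (one_smul ℝ u).symm),
      ← G.eq_liftE hC (one_mul 1) (hv.trans (one_smul ℝ v).symm)]
  H := G.baseFlux hC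
  H_spec := G.baseFlux_spec hC
  nabla := G.baseNabla hC
  leviCivita := G.baseNabla_isLeviCivita hC

/-- Makes the induced geometry that occurs in a hypothesis, in particular the existential one in
`IsCanonicalZero`, interchangeable with the constructed one. -/
theorem InducedGeometry.eq_induced (Q : InducedGeometry C G) : Q = G.induced hC := by
  have hg : Q.g = G.baseMetric hC := by
    funext x
    ext X Y
    rw [G.baseMetric_apply, ← Q.g_spec x, G.anchor_liftE, G.anchor_liftE]
    · rw [G.endo_liftE hC (one_mul 1), one_smul]
    · rw [G.endo_liftE hC (one_mul 1), one_smul]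
  have hH : Q.H = G.baseFlux hC := by
    funext x
    ext X Y Z
    have h1 := Q.H_spec (G.liftSec hC (GenGeom.ext X)) (G.liftSec hC (GenGeom.ext Y))
      (G.liftSec hC (GenGeom.ext Z)) (by simp) (by simp) (by simp) x
    have h2 := G.baseFlux_spec hC (G.liftSec hC (GenGeom.ext X)) (G.liftSec hC (GenGeom.ext Y))
      (G.liftSec hC (GenGeom.ext Z)) (by simp) (by simp) (by simp) x
    rw [← h2] at h1
    simpa only [G.liftSec_apply, G.anchor_lift, ext_apply] using h1
  have hn : Q.nabla = G.baseNabla hC := by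
    refine AffineConnection.IsLeviCivita.unique (g := G.baseMetric hC) (G.baseMetric_symm hC)
      (G.baseMetric_nondeg hC) ?_ (G.baseNabla_isLeviCivita hC)
    rw [← hg]; exact Q.leviCivita
  cases Q
  subst hg hH hn
  rfl

/-- Here `∇` is the half difference of the two quantities whose sum is the flux. So each mixed
bracket is determined by `∇` and `H`. -/
theorem GenMetric.baseNabla_pure (hε : ε = 1 ∨ ε = -1) {a b c : Sec d F E} (ha : G.IsPure ε a)
    (hb : G.IsPure ε b) (hc : G.IsPure ε c) (x : M) :
    ε * G.baseMetric hC x ((G.baseNabla hC).toFun (C.anchorSec b) x (C.anchor x (a x)))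
      (C.anchor x (c x)) =
      1 / 2 * (C.pairing x (C.bracket (G.reflSec hC a) b x) (c x) -
        C.pairing x (C.bracket a (G.reflSec hC b) x) (G.reflSec hC c x)) := by
  have h : (1 : ℝ) * 1 = 1 := one_mul 1
  have h' : (-1 : ℝ) * -1 = 1 := neg_mul_neg_one h
  have hp : ∀ X : VF d M, G.IsPure 1 (G.liftESec hC 1 X) := isPure_liftESec hC h
  have hm : ∀ X : VF d M, G.IsPure (-1) (G.liftESec hC (-1) X) := isPure_liftESec hC h'
  have key : ∀ X Y Z : VF d M, G.baseMetric hC x (G.nablaSec hC X Y x) (Z x) =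
      1 / 2 * (C.pairing x (C.bracket (G.liftESec hC (-1) X) (G.liftESec hC 1 Y) x)
        (G.liftESec hC 1 Z x) - C.pairing x (C.bracket (G.liftESec hC 1 X) (G.liftESec hC (-1) Y) x)
        (G.liftESec hC (-1) Z x)) := fun X Y Z => by
    rw [G.baseMetric_nablaSec]
    simp only [GenMetric.mixed, (hm X).projSec h', (hp Y).projSec h, neg_neg, (hm Y).projSec h',
      (hp X).projSec h, G.projSec_apply, G.pairing_proj, G.liftESec_apply,
      G.proj_eq_self h (G.endo_liftE hC h x (Z x)), G.proj_eq_self h' (G.endo_liftE hC h' x (Z x))]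
  have e1 := (G.baseNabla_apply hC (C.anchorSec a) (C.anchorSec b) x)
  rw [anchorSec_apply] at e1
  rw [e1, ← anchorSec_apply c, key]
  rcases hε with rfl | rfl
  · rw [← reflSec_liftESec, ← reflSec_liftESec, ← reflSec_liftESec, ← ha.eq_liftESec hC h,
      ← hb.eq_liftESec hC h, ← hc.eq_liftESec hC h]
    ring
  · have r : ∀ X : VF d M, G.liftESec hC 1 X = G.reflSec hC (G.liftESec hC (-1) X) :=
      fun X => by rw [reflSec_liftESec, neg_neg]
    rw [r, r, r, ← ha.eq_liftESec hC h', ← hb.eq_liftESec hC h', ← hc.eq_liftESec hC h']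
    ring

theorem GenMetric.zeroConn_isCanonicalZero : (G.zeroConn hC).IsCanonicalZero G where
  leviCivita := G.zeroConn_isLeviCivita hC
  pure := by
    refine ⟨G.induced hC, fun ε hε a b c ha hb hc x => ?_⟩
    have h1 := G.baseNabla_pure hC hε ha hb hc x
    have h2 := G.baseFlux_apply hC hε ha hb hc x
    -- With `P` and `Q` the two mixed brackets, the identity is `2/3 P - 1/3 Q = 1/2 (P - Q) + 1/6
    -- (P + Q)`.
    rw [G.zeroConn_apply, G.zeroSec_pairing_pure hC hε ha hb hc]
    change _ = ε * G.baseMetric hC x _ _ + 1 / 6 * G.baseFlux hC x _ _ _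
    erw [h1, h2]
    rw [GenMetric.flux]
    ring

/-! #### Uniqueness -/

theorem GenConnection.ext' {D D' : C.GenConnection}
    (h : ∀ (a b : Sec d F E) (x : M), D.toFun b x (a x) = D'.toFun b x (a x)) : D = D' := by
  have : D.toFun = D'.toFun := by
    funext Y x
    ext u : 1
    have := h (GenGeom.ext u) Y x
    rwa [ext_apply] at this
  cases D; cases D'; congr

theorem GenConnection.toFun_smul (D : C.GenConnection) (r : ℝ) (b : Sec d F E) (x : M) :
    D.toFun (r • b) x = r • D.toFun b x := by
  ext u : 1
  let f : Fun d M := ⟨fun _ => r, contMDiff_const⟩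
  have h := D.leibniz' f b x u
  have e : fsmul f b = r • b := by ext y; rfl
  have e' : mvfderiv (𝓡 d) f x = 0 := mvfderiv_const r
  have ef : f x = r := rfl
  rw [e, e', ef] at h
  simpa using h

variable {G}

/-- Preserving both `⟨·,·⟩` and `𝒢` amounts to commuting with `𝒢^end`; in particular `D` preserves
`E_±`. -/
theorem GenConnection.IsLeviCivita.toFun_endoSec {D : C.GenConnection} (hD : D.IsLeviCivita G)
    (b : Sec d F E) (x : M) (u : E x) :
    D.toFun (G.endoSec b) x u = G.endo x (D.toFun b x u) := by
  refine pairing_ext_sec (d := d) (F := F) (C := C) x fun c => ?_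
  have h1 := hD.metric b c x u
  have h2 := D.pairing' (G.endoSec b) c x u
  simp only [G.form_apply] at h1
  simp only [G.endoSec_apply] at h2
  linarith

theorem GenConnection.IsLeviCivita.endo_toFun {D : C.GenConnection} (hD : D.IsLeviCivita G)
    {b : Sec d F E} (hb : G.IsPure ε b) (x : M) (u : E x) :
    G.endo x (D.toFun b x u) = ε • D.toFun b x u := by
  rw [← hD.toFun_endoSec, show G.endoSec b = ε • b by ext y; exact hb y, D.toFun_smul]; rfl

/-- In the torsion identity the two terms differentiating `a` stay in the eigenbundle of `a`, which
is orthogonal to `b` and `c`. -/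
theorem GenConnection.IsLeviCivita.pairing_mixed {D : C.GenConnection} (hD : D.IsLeviCivita G)
    (hε : ε * ε = 1) {a b c : Sec d F E} (ha : G.IsPure (-ε) a) (hb : G.IsPure ε b)
    (hc : G.IsPure ε c) (x : M) : C.pairing x (D.toFun b x (a x)) (c x) =
      C.pairing x (C.bracket a b x) (c x) := by
  have h := hD.torsion a b c x
  have h1 := G.pairing_eq_zero hε (hc x) (hD.endo_toFun ha x (b x))
  have h2 := G.pairing_eq_zero hε (hb x) (hD.endo_toFun ha x (c x))
  rw [C.pairing_symm] at h1 h2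
  simp only [map_sub, LinearMap.sub_apply] at h
  linarith

/-- A generalised Levi-Civita connection is determined by its pure-type parts. -/
theorem GenConnection.IsLeviCivita.eq_of_pure {D D' : C.GenConnection} (hD : D.IsLeviCivita G)
    (hD' : D'.IsLeviCivita G) (h : ∀ ε : ℝ, (ε = 1 ∨ ε = -1) → ∀ a b c : Sec d F E,
      G.IsPure ε a → G.IsPure ε b → G.IsPure ε c → ∀ x,
      C.pairing x (D.toFun b x (a x)) (c x) = C.pairing x (D'.toFun b x (a x)) (c x)) :
    D = D' := by
  have key : ∀ ε : ℝ, (ε = 1 ∨ ε = -1) → ∀ a b : Sec d F E, G.IsPure ε b → ∀ x,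
      D.toFun b x (a x) = D'.toFun b x (a x) := fun ε hε a b hb x => by
    have hε' : ε * ε = 1 := by rcases hε with rfl | rfl <;> norm_num
    refine pairing_ext_sec (d := d) (F := F) (C := C) x fun c => ?_
    have hc := GenMetric.isPure_projSec (G := G) hε' c
    rw [G.projSec_add_projSec ε c, Sec.add_apply, map_add, map_add,
      G.pairing_eq_zero hε' (hD.endo_toFun hb x _)
        (GenMetric.isPure_projSec (neg_mul_neg_one hε') c x),
      G.pairing_eq_zero hε' (hD'.endo_toFun hb x _)
        (GenMetric.isPure_projSec (neg_mul_neg_one hε') c x),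
      G.projSec_add_projSec ε a, Sec.add_apply, map_add, map_add, map_add, map_add,
      LinearMap.add_apply, LinearMap.add_apply,
      hD.pairing_mixed hε' (GenMetric.isPure_projSec (neg_mul_neg_one hε') a) hb hc,
      hD'.pairing_mixed hε' (GenMetric.isPure_projSec (neg_mul_neg_one hε') a) hb hc,
      h ε hε _ b _ (GenMetric.isPure_projSec hε' a) hb hc]
  refine GenConnection.ext' fun a b x => ?_
  rw [G.projSec_add_projSec 1 b, D.add', D'.add', LinearMap.add_apply, LinearMap.add_apply,
    key 1 (Or.inl rfl) _ _ (GenMetric.isPure_projSec (one_mul 1) b),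
    key (-1) (Or.inr rfl) _ _ (GenMetric.isPure_projSec (neg_mul_neg_one (one_mul 1)) b)]

theorem GenConnection.IsCanonicalZero.eq_zeroConn {D : C.GenConnection}
    (hD : D.IsCanonicalZero G) : D = G.zeroConn hC := by
  refine hD.leviCivita.eq_of_pure (G.zeroConn_isLeviCivita hC) fun ε hε a b c ha hb hc x => ?_
  obtain ⟨Q, hQ⟩ := hD.pure
  obtain ⟨Q', hQ'⟩ := (G.zeroConn_isCanonicalZero hC).pure
  rw [hQ ε hε a b c ha hb hc, hQ' ε hε a b c ha hb hc, Q.eq_induced G hC, Q'.eq_induced G hC]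

end CourantAlgebroid

end Induced

end GenGeom
end

open Bundle Manifold
open scoped ContDiff
noncomputable section
set_option linter.unusedSectionVars false
namespace GenGeom

/-! ### The generalised first prolongation and the divergence -/

section Prolongation

variable {d : ℕ} {M : Type*} [TopologicalSpace M] [ChartedSpace (EuclideanSpace ℝ (Fin d)) M]
  [IsManifold (𝓡 d) ∞ M]
  {F : Type*} [NormedAddCommGroup F] [NormedSpace ℝ F] [FiniteDimensional ℝ F]
  {E : M → Type*} [∀ x, AddCommGroup (E x)] [∀ x, Module ℝ (E x)]
  [∀ x, TopologicalSpace (E x)] [TopologicalSpace (TotalSpace F E)]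
  [FiberBundle F E] [VectorBundle ℝ F E]

namespace CourantAlgebroid

variable {C : CourantAlgebroid d F E} (G : C.GenMetric) (hC : C.IsExact) {ε : ℝ}

include hC in
-- Conjugation by the reflection changes the sign of `𝒢^end`.
theorem GenMetric.trace_endo (x : M) : LinearMap.trace ℝ (E x) (G.endo x) = 0 := by
  have : FiniteDimensional ℝ (E x) := VectorBundle.finiteDimensional ℝ F E x
  have h1 : G.endo x = -(G.refl hC x ∘ₗ (G.endo x ∘ₗ G.refl hC x)) := by
    ext u
    simp [G.endo_refl, G.refl_refl]
  have h2 : G.endo x = (G.endo x ∘ₗ G.refl hC x) ∘ₗ G.refl hC x := by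
    ext u
    simp [G.refl_refl]
  have h3 := congrArg (LinearMap.trace ℝ (E x)) h1
  rw [map_neg, LinearMap.trace_comp_comm', ← h2] at h3
  linarith

theorem finrank_TM (x : M) : Module.finrank ℝ (TM d x) = d := by
  change Module.finrank ℝ (EuclideanSpace ℝ (Fin d)) = d
  simp

include G hC in
-- The reflection is trace-free, since it anticommutes with the involution `𝒢^end`; and `lift ∘ π`
-- has the trace of `π ∘ lift = id` on `TM`.
theorem GenMetric.trace_id (x : M) : LinearMap.trace ℝ (E x) LinearMap.id = 2 * d := by
  have : FiniteDimensional ℝ (E x) := VectorBundle.finiteDimensional ℝ F E x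
  have : FiniteDimensional ℝ (TM d x) :=
    inferInstanceAs (FiniteDimensional ℝ (EuclideanSpace ℝ (Fin d)))
  have h1 : LinearMap.trace ℝ (E x) (G.refl hC x) = 0 := by
    have e1 : G.refl hC x = -(G.endo x ∘ₗ (G.refl hC x ∘ₗ G.endo x)) := by
      ext u
      simp [G.endo_refl, G.endo_endo]
    have e2 : G.refl hC x = (G.refl hC x ∘ₗ G.endo x) ∘ₗ G.endo x := by
      ext u
      simp [G.endo_endo]
    have h3 := congrArg (LinearMap.trace ℝ (E x)) e1
    rw [map_neg, LinearMap.trace_comp_comm', ← e2] at h3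
    linarith
  have h2 : LinearMap.trace ℝ (E x) (G.lift hC x ∘ₗ C.anchor x) = d := by
    rw [LinearMap.trace_comp_comm']
    have : C.anchor x ∘ₗ G.lift hC x = LinearMap.id := by ext X : 1; simp
    rw [this, LinearMap.trace_id, finrank_TM]
  rw [GenMetric.refl, map_sub, map_smul, h2, smul_eq_mul] at h1
  linarith

/-! ### Elements of the prolongation with prescribed trace -/

/-- The element of the generalised first prolongation defined by a vector `e`. -/
def GenMetric.weyl (x : M) (e : E x) : E x →ₗ[ℝ] E x →ₗ[ℝ] E x :=
  (1 / 2 : ℝ) • (LinearMap.mk₂ ℝ (fun u v => C.pairing x u v • e +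
      C.pairing x (G.endo x u) v • G.endo x e - C.pairing x e v • u -
      C.pairing x (G.endo x e) v • G.endo x u)
    (fun u u' v => by simp only [map_add, LinearMap.add_apply]; module)
    (fun r u v => by simp only [map_smul, LinearMap.smul_apply, smul_eq_mul]; module)
    (fun u v v' => by simp only [map_add]; module)
    (fun r u v => by simp only [map_smul, smul_eq_mul]; module))

/-- In components along `E_±` this is the sum over both signs of `⟨u_±, v_±⟩ e_± - ⟨e_±, v_±⟩ u_±`.
-/
theorem GenMetric.weyl_apply (x : M) (e u v : E x) : G.weyl x e u v = (1 / 2 : ℝ) •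
    (C.pairing x u v • e + C.pairing x (G.endo x u) v • G.endo x e - C.pairing x e v • u -
      C.pairing x (G.endo x e) v • G.endo x u) := rfl

theorem GenMetric.pairing_weyl (x : M) (e u v w : E x) : C.pairing x (G.weyl x e u v) w = 1 / 2 *
    (C.pairing x u v * C.pairing x e w + C.pairing x (G.endo x u) v * C.pairing x (G.endo x e) w -
      C.pairing x e v * C.pairing x u w - C.pairing x (G.endo x e) v * C.pairing x (G.endo x u) w)
    := by
  simp [G.weyl_apply]

theorem GenMetric.weyl_mem (x : M) (e : E x) : G.InProlongation x (G.weyl x e) where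
  skew u v w := by
    rw [C.pairing_symm x v, G.pairing_weyl, G.pairing_weyl]
    ring
  comm u v := by
    simp only [G.weyl_apply, map_smul, map_add, map_sub, G.endo_endo, ← G.endo_symm]
    module
  cyclic u v w := by
    rw [G.pairing_weyl, G.pairing_weyl, G.pairing_weyl, C.pairing_symm x v u,
      C.pairing_symm x w u, C.pairing_symm x w v, G.endo_symm x v u, G.endo_symm x w u,
      G.endo_symm x w v, C.pairing_symm x v (G.endo x u), C.pairing_symm x w (G.endo x u),
      C.pairing_symm x w (G.endo x v)]
    ring

include hC in
-- The rank-one terms contribute `⟨e, v⟩`; the others contribute `-d ⟨e, v⟩`, because `tr id = 2d`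
-- and `tr 𝒢^end = 0`. For `d ≥ 2` the factor is nonzero, so every trace is attained.
theorem GenMetric.trace_weyl (x : M) (e v : E x) :
    LinearMap.trace ℝ (E x) ((G.weyl x e).flip v) = (1 - d) * C.pairing x e v := by
  have : FiniteDimensional ℝ (E x) := VectorBundle.finiteDimensional ℝ F E x
  have h : (G.weyl x e).flip v = (1 / 2 : ℝ) • (((C.pairing x).flip v).smulRight e +
      ((C.pairing x).flip (G.endo x v)).smulRight (G.endo x e) -
      C.pairing x e v • LinearMap.id - C.pairing x (G.endo x e) v • G.endo x) := by
    ext u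
    simp [G.weyl_apply, G.endo_symm]
  have tr : ∀ (f : E x →ₗ[ℝ] ℝ) (u : E x), LinearMap.trace ℝ (E x) (f.smulRight u) = f u :=
    fun f u => LinearMap.trace_smulRight f u
  rw [h, map_smul, map_sub, map_sub, map_add, tr, tr, map_smul, map_smul, G.trace_endo hC,
    G.trace_id hC]
  have f1 : (C.pairing x).flip v e = C.pairing x e v := rfl
  have f2 : (C.pairing x).flip (G.endo x v) (G.endo x e) = C.pairing x e v :=
    G.pairing_endo_endo x e v
  rw [f1, f2]
  simp only [smul_eq_mul]
  ring

variable {G}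

theorem GenMetric.InProlongation.sub {x : M} {S T : E x →ₗ[ℝ] E x →ₗ[ℝ] E x}
    (hS : G.InProlongation x S) (hT : G.InProlongation x T) : G.InProlongation x (S - T) where
  skew u v w := by
    simp only [LinearMap.sub_apply, map_sub]
    rw [hS.skew, hT.skew]; ring
  comm u v := by
    simp only [LinearMap.sub_apply, map_sub]
    rw [hS.comm, hT.comm]
  cyclic u v w := by
    have h1 := hS.cyclic u v w
    have h2 := hT.cyclic u v w
    simp only [LinearMap.sub_apply, map_sub]
    linarith

theorem GenMetric.InProlongation.endo {x : M} {T : E x →ₗ[ℝ] E x →ₗ[ℝ] E x}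
    (hT : G.InProlongation x T) {v : E x} (hv : G.endo x v = ε • v) (u : E x) :
    G.endo x (T u v) = ε • T u v := by
  rw [← hT.comm, hv, map_smul]

/-! ### Orthogonality and nondegeneracy in the prolongation -/

/-- The trilinear form `⟨T_u v, w⟩`. -/
def triForm (C : CourantAlgebroid d F E) (x : M) (T : E x →ₗ[ℝ] E x →ₗ[ℝ] E x) :
    E x →ₗ[ℝ] E x →ₗ[ℝ] E x →ₗ[ℝ] ℝ :=
  T.compr₂ (C.pairing x)

theorem triForm_apply (x : M) (T : E x →ₗ[ℝ] E x →ₗ[ℝ] E x) (u v w : E x) :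
    C.triForm x T u v w = C.pairing x (T u v) w := rfl

/-- The scalar product of trilinear maps `T : u ↦ T_u` induced by `𝒢`. -/
def GenMetric.inner₃ (G : C.GenMetric) (x : M) (S T : E x →ₗ[ℝ] E x →ₗ[ℝ] E x) : ℝ :=
  haveI : FiniteDimensional ℝ (E x) := VectorBundle.finiteDimensional ℝ F E x
  tensorInner (G.form x) 3 (fun u => C.triForm x S (u 0) (u 1) (u 2))
    (fun u => C.triForm x T (u 0) (u 1) (u 2))

/-- Packages a basis, its `𝒢`-dual basis and the trace formula, so that later contractions are plain
finite sums. -/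
theorem GenMetric.exists_inner₃_eq (G : C.GenMetric) (x : M) :
    ∃ (n : ℕ) (b b' : Fin n → E x),
      (∀ v, ∑ i, G.form x (b' i) v • b i = v) ∧
      (∀ L : E x →ₗ[ℝ] E x, LinearMap.trace ℝ (E x) L = ∑ i, G.form x (b' i) (L (b i))) ∧
      ∀ S T : E x →ₗ[ℝ] E x →ₗ[ℝ] E x, G.inner₃ x S T = ∑ i, ∑ j, ∑ k,
        C.pairing x (S (b i) (b j)) (b k) * C.pairing x (T (b' i) (b' j)) (b' k) := by
  have : FiniteDimensional ℝ (E x) := VectorBundle.finiteDimensional ℝ F E x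
  let b := Module.finBasis ℝ (E x)
  exact ⟨_, b, dualVec b (G.form x), sum_dualVec_smul b (G.form_nondeg x),
    trace_eq_sum_dualVec b (G.form_nondeg x), fun S T => contraction_three b _ _⟩

theorem sum_sum_contract {V : Type*} [AddCommGroup V] [Module ℝ V] {n : ℕ} {b b' : Fin n → V}
    {B : LinearMap.BilinForm ℝ V} (hb : ∀ v, ∑ i, B (b' i) v • b i = v)
    (S : V →ₗ[ℝ] V →ₗ[ℝ] ℝ) (v w : V) :
    ∑ j, ∑ k, S (b j) (b k) * (B (b' j) v * B (b' k) w) = S v w := by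
  conv_rhs => rw [← hb v, ← hb w]
  simp only [map_sum, map_smul, LinearMap.sum_apply, LinearMap.smul_apply, smul_eq_mul,
    Finset.mul_sum]
  rw [Finset.sum_comm]
  refine Finset.sum_congr rfl fun j _ => Finset.sum_congr rfl fun k _ => ?_
  ring

theorem sum_sum_sum_contract {V : Type*} [AddCommGroup V] [Module ℝ V] {n : ℕ} {b b' : Fin n → V}
    {B : LinearMap.BilinForm ℝ V} (hb : ∀ v, ∑ i, B (b' i) v • b i = v)
    (S : V →ₗ[ℝ] V →ₗ[ℝ] V →ₗ[ℝ] ℝ) (u v w : V) :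
    ∑ i, ∑ j, ∑ k, S (b i) (b j) (b k) * (B (b' i) u * (B (b' j) v * B (b' k) w)) = S u v w := by
  have h : ∀ i, ∑ j, ∑ k, S (b i) (b j) (b k) * (B (b' i) u * (B (b' j) v * B (b' k) w)) =
      B (b' i) u * S (b i) v w := fun i => by
    rw [← sum_sum_contract hb (S (b i)) v w, Finset.mul_sum]
    refine Finset.sum_congr rfl fun j _ => ?_
    rw [Finset.mul_sum]
    refine Finset.sum_congr rfl fun k _ => ?_
    ring
  simp only [h]
  conv_rhs => rw [← hb u]
  simp only [map_sum, map_smul, LinearMap.sum_apply, LinearMap.smul_apply, smul_eq_mul]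

theorem GenMetric.form_endo (x : M) (u v : E x) : G.form x u (G.endo x v) = C.pairing x u v := by
  rw [G.form_apply, G.pairing_endo_endo]

/-- Trace-free elements of the prolongation are orthogonal to the elements `G.weyl x e`. -/
theorem GenMetric.InProlongation.inner₃_weyl {x : M} {K : E x →ₗ[ℝ] E x →ₗ[ℝ] E x}
    (hK : G.InProlongation x K) (htr : ∀ v, LinearMap.trace ℝ (E x) (K.flip v) = 0) (e : E x) :
    G.inner₃ x K (G.weyl x e) = 0 := by
  obtain ⟨n, b, b', hb, htr', hin⟩ := G.exists_inner₃_eq x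
  rw [hin]
  -- Contracting `K` with each of the four terms of `G.weyl x e` gives the same quantity up to sign,
  -- by skewness and by commutation with `𝒢^end`. Summed over `i` it is a multiple of `tr(u ↦ K_u
  -- 𝒢^end e)`.
  have h1 : ∀ i, ∑ j, ∑ k, C.pairing x (K (b i) (b j)) (b k) *
      C.pairing x (G.weyl x e (b' i) (b' j)) (b' k) =
      -2 * G.form x (b' i) (K (b i) (G.endo x e)) := fun i => by
    have e1 := sum_sum_contract hb (C.triForm x K (b i)) (G.endo x (b' i)) (G.endo x e)
    have e2 := sum_sum_contract hb (C.triForm x K (b i)) (b' i) e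
    have e3 := sum_sum_contract hb (C.triForm x K (b i)) (G.endo x e) (G.endo x (b' i))
    have e4 := sum_sum_contract hb (C.triForm x K (b i)) e (b' i)
    simp only [triForm_apply] at e1 e2 e3 e4
    have s : ∀ j k, C.pairing x (K (b i) (b j)) (b k) *
        C.pairing x (G.weyl x e (b' i) (b' j)) (b' k) = 1 / 2 * (
        C.pairing x (K (b i) (b j)) (b k) *
          (G.form x (b' j) (G.endo x (b' i)) * G.form x (b' k) (G.endo x e)) +
        C.pairing x (K (b i) (b j)) (b k) * (G.form x (b' j) (b' i) * G.form x (b' k) e) -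
        C.pairing x (K (b i) (b j)) (b k) *
          (G.form x (b' j) (G.endo x e) * G.form x (b' k) (G.endo x (b' i))) -
        C.pairing x (K (b i) (b j)) (b k) * (G.form x (b' j) e * G.form x (b' k) (b' i))) :=
      fun j k => by
        rw [G.pairing_weyl]
        simp only [G.form_endo, G.form_symm x (b' j), G.form_symm x (b' k), G.form_apply]
        rw [C.pairing_symm x (b' j) (b' i), C.pairing_symm x (b' k) e,
          C.pairing_symm x (b' j) e, C.pairing_symm x (b' k) (b' i)]
        ring
    simp only [s, ← Finset.mul_sum, Finset.sum_add_distrib, Finset.sum_sub_distrib]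
    rw [e1, e2, e3, e4, hK.comm, hK.comm, G.pairing_endo_endo, G.pairing_endo_endo,
      G.form_endo, hK.skew, C.pairing_symm x (K (b i) e) (b' i)]
    ring
  simp only [h1, ← Finset.mul_sum]
  have h2 := htr (G.endo x e)
  rw [htr'] at h2
  simp only [LinearMap.flip_apply] at h2
  rw [h2, mul_zero]

/-- A spanning family of elements of the prolongation. -/
def GenMetric.young (G : C.GenMetric) (x : M) (α β γ : E x) : E x →ₗ[ℝ] E x →ₗ[ℝ] E x :=
  LinearMap.mk₂ ℝ (fun u v =>
      (2 * G.form x u α) • (G.form x v β • γ - G.form x v γ • β) -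
      G.form x v α • (G.form x u γ • β - G.form x u β • γ) -
      (G.form x u β * G.form x v γ - G.form x v β * G.form x u γ) • α)
    (fun u u' v => by simp only [map_add, LinearMap.add_apply]; module)
    (fun r u v => by simp only [map_smul, LinearMap.smul_apply, smul_eq_mul]; module)
    (fun u v v' => by simp only [map_add, LinearMap.add_apply]; module)
    (fun r u v => by simp only [map_smul, LinearMap.smul_apply, smul_eq_mul]; module)

/-- With `A = α ⊗ (β ∧ γ)`, formed through `𝒢`, this is `3A` minus the cyclic sum of `A`, that is, a
multiple of the projection to tensors of vanishing cyclic sum. -/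
theorem GenMetric.young_apply (x : M) (α β γ u v : E x) : G.young x α β γ u v =
    (2 * G.form x u α) • (G.form x v β • γ - G.form x v γ • β) -
      G.form x v α • (G.form x u γ • β - G.form x u β • γ) -
      (G.form x u β * G.form x v γ - G.form x v β * G.form x u γ) • α := rfl

theorem GenMetric.pairing_eq_form (hε : ε * ε = 1) {x : M} {α : E x} (hα : G.endo x α = ε • α)
    (w : E x) : C.pairing x α w = ε * G.form x w α := by
  rw [G.form_symm, G.form_apply, hα, map_smul, LinearMap.smul_apply, smul_eq_mul, ← mul_assoc, hε,
    one_mul]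

theorem GenMetric.pairing_young (hε : ε * ε = 1) {x : M} {α β γ : E x} (hα : G.endo x α = ε • α)
    (hβ : G.endo x β = ε • β) (hγ : G.endo x γ = ε • γ) (u v w : E x) :
    C.pairing x (G.young x α β γ u v) w = ε * (
      2 * G.form x u α * (G.form x v β * G.form x w γ - G.form x v γ * G.form x w β) -
      G.form x v α * (G.form x u γ * G.form x w β - G.form x u β * G.form x w γ) -
      (G.form x u β * G.form x v γ - G.form x v β * G.form x u γ) * G.form x w α) := by
  rw [G.young_apply]
  simp only [map_sub, map_smul, LinearMap.sub_apply, LinearMap.smul_apply, smul_eq_mul,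
    G.pairing_eq_form hε hα, G.pairing_eq_form hε hβ, G.pairing_eq_form hε hγ]
  ring

theorem GenMetric.young_mem (hε : ε * ε = 1) {x : M} {α β γ : E x} (hα : G.endo x α = ε • α)
    (hβ : G.endo x β = ε • β) (hγ : G.endo x γ = ε • γ) :
    G.InProlongation x (G.young x α β γ) where
  skew u v w := by
    rw [C.pairing_symm x v, G.pairing_young hε hα hβ hγ, G.pairing_young hε hα hβ hγ]
    ring
  comm u v := by
    have h : ∀ {α : E x}, G.endo x α = ε • α → G.form x (G.endo x v) α = ε * G.form x v α :=
      fun {α} hα => by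
        rw [G.form_apply, G.endo_endo, C.pairing_symm, G.pairing_eq_form hε hα]
    rw [G.young_apply, G.young_apply, h hα, h hβ, h hγ]
    simp only [map_sub, map_smul, hα, hβ, hγ]
    module
  cyclic u v w := by
    rw [G.pairing_young hε hα hβ hγ, G.pairing_young hε hα hβ hγ, G.pairing_young hε hα hβ hγ]
    ring

/-- As `K` has vanishing cyclic sum, only the part `3A` counts, and skewness of `K` doubles it. The
sign `ε` relates the pairing to `𝒢` on the eigenspace. -/
theorem GenMetric.InProlongation.inner₃_young (hε : ε * ε = 1) {x : M}
    {K : E x →ₗ[ℝ] E x →ₗ[ℝ] E x} (hK : G.InProlongation x K) {α β γ : E x}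
    (hα : G.endo x α = ε • α) (hβ : G.endo x β = ε • β) (hγ : G.endo x γ = ε • γ) :
    G.inner₃ x K (G.young x α β γ) = 6 * ε * C.pairing x (K α β) γ := by
  obtain ⟨n, b, b', hb, -, hin⟩ := G.exists_inner₃_eq x
  rw [hin]
  have e := fun u v w => sum_sum_sum_contract hb (C.triForm x K) u v w
  simp only [triForm_apply] at e
  have s : ∀ i j k, C.pairing x (K (b i) (b j)) (b k) *
        C.pairing x (G.young x α β γ (b' i) (b' j)) (b' k) = ε * (
        2 * (C.pairing x (K (b i) (b j)) (b k) *
          (G.form x (b' i) α * (G.form x (b' j) β * G.form x (b' k) γ))) -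
        2 * (C.pairing x (K (b i) (b j)) (b k) *
          (G.form x (b' i) α * (G.form x (b' j) γ * G.form x (b' k) β))) -
        C.pairing x (K (b i) (b j)) (b k) *
          (G.form x (b' i) γ * (G.form x (b' j) α * G.form x (b' k) β)) +
        C.pairing x (K (b i) (b j)) (b k) *
          (G.form x (b' i) β * (G.form x (b' j) α * G.form x (b' k) γ)) -
        C.pairing x (K (b i) (b j)) (b k) *
          (G.form x (b' i) β * (G.form x (b' j) γ * G.form x (b' k) α)) +
        C.pairing x (K (b i) (b j)) (b k) *
          (G.form x (b' i) γ * (G.form x (b' j) β * G.form x (b' k) α))) := fun i j k => by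
    rw [G.pairing_young hε hα hβ hγ]; ring
  simp only [s, ← Finset.mul_sum, Finset.sum_add_distrib, Finset.sum_sub_distrib, e]
  have s1 := hK.skew α β γ
  have s2 := hK.skew β γ α
  have s3 := hK.skew γ α β
  have c := hK.cyclic α β γ
  rw [C.pairing_symm] at s1 s2 s3
  rw [C.pairing_symm] at s1 s2 s3
  rw [C.pairing_symm x β] at s1
  rw [C.pairing_symm x γ] at s2
  rw [C.pairing_symm x α] at s3
  linear_combination ε * (-2 * s1 + s2 + s3 - 2 * c)

include hC in
/-- `𝒢` is nondegenerate on the kernel of the trace. -/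
theorem GenMetric.InProlongation.eq_zero (hd : 2 ≤ d) {x : M} {K : E x →ₗ[ℝ] E x →ₗ[ℝ] E x}
    (hK : G.InProlongation x K) (htr : ∀ v, LinearMap.trace ℝ (E x) (K.flip v) = 0)
    (horth : ∀ T, G.InProlongation x T → (∀ v, LinearMap.trace ℝ (E x) (T.flip v) = 0) →
      G.inner₃ x K T = 0) : K = 0 := by
  have hd' : (1 - d : ℝ) ≠ 0 := by
    have : (2 : ℝ) ≤ d := by exact_mod_cast hd
    linarith
  have hsub : ∀ S T, G.inner₃ x K (S - T) = G.inner₃ x K S - G.inner₃ x K T := fun S T => by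
    obtain ⟨n, b, b', -, -, hin⟩ := G.exists_inner₃_eq x
    rw [hin, hin, hin]
    simp only [LinearMap.sub_apply, map_sub, mul_sub, Finset.sum_sub_distrib]
  -- Subtracting the `weyl` element with the same trace makes `T` trace-free, and `K` is orthogonal
  -- to both parts.
  have key : ∀ T, G.InProlongation x T → G.inner₃ x K T = 0 := fun T hT => by
    obtain ⟨e, he⟩ := C.exists_pairing_eq x ((1 - d : ℝ)⁻¹ • (LinearMap.trace ℝ (E x) ∘ₗ T.flip))
    have h1 := horth (T - G.weyl x e) (hT.sub (G.weyl_mem x e)) fun v => by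
      have : (T - G.weyl x e).flip v = T.flip v - (G.weyl x e).flip v := by ext u; simp
      rw [this, map_sub, G.trace_weyl hC, he]
      simp [mul_inv_cancel_left₀ hd']
    rw [hsub, hK.inner₃_weyl htr, sub_zero] at h1
    exact h1
  have pure : ∀ ε : ℝ, ε * ε = 1 → ∀ α β γ, C.pairing x (K (G.proj ε x α) (G.proj ε x β))
      (G.proj ε x γ) = 0 := fun ε hε α β γ => by
    have h1 := hK.inner₃_young hε (G.endo_proj hε x α) (G.endo_proj hε x β) (G.endo_proj hε x γ)
    rw [key _ (G.young_mem hε (G.endo_proj hε x α) (G.endo_proj hε x β) (G.endo_proj hε x γ))] at h1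
    have h2 : ε ≠ 0 := fun h0 => by simp [h0] at hε
    have h3 : (6 * ε : ℝ) ≠ 0 := mul_ne_zero (by norm_num) h2
    exact (mul_eq_zero.1 h1.symm).resolve_left h3
  -- The remaining components have `v, w` in one eigenspace and `u` in the other; two terms of the
  -- cyclic identity then vanish by orthogonality and leave the third.
  have h1 : ∀ ε : ℝ, ε * ε = 1 → ∀ u v, K u (G.proj ε x v) = 0 := fun ε hε u v => by
    have hv := G.endo_proj hε x v
    have hε2 : -ε * -ε = 1 := by rwa [neg_mul_neg]
    refine C.pairing_nondeg x _ fun w => ?_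
    rw [← G.proj_add_proj ε x w, map_add, G.pairing_eq_zero hε (hK.endo hv u)
      (G.endo_proj hε2 x w), add_zero, ← G.proj_add_proj ε x u, map_add, LinearMap.add_apply,
      map_add, LinearMap.add_apply, pure ε hε, zero_add]
    have hu := G.endo_proj hε2 x u
    have hw := G.endo_proj hε x w
    have c := hK.cyclic (G.proj (-ε) x u) (G.proj ε x v) (G.proj ε x w)
    rw [G.pairing_eq_zero hε (hK.endo hw _) hu, C.pairing_symm x _ (G.proj ε x v),
      G.pairing_eq_zero hε hv (hK.endo hu _)] at c
    linarith
  ext u v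
  rw [← G.proj_add_proj 1 x v, map_add, h1 1 (by norm_num), h1 (-1) (by norm_num)]
  simp

end CourantAlgebroid

end Prolongation

end GenGeom
end

open Bundle Manifold
open scoped ContDiff
noncomputable section
set_option linter.unusedSectionVars false
namespace GenGeom

theorem contraction_symm {V : Type*} [AddCommGroup V] [Module ℝ V] {ι : Type*} [Fintype ι]
    [DecidableEq ι] (b : Module.Basis ι ℝ V) {B : LinearMap.BilinForm ℝ V}
    (hs : ∀ u v, B u v = B v u) (n : ℕ) (S T : (Fin n → V) → ℝ) :
    contraction b B n S T = contraction b B n T S := by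
  have h : ∀ i j, (Matrix.of fun i j => B (b i) (b j))⁻¹ i j =
      (Matrix.of fun i j => B (b i) (b j))⁻¹ j i := fun i j => by
    have : (Matrix.of fun i j => B (b i) (b j)).transpose = Matrix.of fun i j => B (b i) (b j) := by
      ext i j; exact hs _ _
    conv_lhs => rw [← this, ← Matrix.transpose_nonsing_inv, Matrix.transpose_apply]
  unfold contraction
  rw [Finset.sum_comm]
  refine Finset.sum_congr rfl fun I _ => Finset.sum_congr rfl fun J _ => ?_
  simp only [h (J _)]
  ring

/-! ### The canonical connection of a generalised metric and a divergence operator -/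

section Canonical

variable {d : ℕ} {M : Type*} [TopologicalSpace M] [ChartedSpace (EuclideanSpace ℝ (Fin d)) M]
  [IsManifold (𝓡 d) ∞ M] [T2Space M] [SigmaCompactSpace M]
  {F : Type*} [NormedAddCommGroup F] [NormedSpace ℝ F] [FiniteDimensional ℝ F]
  {E : M → Type*} [∀ x, AddCommGroup (E x)] [∀ x, Module ℝ (E x)]
  [∀ x, TopologicalSpace (E x)] [TopologicalSpace (TotalSpace F E)]
  [FiberBundle F E] [VectorBundle ℝ F E] [ContMDiffVectorBundle ∞ F E (𝓡 d)]

namespace CourantAlgebroid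

variable {C : CourantAlgebroid d F E}

theorem GenConnection.toFun_fsmul (D : C.GenConnection) (f : Fun d M) (b : Sec d F E) (x : M) :
    D.toFun (fsmul f b) x =
      (((mvfderiv (𝓡 d) f x : TM d x →L[ℝ] ℝ) : TM d x →ₗ[ℝ] ℝ) ∘ₗ C.anchor x).smulRight (b x) +
        f x • D.toFun b x := by
  ext u
  exact D.leibniz' f b x u

theorem GenConnection.trace_fsmul (D : C.GenConnection) (f : Fun d M) (b : Sec d F E) (x : M) :
    LinearMap.trace ℝ (E x) (D.toFun (fsmul f b) x) =
      mvfderiv (𝓡 d) f x (C.anchor x (b x)) + f x * LinearMap.trace ℝ (E x) (D.toFun b x) := by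
  have : FiniteDimensional ℝ (E x) := VectorBundle.finiteDimensional ℝ F E x
  rw [D.toFun_fsmul, map_add, map_smul, smul_eq_mul, LinearMap.trace_smulRight]
  rfl

/-- The difference `D - D₀` of two generalised connections, as the tensor `u ↦ (D - D₀)_u`. -/
def GenConnection.diffAt (D D₀ : C.GenConnection) (x : M) : E x →ₗ[ℝ] E x →ₗ[ℝ] E x :=
  (tensorialLin (fun b : Sec d F E => D.toFun b x - D₀.toFun b x) x
    (fun s t => by rw [D.add', D₀.add']; abel)
    (fun f s => by
      rw [D.toFun_fsmul, D₀.toFun_fsmul, add_sub_add_left_eq_sub, smul_sub])).flip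

theorem GenConnection.diffAt_flip (D D₀ : C.GenConnection) (b : Sec d F E) (x : M) :
    (D.diffAt D₀ x).flip (b x) = D.toFun b x - D₀.toFun b x := by
  rw [GenConnection.diffAt, LinearMap.flip_flip, tensorialLin_apply]

theorem GenConnection.diffAt_apply (D D₀ : C.GenConnection) (b : Sec d F E) (x : M) (u : E x) :
    D.diffAt D₀ x u (b x) = D.toFun b x u - D₀.toFun b x u := by
  rw [← LinearMap.sub_apply, ← D.diffAt_flip D₀]; rfl

variable {G : C.GenMetric} (hC : C.IsExact)

/-- The inhomogeneous terms, namely derivatives and brackets, agree for both connections and drop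
out of the difference. -/
theorem GenConnection.IsLeviCivita.diffAt_mem {D D₀ : C.GenConnection} (hD : D.IsLeviCivita G)
    (hD₀ : D₀.IsLeviCivita G) (x : M) : G.InProlongation x (D.diffAt D₀ x) where
  skew u v w := by
    obtain ⟨b, rfl⟩ := exists_section (d := d) (F := F) x v
    obtain ⟨c, rfl⟩ := exists_section (d := d) (F := F) x w
    have h1 := D.pairing' b c x u
    have h2 := D₀.pairing' b c x u
    rw [D.diffAt_apply, D.diffAt_apply]
    simp only [map_sub, LinearMap.sub_apply]
    linarith
  comm u v := by
    obtain ⟨b, rfl⟩ := exists_section (d := d) (F := F) x v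
    have h := D.diffAt_apply D₀ (G.endoSec b) x u
    rw [hD.toFun_endoSec, hD₀.toFun_endoSec] at h
    rw [D.diffAt_apply, map_sub]
    exact h
  cyclic u v w := by
    obtain ⟨a, rfl⟩ := exists_section (d := d) (F := F) x u
    obtain ⟨b, rfl⟩ := exists_section (d := d) (F := F) x v
    obtain ⟨c, rfl⟩ := exists_section (d := d) (F := F) x w
    have h1 := hD.torsion a b c x
    have h2 := hD₀.torsion a b c x
    have h3 := D.pairing' a c x (b x)
    have h4 := D₀.pairing' a c x (b x)
    rw [D.diffAt_apply, D.diffAt_apply, D.diffAt_apply]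
    simp only [map_sub, LinearMap.sub_apply] at h1 h2 ⊢
    rw [C.pairing_symm x _ (a x), C.pairing_symm x _ (a x)]
    linarith

theorem GenMetric.inner₃_symm (G : C.GenMetric) (x : M) (S T : E x →ₗ[ℝ] E x →ₗ[ℝ] E x) :
    G.inner₃ x S T = G.inner₃ x T S := by
  unfold GenMetric.inner₃ tensorInner
  exact contraction_symm _ (G.form_symm x) 3 _ _

theorem GenMetric.inner₃_sub_left (G : C.GenMetric) (x : M) (S S' T : E x →ₗ[ℝ] E x →ₗ[ℝ] E x) :
    G.inner₃ x (S - S') T = G.inner₃ x S T - G.inner₃ x S' T := by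
  obtain ⟨n, b, b', -, -, hin⟩ := G.exists_inner₃_eq x
  rw [hin, hin, hin]
  simp only [LinearMap.sub_apply, map_sub, sub_mul, Finset.sum_sub_distrib]

/-! ### Prescribing the divergence -/

/-- The connection `D + T^e`. -/
def GenConnection.addWeyl (D : C.GenConnection) (G : C.GenMetric) (e : Sec d F E) :
    C.GenConnection where
  toFun b x := D.toFun b x + (G.weyl x (e x)).flip (b x)
  smooth' a b := (D.deriv a b + (1 / 2 : ℝ) • (fsmul (C.pair a b) e +
    fsmul (C.pair (G.endoSec a) b) (G.endoSec e) - fsmul (C.pair e b) a -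
    fsmul (C.pair (G.endoSec e) b) (G.endoSec a))).contMDiff
  add' b c x := by
    rw [D.add', Sec.add_apply, map_add]; abel
  leibniz' f b x u := by
    rw [fsmul_apply, map_smul, LinearMap.add_apply, D.leibniz', LinearMap.add_apply, smul_add,
      add_assoc]
    rfl
  pairing' b c x u := by
    have h := (G.weyl_mem x (e x)).skew u (b x) (c x)
    simp only [LinearMap.add_apply, map_add, LinearMap.flip_apply]
    rw [D.pairing']
    linarith

theorem GenConnection.addWeyl_apply (D : C.GenConnection) (G : C.GenMetric) (e b : Sec d F E)
    (x : M) (u : E x) : (D.addWeyl G e).toFun b x u = D.toFun b x u + G.weyl x (e x) u (b x) := rfl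

theorem GenConnection.IsLeviCivita.addWeyl {D : C.GenConnection} (hD : D.IsLeviCivita G)
    (e : Sec d F E) : (D.addWeyl G e).IsLeviCivita G where
  metric b c x u := by
    have h := (G.weyl_mem x (e x)).skew u (G.endo x (b x)) (c x)
    rw [(G.weyl_mem x (e x)).comm] at h
    have h1 := hD.metric b c x u
    rw [D.addWeyl_apply, D.addWeyl_apply, map_add, map_add, LinearMap.add_apply, h1]
    simp only [G.form_apply]
    linarith
  torsion a b c x := by
    have h := (G.weyl_mem x (e x)).skew (b x) (a x) (c x)
    have h1 := hD.torsion a b c x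
    have h2 := (G.weyl_mem x (e x)).cyclic (a x) (b x) (c x)
    rw [C.pairing_symm x (a x)] at h
    rw [D.addWeyl_apply, D.addWeyl_apply, D.addWeyl_apply]
    simp only [map_sub, map_add, LinearMap.sub_apply, LinearMap.add_apply] at h1 ⊢
    linarith

theorem GenConnection.diffAt_addWeyl (D : C.GenConnection) (e : Sec d F E) (x : M) :
    (D.addWeyl G e).diffAt D x = G.weyl x (e x) := by
  ext u v
  obtain ⟨b, rfl⟩ := exists_section (d := d) (F := F) x v
  rw [GenConnection.diffAt_apply, D.addWeyl_apply, add_sub_cancel_left]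

/-- The functional `a ↦ (div(a) - tr(D a)) / (1 - d)`. -/
def GenConnection.divForm (D : C.GenConnection) (dv : C.Divergence) (x : M) : E x →ₗ[ℝ] ℝ :=
  (1 - d : ℝ)⁻¹ • tensorialLin
    (fun a : Sec d F E => dv.toFun a x - LinearMap.trace ℝ (E x) (D.toFun a x)) x
    (fun s t => by
      rw [map_add, D.add', map_add]
      change dv.toFun s x + dv.toFun t x - _ = _
      ring)
    (fun f s => by
      rw [dv.leibniz, D.trace_fsmul, smul_eq_mul]; ring)

theorem GenConnection.divForm_apply (D : C.GenConnection) (dv : C.Divergence) (a : Sec d F E)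
    (x : M) : D.divForm dv x (a x) =
      (1 - d : ℝ)⁻¹ * (dv.toFun a x - LinearMap.trace ℝ (E x) (D.toFun a x)) :=
  congrArg ((1 - d : ℝ)⁻¹ * ·) (tensorialLin_apply
    (fun a : Sec d F E => dv.toFun a x - LinearMap.trace ℝ (E x) (D.toFun a x)) x _ _ a)

theorem GenConnection.exists_divVec (D : C.GenConnection) (dv : C.Divergence) :
    ∃ e : Sec d F E, ∀ (a : Sec d F E) (x : M), C.pairing x (e x) (a x) =
      (1 - d : ℝ)⁻¹ * (dv.toFun a x - LinearMap.trace ℝ (E x) (D.toFun a x)) := by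
  choose e he using fun x => C.exists_pairing_eq x (D.divForm dv x)
  refine ⟨⟨e, fun x₀ => ?_⟩, fun a x => by rw [← D.divForm_apply, ← he]; rfl⟩
  have : FiniteDimensional ℝ (E x₀) := VectorBundle.finiteDimensional ℝ F E x₀
  let b := Module.finBasis ℝ (E x₀)
  let s : Fin (Module.finrank ℝ (E x₀)) → Sec d F E := fun j => GenGeom.ext (b j)
  -- Smoothness is tested against sections that form a basis at `x₀`; there the values are known
  -- from the divergence and the trace.
  refine contMDiffAt_of_functionals (d := d) (fun j x => C.pairing x (s j x)) x₀
    (fun j t => (C.pairing_smooth (s j) t).contMDiffAt) (fun u hu => ?_) e fun j => ?_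
  · refine C.pairing_nondeg x₀ u fun v => ?_
    have h0 : C.pairing x₀ u = 0 := b.ext fun j => by
      have := hu j
      rw [ext_apply, C.pairing_symm] at this
      simpa using this
    rw [h0]; rfl
  · have h : (fun x => C.pairing x (s j x) (e x)) = fun x =>
        (1 - d : ℝ)⁻¹ * (dv.toFun (s j) x - LinearMap.trace ℝ (E x) (D.toFun (s j) x)) := by
      funext x
      rw [C.pairing_symm, he, D.divForm_apply]
    rw [h]
    exact contMDiffAt_const.mul ((dv.toFun (s j)).contMDiff.contMDiffAt.sub
      (contMDiff_trace _ fun t => D.smooth' t (s j)).contMDiffAt)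

/-- The section `e` with `(1 - d) ⟨e, a⟩ = div(a) - tr(D a)`. -/
def GenConnection.divVec (D : C.GenConnection) (dv : C.Divergence) : Sec d F E :=
  Classical.choose (D.exists_divVec dv)

theorem GenConnection.pairing_divVec (D : C.GenConnection) (dv : C.Divergence) (a : Sec d F E)
    (x : M) : C.pairing x (D.divVec dv x) (a x) =
      (1 - d : ℝ)⁻¹ * (dv.toFun a x - LinearMap.trace ℝ (E x) (D.toFun a x)) :=
  Classical.choose_spec (D.exists_divVec dv) a x

variable (G)

/-- The canonical connection `D^{𝒢,div}`. -/
def GenMetric.canonConn (dv : C.Divergence) : C.GenConnection :=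
  (G.zeroConn hC).addWeyl G ((G.zeroConn hC).divVec dv)

variable {G} (hd : 2 ≤ d)

include hd in
theorem GenMetric.trace_weyl_divVec (dv : C.Divergence) (a : Sec d F E) (x : M) :
    LinearMap.trace ℝ (E x) ((G.weyl x ((G.zeroConn hC).divVec dv x)).flip (a x)) =
      dv.toFun a x - LinearMap.trace ℝ (E x) ((G.zeroConn hC).toFun a x) := by
  have hd' : (1 - d : ℝ) ≠ 0 := by
    have : (2 : ℝ) ≤ d := by exact_mod_cast hd
    linarith
  rw [G.trace_weyl hC, GenConnection.pairing_divVec, mul_inv_cancel_left₀ hd']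

include hd in
-- The correction `D - D⁰` is a `weyl` element. Its vector was chosen to correct the trace, and its
-- orthogonality to the trace kernel is `inner₃_weyl`.
theorem GenMetric.canonConn_isCanonical (dv : C.Divergence) :
    (G.canonConn hC dv).IsCanonical G dv where
  leviCivita := (G.zeroConn_isLeviCivita hC).addWeyl _
  divergence a x := by
    have h := GenMetric.trace_weyl_divVec (G := G) hC hd dv a x
    change LinearMap.trace ℝ (E x) ((G.zeroConn hC).toFun a x +
      (G.weyl x ((G.zeroConn hC).divVec dv x)).flip (a x)) = _
    rw [map_add, h]
    ring
  orthogonal := by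
    refine ⟨G.zeroConn hC, G.zeroConn_isCanonicalZero hC, fun x T hT htr => ?_⟩
    change G.inner₃ x ((G.canonConn hC dv).diffAt (G.zeroConn hC) x) T = 0
    rw [GenMetric.canonConn, GenConnection.diffAt_addWeyl, G.inner₃_symm]
    exact hT.inner₃_weyl htr _

include hd in
-- The difference of `D - D⁰` and the `weyl` correction is trace-free and orthogonal to the trace
-- kernel, so `InProlongation.eq_zero` applies.
theorem GenConnection.IsCanonical.eq_canonConn {dv : C.Divergence} {D : C.GenConnection}
    (hD : D.IsCanonical G dv) : D = G.canonConn hC dv := by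
  obtain ⟨D₀, hD₀, horth⟩ := hD.orthogonal
  obtain rfl := hD₀.eq_zeroConn hC
  refine GenConnection.ext' fun a b x => ?_
  have hmem := (hD.leviCivita.diffAt_mem hD₀.leviCivita x).sub
    (G.weyl_mem x ((G.zeroConn hC).divVec dv x))
  have h0 := hmem.eq_zero hC hd (fun v => by
    obtain ⟨c, rfl⟩ := exists_section (d := d) (F := F) x v
    have h1 : (D.diffAt (G.zeroConn hC) x - G.weyl x ((G.zeroConn hC).divVec dv x)).flip (c x) =
      (D.diffAt (G.zeroConn hC) x).flip (c x) -
        (G.weyl x ((G.zeroConn hC).divVec dv x)).flip (c x) := by ext u; rfl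
    rw [h1, map_sub, GenMetric.trace_weyl_divVec hC hd, D.diffAt_flip, map_sub, hD.divergence,
      sub_self]) fun T hT htr => by
    rw [G.inner₃_sub_left, G.inner₃_symm x (G.weyl x _), hT.inner₃_weyl htr, sub_zero]
    exact horth x T hT htr
  have h1 := congrArg (fun L : E x →ₗ[ℝ] E x →ₗ[ℝ] E x => L (a x) (b x)) (sub_eq_zero.1 h0)
  simp only [D.diffAt_apply] at h1
  rw [GenMetric.canonConn, GenConnection.addWeyl_apply, ← h1]
  abel

include hd hC in
theorem exists_unique_isCanonical (G : C.GenMetric) (dv : C.Divergence) :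
    ∃! D : C.GenConnection, D.IsCanonical G dv :=
  ⟨G.canonConn hC dv, G.canonConn_isCanonical hC hd dv, fun _ hD => hD.eq_canonConn hC hd⟩

end CourantAlgebroid

end Canonical

end GenGeom
end

open Bundle Manifold
open scoped ContDiff
noncomputable section
set_option linter.unusedSectionVars false
namespace GenGeom

/-! ### Tensoriality of the generalised Riemann tensor -/

section RiemannTensor

variable {d : ℕ} {M : Type*} [TopologicalSpace M] [ChartedSpace (EuclideanSpace ℝ (Fin d)) M]
  [IsManifold (𝓡 d) ∞ M] [T2Space M] [SigmaCompactSpace M]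
  {F : Type*} [NormedAddCommGroup F] [NormedSpace ℝ F] [FiniteDimensional ℝ F]
  {E : M → Type*} [∀ x, AddCommGroup (E x)] [∀ x, Module ℝ (E x)]
  [∀ x, TopologicalSpace (E x)] [TopologicalSpace (TotalSpace F E)]
  [FiberBundle F E] [VectorBundle ℝ F E] [ContMDiffVectorBundle ∞ F E (𝓡 d)]

namespace CourantAlgebroid

variable {C : CourantAlgebroid d F E}

variable (C) in
/-- The scalar product of linear forms on `E_x` induced by `⟨·,·⟩`. -/
def dualInner (x : M) (S T : E x →ₗ[ℝ] ℝ) : ℝ :=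
  haveI : FiniteDimensional ℝ (E x) := VectorBundle.finiteDimensional ℝ F E x
  tensorInner (C.pairing x) 1 (fun u => S (u 0)) (fun u => T (u 0))

variable (C) in
theorem exists_dualInner_eq (x : M) : ∃ (n : ℕ) (b b' : Fin n → E x),
    (∀ v, ∑ i, C.pairing x (b i) v • b' i = v) ∧
    ∀ S T : E x →ₗ[ℝ] ℝ, C.dualInner x S T = ∑ i, S (b i) * T (b' i) := by
  have : FiniteDimensional ℝ (E x) := VectorBundle.finiteDimensional ℝ F E x
  let b := Module.finBasis ℝ (E x)
  exact ⟨_, b, dualVec b (C.pairing x),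
    sum_smul_dualVec b (C.pairing_symm x) (C.pairing_nondeg x), fun S T => contraction_one b S T⟩

theorem dualInner_symm (x : M) (S T : E x →ₗ[ℝ] ℝ) : C.dualInner x S T = C.dualInner x T S := by
  unfold dualInner tensorInner
  exact contraction_symm _ (C.pairing_symm x) 1 _ _

theorem dualInner_add_left (x : M) (S S' T : E x →ₗ[ℝ] ℝ) :
    C.dualInner x (S + S') T = C.dualInner x S T + C.dualInner x S' T := by
  obtain ⟨n, b, b', -, h⟩ := C.exists_dualInner_eq x
  simp only [h, LinearMap.add_apply, add_mul, Finset.sum_add_distrib]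

theorem dualInner_smul_left (x : M) (r : ℝ) (S T : E x →ₗ[ℝ] ℝ) :
    C.dualInner x (r • S) T = r * C.dualInner x S T := by
  obtain ⟨n, b, b', -, h⟩ := C.exists_dualInner_eq x
  simp only [h, LinearMap.smul_apply, smul_eq_mul, Finset.mul_sum, mul_assoc]

theorem dualInner_pairing_left (x : M) (s : E x) (T : E x →ₗ[ℝ] ℝ) :
    C.dualInner x (C.pairing x s) T = T s := by
  obtain ⟨n, b, b', hb, h⟩ := C.exists_dualInner_eq x
  conv_rhs => rw [← hb s]
  simp only [h, map_sum, map_smul, smul_eq_mul, C.pairing_symm x s]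

/-- The commutator of the derivatives along `πa`, `πb` is the derivative along `π[a, b]`. -/
theorem commutator_smul (f f₁ f₂ : Fun d M) (a b c : Sec d F E)
    (h₁ : ∀ x, f₁ x = mvfderiv (𝓡 d) f x (C.anchor x (a x)))
    (h₂ : ∀ x, f₂ x = mvfderiv (𝓡 d) f x (C.anchor x (b x))) (x : M) :
    (mvfderiv (𝓡 d) f₂ x (C.anchor x (a x)) - mvfderiv (𝓡 d) f₁ x (C.anchor x (b x)) -
      mvfderiv (𝓡 d) f x (C.anchor x (C.bracket a b x))) • c x = 0 := by
  have e₁ : C.bracket a (fsmul f c) = fsmul f₁ c + fsmul f (C.bracket a c) := by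
    ext y; rw [C.bracket_fsmul, ← h₁]; rfl
  have e₂ : C.bracket b (fsmul f c) = fsmul f₂ c + fsmul f (C.bracket b c) := by
    ext y; rw [C.bracket_fsmul, ← h₂]; rfl
  -- Comparing the Jacobi identity for `f c` with `f` times the one for `c` leaves exactly the
  -- commutator of derivatives times `c`. No second derivatives in charts are needed.
  have h := congrArg (fun s : Sec d F E => s x) (C.jacobi a b (fsmul f c))
  have h' := congrArg (fun s : Sec d F E => s x) (C.jacobi a b c)
  simp only [e₁, e₂, map_add, Sec.add_apply, C.bracket_fsmul] at h h'
  rw [h', ← h₁, ← h₂] at h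
  rw [← sub_eq_zero] at h
  rw [← h]
  module

/-! ### Multiplication by functions in the curvature and in the generalised Riemann tensor -/

namespace GenConnection

variable (D : C.GenConnection)

theorem deriv_apply (a b : Sec d F E) (x : M) : D.deriv a b x = D.toFun b x (a x) := rfl

theorem deriv_add_left (a a' b : Sec d F E) : D.deriv (a + a') b = D.deriv a b + D.deriv a' b := by
  ext x; simp [deriv_apply]

theorem deriv_add_right (a b b' : Sec d F E) : D.deriv a (b + b') = D.deriv a b + D.deriv a b' := by
  ext x; simp [deriv_apply, D.add']

theorem deriv_fsmul_left (f : Fun d M) (a b : Sec d F E) :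
    D.deriv (fsmul f a) b = fsmul f (D.deriv a b) := by
  ext x; simp [deriv_apply]

/-- The curvature `([D_v, D_w] - D_{[v,w]}) b`. -/
def curv (v w b : Sec d F E) (x : M) : E x :=
  D.toFun (D.deriv w b) x (v x) - D.toFun (D.deriv v b) x (w x) - D.toFun b x (C.bracket v w x)

theorem rm_eq (a b v w : Sec d F E) (x : M) : D.rm a b v w x =
    1 / 2 * (C.pairing x (a x) (D.curv v w b x) + C.pairing x (w x) (D.curv b a v x) +
      C.dualInner x ((C.pairing x).flip (w x) ∘ₗ D.toFun v x)
        ((C.pairing x).flip (a x) ∘ₗ D.toFun b x)) := rfl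

/-- The two curvature terms are exchanged and the trace term is symmetric. This halves the work:
slots one and two follow from slots four and three. -/
theorem rm_symm (a b v w : Sec d F E) (x : M) : D.rm a b v w x = D.rm w v b a x := by
  rw [rm_eq, rm_eq, dualInner_symm]; ring

theorem curv_add₁ (v v' w b : Sec d F E) (x : M) :
    D.curv (v + v') w b x = D.curv v w b x + D.curv v' w b x := by
  simp only [curv, deriv_add_left, D.add', map_add, Sec.add_apply,
    LinearMap.add_apply]
  abel

theorem curv_add₂ (v w w' b : Sec d F E) (x : M) :
    D.curv v (w + w') b x = D.curv v w b x + D.curv v w' b x := by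
  simp only [curv, deriv_add_left, D.add', map_add, Sec.add_apply,
    LinearMap.add_apply]
  abel

theorem curv_add₃ (v w b b' : Sec d F E) (x : M) :
    D.curv v w (b + b') x = D.curv v w b x + D.curv v w b' x := by
  simp only [curv, deriv_add_right, D.add', LinearMap.add_apply]
  abel

theorem curv_fsmul₂ (f : Fun d M) (v w b : Sec d F E) (x : M) :
    D.curv v (fsmul f w) b x = f x • D.curv v w b x := by
  simp only [curv, deriv_fsmul_left, D.leibniz', C.bracket_fsmul, fsmul_apply, map_add, map_smul,
    deriv_apply]
  module

/-- Here `g` is the gradient of `f` for the pairing. The defect comes from the term `⟨v, w⟩ g` in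
`[f v, w]`. -/
theorem curv_fsmul₁ (f : Fun d M) (v w b : Sec d F E) (x : M) {g : E x}
    (hg : ∀ u, C.pairing x g u = mvfderiv (𝓡 d) f x (C.anchor x u)) :
    D.curv (fsmul f v) w b x =
      f x • D.curv v w b x - C.pairing x (v x) (w x) • D.toFun b x g := by
  have h : C.bracket (fsmul f v) w x = f x • C.bracket v w x -
      mvfderiv (𝓡 d) f x (C.anchor x (w x)) • v x + C.pairing x (v x) (w x) • g := by
    refine pairing_ext_sec (d := d) (F := F) (C := C) x fun c => ?_
    rw [C.pairing_fsmul_bracket]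
    simp only [map_add, map_sub, map_smul, LinearMap.add_apply, LinearMap.sub_apply,
      LinearMap.smul_apply, smul_eq_mul, hg]
    ring
  simp only [curv, deriv_fsmul_left, D.leibniz', h, fsmul_apply, map_add, map_sub, map_smul,
    deriv_apply]
  module

include D in
-- By the Leibniz rule for the divergence, `π(a) f = tr(D(f a)) - f tr(D a)`, and traces are smooth.
theorem contMDiff_derivFun (f : Fun d M) (a : Sec d F E) : ContMDiff (𝓡 d) 𝓘(ℝ, ℝ) ∞
    (fun x => mvfderiv (𝓡 d) f x (C.anchor x (a x))) := by
  have h : (fun x => mvfderiv (𝓡 d) f x (C.anchor x (a x))) = fun x =>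
      LinearMap.trace ℝ (E x) (D.toFun (fsmul f a) x) -
        f x * LinearMap.trace ℝ (E x) (D.toFun a x) := by
    funext x
    rw [D.trace_fsmul]; ring
  rw [h]
  exact (contMDiff_trace _ fun t => D.smooth' t _).sub
    (f.contMDiff.mul (contMDiff_trace _ fun t => D.smooth' t _))

theorem curv_fsmul₃ (f : Fun d M) (v w b : Sec d F E) (x : M) :
    D.curv v w (fsmul f b) x = f x • D.curv v w b x := by
  let f₁ : Fun d M := ⟨_, D.contMDiff_derivFun f v⟩
  let f₂ : Fun d M := ⟨_, D.contMDiff_derivFun f w⟩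
  have e₁ : D.deriv v (fsmul f b) = fsmul f₁ b + fsmul f (D.deriv v b) := by
    ext y; rw [deriv_apply, D.leibniz']; rfl
  have e₂ : D.deriv w (fsmul f b) = fsmul f₂ b + fsmul f (D.deriv w b) := by
    ext y; rw [deriv_apply, D.leibniz']; rfl
  have h := commutator_smul f f₁ f₂ v w b (fun _ => rfl) (fun _ => rfl) x
  have h₁ : f₁ x = mvfderiv (𝓡 d) f x (C.anchor x (v x)) := rfl
  have h₂ : f₂ x = mvfderiv (𝓡 d) f x (C.anchor x (w x)) := rfl
  simp only [curv, e₁, e₂, D.add', LinearMap.add_apply, D.leibniz', deriv_apply, h₁, h₂]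
  rw [← sub_eq_zero, ← h]
  module

theorem rm_add_fourth (a b v w w' : Sec d F E) (x : M) :
    D.rm a b v (w + w') x = D.rm a b v w x + D.rm a b v w' x := by
  have e : (C.pairing x).flip ((w + w') x) ∘ₗ D.toFun v x =
      (C.pairing x).flip (w x) ∘ₗ D.toFun v x + (C.pairing x).flip (w' x) ∘ₗ D.toFun v x := by
    ext u; simp
  rw [rm_eq, rm_eq, rm_eq, e, dualInner_add_left, curv_add₂, Sec.add_apply]
  simp only [map_add, LinearMap.add_apply]
  ring

theorem rm_add_third (a b v v' w : Sec d F E) (x : M) :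
    D.rm a b (v + v') w x = D.rm a b v w x + D.rm a b v' w x := by
  have e : (C.pairing x).flip (w x) ∘ₗ D.toFun (v + v') x =
      (C.pairing x).flip (w x) ∘ₗ D.toFun v x + (C.pairing x).flip (w x) ∘ₗ D.toFun v' x := by
    rw [D.add']; ext u; simp
  rw [rm_eq, rm_eq, rm_eq, e, dualInner_add_left, curv_add₁, curv_add₃]
  simp only [map_add]
  ring

theorem rm_fsmul_fourth (f : Fun d M) (a b v w : Sec d F E) (x : M) :
    D.rm a b v (fsmul f w) x = f x • D.rm a b v w x := by
  have e : (C.pairing x).flip (fsmul f w x) ∘ₗ D.toFun v x =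
      f x • ((C.pairing x).flip (w x) ∘ₗ D.toFun v x) := by
    ext u; simp
  rw [rm_eq, rm_eq, e, dualInner_smul_left, curv_fsmul₂, fsmul_apply]
  simp only [map_smul, LinearMap.smul_apply, smul_eq_mul]
  ring

/-- The trace term contributes `⟨v, w⟩ ⟨D_g b, a⟩` with `g` the gradient of `f`, which cancels the
defect of `curv_fsmul₁`. This is what the trace term is for. -/
theorem rm_fsmul_third (f : Fun d M) (a b v w : Sec d F E) (x : M) :
    D.rm a b (fsmul f v) w x = f x • D.rm a b v w x := by
  obtain ⟨g, hg⟩ := C.exists_pairing_eq x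
    (((mvfderiv (𝓡 d) f x : TM d x →L[ℝ] ℝ) : TM d x →ₗ[ℝ] ℝ) ∘ₗ C.anchor x)
  have e : (C.pairing x).flip (w x) ∘ₗ D.toFun (fsmul f v) x =
      C.pairing x (v x) (w x) • C.pairing x g +
        f x • ((C.pairing x).flip (w x) ∘ₗ D.toFun v x) := by
    ext u
    simp [D.leibniz', hg, mul_comm]
  rw [rm_eq, rm_eq, e, dualInner_add_left, dualInner_smul_left, dualInner_smul_left,
    dualInner_pairing_left, D.curv_fsmul₁ f v w b x hg, curv_fsmul₃]
  have e' : ((C.pairing x).flip (a x) ∘ₗ D.toFun b x) g =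
    C.pairing x (a x) (D.toFun b x g) := C.pairing_symm x _ _
  rw [e']
  simp only [map_sub, map_smul, smul_eq_mul]
  ring

theorem rm_add_first (a a' b v w : Sec d F E) (x : M) :
    D.rm (a + a') b v w x = D.rm a b v w x + D.rm a' b v w x := by
  simp only [D.rm_symm _ b v w, rm_add_fourth]

theorem rm_add_second (a b b' v w : Sec d F E) (x : M) :
    D.rm a (b + b') v w x = D.rm a b v w x + D.rm a b' v w x := by
  simp only [D.rm_symm a _ v w, rm_add_third]

theorem rm_fsmul_first (f : Fun d M) (a b v w : Sec d F E) (x : M) :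
    D.rm (fsmul f a) b v w x = f x • D.rm a b v w x := by
  simp only [D.rm_symm _ b v w, rm_fsmul_fourth]

theorem rm_fsmul_second (f : Fun d M) (a b v w : Sec d F E) (x : M) :
    D.rm a (fsmul f b) v w x = f x • D.rm a b v w x := by
  simp only [D.rm_symm a _ v w, rm_fsmul_third]

/-- The generalised Riemann tensor only depends on the values of the sections. -/
theorem rm_congr {a a' b b' v v' w w' : Sec d F E} {x : M} (ha : a x = a' x) (hb : b x = b' x)
    (hv : v x = v' x) (hw : w x = w' x) : D.rm a b v w x = D.rm a' b' v' w' x :=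
  calc D.rm a b v w x = D.rm a' b v w x :=
        tensorial_congr (φ := fun a => D.rm a b v w x) (fun s t => D.rm_add_first s t b v w x)
          (fun f s => D.rm_fsmul_first f s b v w x) ha
    _ = D.rm a' b' v w x :=
        tensorial_congr (φ := fun b => D.rm a' b v w x) (fun s t => D.rm_add_second a' s t v w x)
          (fun f s => D.rm_fsmul_second f a' s v w x) hb
    _ = D.rm a' b' v' w x :=
        tensorial_congr (φ := fun v => D.rm a' b' v w x) (fun s t => D.rm_add_third a' b' s t w x)
          (fun f s => D.rm_fsmul_third f a' b' s w x) hv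
    _ = D.rm a' b' v' w' x :=
        tensorial_congr (φ := fun w => D.rm a' b' v' w x)
          (fun s t => D.rm_add_fourth a' b' v' s t x)
          (fun f s => D.rm_fsmul_fourth f a' b' v' s x) hw

theorem rm_eq_rmAt (a b v w : Sec d F E) (x : M) :
    D.rm a b v w x = D.rmAt x ![a x, b x, v x, w x] :=
  D.rm_congr (by simp [ext_apply]) (by simp [ext_apply]) (by simp [ext_apply])
    (by simp [ext_apply])

/-- The generalised Riemann tensor at a point, as a multilinear map. -/
def rmMulti (x : M) : MultilinearMap ℝ (fun _ : Fin 4 => E x) ℝ where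
  toFun := D.rmAt x
  map_update_add' := by
    intro inst u i v w
    obtain rfl : inst = instDecidableEqFin 4 := Subsingleton.elim _ _
    have h : ∀ v w : E x, (GenGeom.ext (v + w) : Sec d F E) x =
        (GenGeom.ext v + GenGeom.ext w : Sec d F E) x := by simp [ext_apply]
    fin_cases i
    · exact (D.rm_congr (h v w) rfl rfl rfl).trans (D.rm_add_first _ _ _ _ _ x)
    · exact (D.rm_congr rfl (h v w) rfl rfl).trans (D.rm_add_second _ _ _ _ _ x)
    · exact (D.rm_congr rfl rfl (h v w) rfl).trans (D.rm_add_third _ _ _ _ _ x)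
    · exact (D.rm_congr rfl rfl rfl (h v w)).trans (D.rm_add_fourth _ _ _ _ _ x)
  map_update_smul' := by
    intro inst u i r v
    obtain rfl : inst = instDecidableEqFin 4 := Subsingleton.elim _ _
    let f : Fun d M := ⟨fun _ => r, contMDiff_const⟩
    have h : ∀ v : E x, (GenGeom.ext (r • v) : Sec d F E) x =
        (fsmul f (GenGeom.ext v) : Sec d F E) x := fun v => by
      rw [fsmul_apply, ext_apply, ext_apply]; rfl
    fin_cases i
    · exact (D.rm_congr (h v) rfl rfl rfl).trans (D.rm_fsmul_first f _ _ _ _ x)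
    · exact (D.rm_congr rfl (h v) rfl rfl).trans (D.rm_fsmul_second f _ _ _ _ x)
    · exact (D.rm_congr rfl rfl (h v) rfl).trans (D.rm_fsmul_third f _ _ _ _ x)
    · exact (D.rm_congr rfl rfl rfl (h v)).trans (D.rm_fsmul_fourth f _ _ _ _ x)

theorem contraction_rmAt (G : C.GenMetric) (x : M) {ι : Type*} [Fintype ι] [DecidableEq ι]
    (b : Module.Basis ι ℝ (E x)) :
    contraction b (G.form x) 4 (D.rmAt x) (D.rmAt x) = D.kretschmann G x :=
  contraction_basis_indep b _ (G.form_symm x) (G.form_nondeg x) (D.rmMulti x) (D.rmMulti x)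

end GenConnection

end CourantAlgebroid

end RiemannTensor

end GenGeom
end

open Bundle Manifold
open scoped ContDiff
noncomputable section
set_option linter.unusedSectionVars false
namespace GenGeom

/-! ### Invariance under isomorphisms -/

section Naturality

variable {d : ℕ}
  {M : Type*} [TopologicalSpace M] [ChartedSpace (EuclideanSpace ℝ (Fin d)) M]
  [IsManifold (𝓡 d) ∞ M] [T2Space M] [SigmaCompactSpace M]
  {F : Type*} [NormedAddCommGroup F] [NormedSpace ℝ F] [FiniteDimensional ℝ F]
  {E : M → Type*} [∀ x, AddCommGroup (E x)] [∀ x, Module ℝ (E x)]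
  [∀ x, TopologicalSpace (E x)] [TopologicalSpace (TotalSpace F E)]
  [FiberBundle F E] [VectorBundle ℝ F E] [ContMDiffVectorBundle ∞ F E (𝓡 d)]
  {M' : Type*} [TopologicalSpace M'] [ChartedSpace (EuclideanSpace ℝ (Fin d)) M']
  [IsManifold (𝓡 d) ∞ M'] [T2Space M'] [SigmaCompactSpace M']
  {F' : Type*} [NormedAddCommGroup F'] [NormedSpace ℝ F'] [FiniteDimensional ℝ F']
  {E' : M' → Type*} [∀ x, AddCommGroup (E' x)] [∀ x, Module ℝ (E' x)]
  [∀ x, TopologicalSpace (E' x)] [TopologicalSpace (TotalSpace F' E')]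
  [FiberBundle F' E'] [VectorBundle ℝ F' E'] [ContMDiffVectorBundle ∞ F' E' (𝓡 d)]

namespace BundleIso

variable (Φ : BundleIso d F E F' E')

/-- Every section of `E` corresponds to a section of `E'`. -/
theorem exists_related (a : Sec d F E) : ∃ a' : Sec d F' E', Φ.Related a a' := by
  -- The fibre over `x'` is reached only through the equality of `x'` with the image of its
  -- preimage. In the total space the transport disappears, which gives smoothness as a composite.
  let s : ∀ x', E' x' := fun x' =>
    (Φ.base.apply_symm_apply x') ▸ Φ.fib (Φ.base.symm x') (a (Φ.base.symm x'))
  have h : ∀ (x' : M') (y : M) (h : Φ.base y = x'),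
      TotalSpace.mk' F' x' (h ▸ Φ.fib y (a y) : E' x') = Φ.total (TotalSpace.mk' F y (a y)) := by
    rintro x' y rfl
    exact (Φ.total_eq y (a y)).symm
  have h' : ∀ x', TotalSpace.mk' F' x' (s x') =
      Φ.total (TotalSpace.mk' F (Φ.base.symm x') (a (Φ.base.symm x'))) := fun x' => h _ _ _
  refine ⟨⟨s, ?_⟩, fun x => ?_⟩
  · have : (fun x' => TotalSpace.mk' F' x' (s x')) =
        Φ.total ∘ (fun y => TotalSpace.mk' F y (a y)) ∘ Φ.base.symm := funext h'
    rw [this]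
    exact Φ.total.contMDiff.comp (a.contMDiff.comp Φ.base.symm.contMDiff)
  · have h1 := h' (Φ.base x)
    rw [Φ.base.symm_apply_apply, Φ.total_eq] at h1
    exact TotalSpace.mk_injective _ h1

variable {Φ} {a b : Sec d F E} {a' b' : Sec d F' E'}

theorem Related.add (ha : Φ.Related a a') (hb : Φ.Related b b') : Φ.Related (a + b) (a' + b') :=
  fun x => by simp [ha x, hb x]

theorem Related.smul (r : ℝ) (ha : Φ.Related a a') : Φ.Related (r • a) (r • a') :=
  fun x => by simp [ha x]

namespace MapsPair

variable {C : CourantAlgebroid d F E} {C' : CourantAlgebroid d F' E'} {G : C.GenMetric}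
  {dv : C.Divergence} {G' : C'.GenMetric} {dv' : C'.Divergence}
  (hΦ : Φ.IsCourantIso C C') (h : Φ.MapsPair G dv G' dv') (hC : C.IsExact) (hC' : C'.IsExact)

include hΦ in
theorem _root_.GenGeom.BundleIso.IsCourantIso.eq_fib {x : M} {v : E x} {v' : E' (Φ.base x)}
    (hv : ∀ w, C'.pairing (Φ.base x) v' (Φ.fib x w) = C.pairing x v w) : v' = Φ.fib x v := by
  refine CourantAlgebroid.pairing_ext (C := C') _ fun w' => ?_
  obtain ⟨w, rfl⟩ := (Φ.fib x).surjective w'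
  rw [hv, hΦ.pairing]

include hΦ h

theorem endo (x : M) (u : E x) : G'.endo (Φ.base x) (Φ.fib x u) = Φ.fib x (G.endo x u) :=
  hΦ.eq_fib fun w => h.metric x u w

/-- The lift is characterised by its anchor and by `π ∘ 𝒢^end = 0` on it, both of which `Φ`
respects. -/
theorem refl (x : M) (u : E x) :
    G'.refl hC' (Φ.base x) (Φ.fib x u) = Φ.fib x (G.refl hC x u) := by
  have h1 : Φ.fib x (G.lift hC x (C.anchor x u)) =
      G'.lift hC' (Φ.base x) (C'.anchor (Φ.base x) (Φ.fib x u)) := by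
    have h2 := G'.eq_lift hC' (v := Φ.fib x (G.lift hC x (C.anchor x u))) (by
      rw [endo hΦ h, hΦ.anchor, G.anchor_endo_lift, map_zero])
    rw [h2, hΦ.anchor, hΦ.anchor, G.anchor_lift]
  rw [G'.refl_apply, ← h1, G.refl_apply, map_sub, map_smul]

theorem proj (ε : ℝ) (x : M) (u : E x) :
    G'.proj ε (Φ.base x) (Φ.fib x u) = Φ.fib x (G.proj ε x u) := by
  rw [G'.proj_apply, endo hΦ h, G.proj_apply, map_smul, map_add, map_smul]

theorem projSec (ε : ℝ) (ha : Φ.Related a a') : Φ.Related (G.projSec ε a) (G'.projSec ε a') :=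
  fun x => by rw [G'.projSec_apply, ha, proj hΦ h, G.projSec_apply]

theorem reflSec (ha : Φ.Related a a') : Φ.Related (G.reflSec hC a) (G'.reflSec hC' a') :=
  fun x => by rw [G'.reflSec_apply, ha, refl hΦ h hC, G.reflSec_apply]

theorem mixed (ε : ℝ) (ha : Φ.Related a a') (hb : Φ.Related b b') :
    Φ.Related (G.mixed ε a b) (G'.mixed ε a' b') :=
  projSec hΦ h _ (hΦ.bracket _ _ _ _ (projSec hΦ h _ ha) (projSec hΦ h _ hb))

theorem partConn (ε : ℝ) (ha : Φ.Related a a') (hb : Φ.Related b b') :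
    Φ.Related (G.partConn hC ε a b) (G'.partConn hC' ε a' b') :=
  ((mixed hΦ h _ ha hb).add ((mixed hΦ h _ (reflSec hΦ h hC hC' ha) hb).smul _)).add
    ((reflSec hΦ h hC hC' (mixed hΦ h _ ha (reflSec hΦ h hC hC' hb))).smul _)

theorem zeroConn (ha : Φ.Related a a') (x : M) (u : E x) :
    (G'.zeroConn hC').toFun a' (Φ.base x) (Φ.fib x u) =
      Φ.fib x ((G.zeroConn hC).toFun a x u) := by
  obtain ⟨b, rfl⟩ := exists_section (d := d) (F := F) x u
  obtain ⟨b', hb⟩ := Φ.exists_related b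
  rw [← hb, G'.zeroConn_apply, G.zeroConn_apply]
  exact ((partConn hΦ h hC hC' 1 hb ha).add (partConn hΦ h hC hC' (-1) hb ha)) x

theorem divVec : Φ.Related ((G.zeroConn hC).divVec dv) ((G'.zeroConn hC').divVec dv') := by
  refine fun x => hΦ.eq_fib fun v => ?_
  obtain ⟨a, rfl⟩ := exists_section (d := d) (F := F) x v
  obtain ⟨a', ha⟩ := Φ.exists_related a
  have h1 : (G'.zeroConn hC').toFun a' (Φ.base x) =
      (Φ.fib x).conj ((G.zeroConn hC).toFun a x) := by
    ext u'
    obtain ⟨u, rfl⟩ := (Φ.fib x).surjective u'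
    rw [zeroConn hΦ h hC hC' ha, LinearEquiv.conj_apply_apply, LinearEquiv.symm_apply_apply]
  rw [← ha, CourantAlgebroid.GenConnection.pairing_divVec,
    CourantAlgebroid.GenConnection.pairing_divVec, h.div a a' ha, h1, LinearMap.trace_conj']

theorem weyl (x : M) (e u v : E x) : G'.weyl (Φ.base x) (Φ.fib x e) (Φ.fib x u) (Φ.fib x v) =
    Φ.fib x (G.weyl x e u v) := by
  simp only [G'.weyl_apply, G.weyl_apply, endo hΦ h, hΦ.pairing, map_smul, map_sub, map_add]

/-- By uniqueness, naturality of `D^{𝒢,div}` is only needed for the explicit formula, whose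
constituents are all natural. -/
theorem canonConn (ha : Φ.Related a a') (x : M) (u : E x) :
    (G'.canonConn hC' dv').toFun a' (Φ.base x) (Φ.fib x u) =
      Φ.fib x ((G.canonConn hC dv).toFun a x u) := by
  rw [CourantAlgebroid.GenMetric.canonConn, CourantAlgebroid.GenMetric.canonConn,
    CourantAlgebroid.GenConnection.addWeyl_apply, CourantAlgebroid.GenConnection.addWeyl_apply,
    zeroConn hΦ h hC hC' ha, divVec hΦ h hC hC' x, ha, weyl hΦ h, map_add]

end MapsPair

namespace IsCourantIso

variable {C : CourantAlgebroid d F E} {C' : CourantAlgebroid d F' E'} (hΦ : Φ.IsCourantIso C C')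
  {D : C.GenConnection} {D' : C'.GenConnection}
  (hD : ∀ a a', Φ.Related a a' → ∀ x u,
    D'.toFun a' (Φ.base x) (Φ.fib x u) = Φ.fib x (D.toFun a x u))

include hΦ in
theorem dualInner {x : M} {S T : E x →ₗ[ℝ] ℝ} {S' T' : E' (Φ.base x) →ₗ[ℝ] ℝ}
    (hS : ∀ u, S' (Φ.fib x u) = S u) (hT : ∀ u, T' (Φ.fib x u) = T u) :
    C'.dualInner (Φ.base x) S' T' = C.dualInner x S T := by
  have : FiniteDimensional ℝ (E x) := VectorBundle.finiteDimensional ℝ F E x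
  have : FiniteDimensional ℝ (E' (Φ.base x)) :=
    VectorBundle.finiteDimensional ℝ F' E' (Φ.base x)
  have h1 := tensorInner_eq_contraction ((Module.finBasis ℝ (E x)).map (Φ.fib x))
    (C'.pairing_symm (Φ.base x)) (C'.pairing_nondeg (Φ.base x)) (multi₁ S') (multi₁ T')
  have h2 := contraction_map (Module.finBasis ℝ (E x)) (Φ.fib x) _ (hΦ.pairing x) (n := 1)
    (S := fun u => S (u 0)) (T := fun u => T (u 0)) (S' := fun u => S' (u 0))
    (T' := fun u => T' (u 0)) (fun u => hS (u 0)) fun u => hT (u 0)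
  exact h1.trans h2

include hΦ hD

theorem deriv {a b a' b'} (ha : Φ.Related a a') (hb : Φ.Related b b') :
    Φ.Related (D.deriv a b) (D'.deriv a' b') := fun x => by
  rw [CourantAlgebroid.GenConnection.deriv_apply, CourantAlgebroid.GenConnection.deriv_apply,
    ha, hD _ _ hb]

theorem curv {v w b v' w' b'} (hv : Φ.Related v v') (hw : Φ.Related w w') (hb : Φ.Related b b')
    (x : M) : D'.curv v' w' b' (Φ.base x) = Φ.fib x (D.curv v w b x) := by
  unfold CourantAlgebroid.GenConnection.curv
  rw [hΦ.bracket _ _ _ _ hv hw x, hv, hw, hD _ _ hb, hD _ _ (deriv hΦ hD hv hb),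
    hD _ _ (deriv hΦ hD hw hb), map_sub, map_sub]

theorem rm {a b v w a' b' v' w'} (ha : Φ.Related a a') (hb : Φ.Related b b')
    (hv : Φ.Related v v') (hw : Φ.Related w w') (x : M) :
    D'.rm a' b' v' w' (Φ.base x) = D.rm a b v w x := by
  rw [D'.rm_eq, D.rm_eq, curv hΦ hD hv hw hb, curv hΦ hD hb ha hv, ha, hw, hΦ.pairing, hΦ.pairing]
  rw [hΦ.dualInner (S := (C.pairing x).flip (w x) ∘ₗ D.toFun v x)
    (T := (C.pairing x).flip (a x) ∘ₗ D.toFun b x)]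
  · intro u
    rw [LinearMap.comp_apply, hD _ _ hv]
    exact hΦ.pairing x _ _
  · intro u
    rw [LinearMap.comp_apply, hD _ _ hb]
    exact hΦ.pairing x _ _

theorem kretschmann {G : C.GenMetric} {G' : C'.GenMetric}
    (h : ∀ x u v, G'.form (Φ.base x) (Φ.fib x u) (Φ.fib x v) = G.form x u v) (x : M) :
    D'.kretschmann G' (Φ.base x) = D.kretschmann G x := by
  have : FiniteDimensional ℝ (E x) := VectorBundle.finiteDimensional ℝ F E x
  have hR : ∀ u : Fin 4 → E x, D'.rmAt (Φ.base x) (fun k => Φ.fib x (u k)) = D.rmAt x u := by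
    intro u
    choose s hs using fun k => Φ.exists_related (ext (u k))
    refine Eq.trans ?_ (rm hΦ hD (hs 0) (hs 1) (hs 2) (hs 3) x)
    refine D'.rm_congr ?_ ?_ ?_ ?_ <;> rw [hs, ext_apply, ext_apply]
  rw [← D'.contraction_rmAt G' (Φ.base x) ((Module.finBasis ℝ (E x)).map (Φ.fib x))]
  exact contraction_map _ _ _ (h x) hR hR

end IsCourantIso

end BundleIso

end Naturality

end GenGeom
end

open Bundle Manifold
open scoped ContDiff
noncomputable section
set_option linter.unusedSectionVars false
namespace GenGeom

/-! ### The Kretschmann scalar for vanishing flux and metric divergence -/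

section FluxFree

variable {d : ℕ} {M : Type*} [TopologicalSpace M] [ChartedSpace (EuclideanSpace ℝ (Fin d)) M]
  [IsManifold (𝓡 d) ∞ M] [T2Space M] [SigmaCompactSpace M]
  {F : Type*} [NormedAddCommGroup F] [NormedSpace ℝ F] [FiniteDimensional ℝ F]
  {E : M → Type*} [∀ x, AddCommGroup (E x)] [∀ x, Module ℝ (E x)]
  [∀ x, TopologicalSpace (E x)] [TopologicalSpace (TotalSpace F E)]
  [FiberBundle F E] [VectorBundle ℝ F E] [ContMDiffVectorBundle ∞ F E (𝓡 d)]

/-- The value of the curvature `R(V, W) B` at a point. -/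
def AffineConnection.curv (N : AffineConnection d M) (V W B : VF d M) (x : M) : TM d x :=
  N.toFun (N.deriv W B) x (V x) - N.toFun (N.deriv V B) x (W x)
    - N.toFun B x (VectorField.mlieBracket (𝓡 d) V W x)

theorem AffineConnection.sub' (N : AffineConnection d M) (Y Z : VF d M) (x : M) :
    N.toFun (Y - Z) x = N.toFun Y x - N.toFun Z x := by
  have h := N.add' (Y - Z) Z x
  rw [sub_add_cancel] at h
  rw [h, add_sub_cancel_right]

/-- Replacing Lie brackets by `∇_V W - ∇_W V` turns the Jacobi identity of vector fields into the
cyclic identity. -/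
theorem AffineConnection.IsLeviCivita.bianchi {N : AffineConnection d M}
    {g : ∀ x : M, LinearMap.BilinForm ℝ (TM d x)} (hN : N.IsLeviCivita g) (V W B : VF d M) (x : M) :
    N.curv V W B x + N.curv W B V x + N.curv B V W x = 0 := by
  have hb : ∀ V W : VF d M, VectorField.mlieBracket (𝓡 d) V W =
      ⇑(N.deriv V W - N.deriv W V : VF d M) := fun V W => by
    funext y; exact (hN.2 V W y).symm
  have key : ∀ V W B : VF d M,
      VectorField.mlieBracket (𝓡 d) V (VectorField.mlieBracket (𝓡 d) W B) x =
      N.toFun (N.deriv W B) x (V x) - N.toFun (N.deriv B W) x (V x) -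
        N.toFun V x (VectorField.mlieBracket (𝓡 d) W B x) := fun V W B => by
    rw [hb W B, ← hN.2 V _ x, N.sub', LinearMap.sub_apply]
  have hm : minSmoothness ℝ 3 ≤ ∞ := by
    rw [minSmoothness_of_isRCLikeNormedField]; exact ENat.LEInfty.out
  have hm' : minSmoothness ℝ 2 ≤ ∞ := by
    rw [minSmoothness_of_isRCLikeNormedField]; exact ENat.LEInfty.out
  have : IsManifold (𝓡 d) (minSmoothness ℝ 3) M := IsManifold.of_le (n := ∞) hm
  have hj := VectorField.leibniz_identity_mlieBracket_apply (I := 𝓡 d) (x := x)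
    (V.contMDiff.contMDiffAt.of_le hm') (W.contMDiff.contMDiffAt.of_le hm')
    (B.contMDiff.contMDiffAt.of_le hm')
  rw [VectorField.mlieBracket_swap_apply (W := B), key, key, key] at hj
  simp only [AffineConnection.curv]
  rw [VectorField.mlieBracket_swap_apply (V := B), map_neg, ← sub_eq_zero.2 hj]
  abel

namespace CourantAlgebroid

variable {C : CourantAlgebroid d F E}

theorem GenConnection.curv_skew (D : C.GenConnection) (v w a b : Sec d F E) (x : M) :
    C.pairing x (D.curv v w a x) (b x) = -C.pairing x (a x) (D.curv v w b x) := by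
  let f := C.pair a b
  let f₁ : Fun d M := C.pair (D.deriv v a) b + C.pair a (D.deriv v b)
  let f₂ : Fun d M := C.pair (D.deriv w a) b + C.pair a (D.deriv w b)
  have h := fun c => commutator_smul f f₁ f₂ v w c (fun y => (D.pairing' a b y (v y)).symm)
    (fun y => (D.pairing' a b y (w y)).symm) x
  have h₁ : mvfderiv (𝓡 d) f₂ x (C.anchor x (v x)) =
      mvfderiv (𝓡 d) (C.pair (D.deriv w a) b) x (C.anchor x (v x)) +
      mvfderiv (𝓡 d) (C.pair a (D.deriv w b)) x (C.anchor x (v x)) := mvfderiv_fun_add' ..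
  have h₂ : mvfderiv (𝓡 d) f₁ x (C.anchor x (w x)) =
      mvfderiv (𝓡 d) (C.pair (D.deriv v a) b) x (C.anchor x (w x)) +
      mvfderiv (𝓡 d) (C.pair a (D.deriv v b)) x (C.anchor x (w x)) := mvfderiv_fun_add' ..
  have p : ∀ a b : Sec d F E, ∀ u, mvfderiv (𝓡 d) (C.pair a b) x (C.anchor x u) = _ :=
    fun a b u => D.pairing' a b x u
  have hK : mvfderiv (𝓡 d) f₂ x (C.anchor x (v x)) - mvfderiv (𝓡 d) f₁ x (C.anchor x (w x)) -
      mvfderiv (𝓡 d) f x (C.anchor x (C.bracket v w x)) =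
      C.pairing x (D.curv v w a x) (b x) + C.pairing x (a x) (D.curv v w b x) := by
    rw [h₁, h₂, p, p, p, p, p]
    simp only [GenConnection.curv, map_sub, LinearMap.sub_apply, GenConnection.deriv_apply]
    ring
  rw [hK] at h
  -- `commutator_smul` only says that this scalar annihilates every vector of the fibre. If it is
  -- nonzero, `a x` and `b x` vanish and the claim is trivial.
  by_cases h0 : C.pairing x (D.curv v w a x) (b x) + C.pairing x (a x) (D.curv v w b x) = 0
  · linarith
  · have ha := (smul_eq_zero.1 (h a)).resolve_left h0
    have hb := (smul_eq_zero.1 (h b)).resolve_left h0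
    rw [ha, hb]; simp

/-- Isotropy of `T*M`; it removes the trace term from `ℛm` when `D` differentiates only along the
anchor. -/
theorem dualInner_anchor (hC : C.IsExact) (x : M) (ξ ζ : TM d x →ₗ[ℝ] ℝ) :
    C.dualInner x (ξ ∘ₗ C.anchor x) (ζ ∘ₗ C.anchor x) = 0 := by
  obtain ⟨s, hs, hξ⟩ := hC.exists_ker ξ
  have : ξ ∘ₗ C.anchor x = C.pairing x s := by ext v; exact (hξ v).symm
  rw [this, dualInner_pairing_left, LinearMap.comp_apply, hs, map_zero]

variable {G : C.GenMetric} (hC : C.IsExact) {ε : ℝ} (hH : G.baseFlux hC = 0)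

include hH in
-- For `H = 0` both mixed brackets reduce to `∇`, so `D⁰` is `∇` lifted to `E_±`, for every
-- direction `u`.
theorem GenMetric.zeroConn_liftESec (hε : ε = 1 ∨ ε = -1) (Y : VF d M) (x : M) (u : E x) :
    (G.zeroConn hC).toFun (G.liftESec hC ε Y) x u =
      G.liftE hC ε x ((G.baseNabla hC).toFun Y x (C.anchor x u)) := by
  have hε' : ε * ε = 1 := by rcases hε with rfl | rfl <;> norm_num
  have hL := G.zeroConn_isLeviCivita hC
  have hY := isPure_liftESec (G := G) hC hε' Y
  have hπ : C.anchorSec (G.liftESec hC ε Y) = Y := by ext y; simp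
  obtain ⟨a, rfl⟩ := exists_section (d := d) (F := F) x u
  refine pairing_ext_sec (d := d) (F := F) (C := C) x fun c => ?_
  have key : ∀ a c : Sec d F E, G.IsPure ε a → G.IsPure ε c →
      ε * G.baseMetric hC x ((G.baseNabla hC).toFun Y x (C.anchor x (a x))) (C.anchor x (c x)) =
        C.pairing x (C.bracket (G.reflSec hC a) (G.liftESec hC ε Y) x) (c x) := fun a c ha hc => by
    have h1 := G.baseNabla_pure hC hε ha hY hc x
    have h2 := G.baseFlux_apply hC hε ha hY hc x
    rw [hπ] at h1
    rw [hH] at h2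
    have h3 : (0 : ℝ) = G.flux hC a (G.liftESec hC ε Y) c x := h2
    rw [GenMetric.flux] at h3
    linarith
  have hc := isPure_projSec (G := G) hε' c
  have hc' := isPure_projSec (G := G) (neg_mul_neg_one hε') c
  have ha := isPure_projSec (G := G) hε' a
  have ha' := isPure_projSec (G := G) (neg_mul_neg_one hε') a
  have hp : ∀ X, C.pairing x (G.liftE hC ε x X) (G.projSec ε c x) =
      ε * G.baseMetric hC x X (C.anchor x (G.projSec ε c x)) := fun X => by
    rw [G.pairing_pure hC hε (G.endo_liftE hC hε' x X) (hc x), G.anchor_liftE]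
  rw [G.projSec_add_projSec ε c, Sec.add_apply, map_add, map_add,
    G.pairing_eq_zero hε' (hL.endo_toFun hY x _) (hc' x),
    G.pairing_eq_zero hε' (G.endo_liftE hC hε' x _) (hc' x), add_zero, add_zero, hp]
  rw [G.projSec_add_projSec ε a]
  simp only [Sec.add_apply, map_add, LinearMap.add_apply, mul_add]
  congr 1
  · obtain ⟨Q, hQ⟩ := (G.zeroConn_isCanonicalZero hC).pure
    rw [hQ ε hε _ _ _ ha hY hc, Q.eq_induced G hC, hπ]
    have h0 : (G.induced hC).H = 0 := hH
    rw [h0]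
    change _ + 1 / 6 * (0 : ℝ) = _
    rw [mul_zero, add_zero]
    rfl
  · rw [hL.pairing_mixed hε' ha' hY hc, ← G.reflSec_reflSec hC (G.projSec (-ε) a),
      ← key _ _ (ha'.reflSec' hC) hc]
    simp only [GenMetric.reflSec_apply, GenMetric.anchor_refl]

include hH in
theorem GenMetric.trace_zeroConn (a : Sec d F E) (x : M) :
    LinearMap.trace ℝ (E x) ((G.zeroConn hC).toFun a x) =
      LinearMap.trace ℝ (TM d x) ((G.baseNabla hC).toFun (C.anchorSec a) x) := by
  have : FiniteDimensional ℝ (E x) := VectorBundle.finiteDimensional ℝ F E x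
  have : FiniteDimensional ℝ (TM d x) :=
    inferInstanceAs (FiniteDimensional ℝ (EuclideanSpace ℝ (Fin d)))
  have key : ∀ ε : ℝ, (ε = 1 ∨ ε = -1) → ∀ Y : VF d M,
      LinearMap.trace ℝ (E x) ((G.zeroConn hC).toFun (G.liftESec hC ε Y) x) =
        LinearMap.trace ℝ (TM d x) ((G.baseNabla hC).toFun Y x) := fun ε hε Y => by
    have h1 : (G.zeroConn hC).toFun (G.liftESec hC ε Y) x =
        (G.liftE hC ε x ∘ₗ (G.baseNabla hC).toFun Y x) ∘ₗ C.anchor x := by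
      ext u; exact GenMetric.zeroConn_liftESec hC hH hε Y x u
    have h2 : C.anchor x ∘ₗ (G.liftE hC ε x ∘ₗ (G.baseNabla hC).toFun Y x) =
        (G.baseNabla hC).toFun Y x := by ext X : 1; simp
    rw [h1, LinearMap.trace_comp_comm', h2]
  have h1 : (1 : ℝ) * 1 = 1 := one_mul 1
  conv_lhs => rw [G.projSec_add_projSec 1 a, (isPure_projSec h1 a).eq_liftESec hC h1,
    (isPure_projSec (neg_mul_neg_one h1) a).eq_liftESec hC (neg_mul_neg_one h1)]
  rw [(G.zeroConn hC).add', map_add, key 1 (Or.inl rfl), key (-1) (Or.inr rfl), ← map_add,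
    ← (G.baseNabla hC).add']
  congr 2
  ext y
  rw [Sec.add_apply, anchorSec_apply, anchorSec_apply, ← map_add, ← Sec.add_apply,
    ← G.projSec_add_projSec]
  rfl

include hH in
-- `D⁰` already has the metric divergence, so no correction is needed.
theorem GenMetric.canonConn_eq_zeroConn {dv : C.Divergence}
    (hdv : (G.induced hC).IsMetricDivergence dv) : G.canonConn hC dv = G.zeroConn hC := by
  have he : ∀ x, (G.zeroConn hC).divVec dv x = 0 := fun x => by
    refine C.pairing_nondeg x _ fun v => ?_
    obtain ⟨a, rfl⟩ := exists_section (d := d) (F := F) x v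
    rw [GenConnection.pairing_divVec, hdv, GenMetric.trace_zeroConn hC hH]
    exact mul_eq_zero_of_right _ (sub_self _)
  refine GenConnection.ext' fun a b x => ?_
  rw [GenMetric.canonConn, GenConnection.addWeyl_apply, he]
  simp [G.weyl_apply]

include hH in
theorem GenMetric.curv_zeroConn (hε : ε = 1 ∨ ε = -1) (v w : Sec d F E) (Y : VF d M) (x : M) :
    (G.zeroConn hC).curv v w (G.liftESec hC ε Y) x =
      G.liftE hC ε x ((G.baseNabla hC).curv (C.anchorSec v) (C.anchorSec w) Y x) := by
  have h1 : ∀ a, (G.zeroConn hC).deriv a (G.liftESec hC ε Y) =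
      G.liftESec hC ε ((G.baseNabla hC).deriv (C.anchorSec a) Y) := fun a => by
    ext y; exact GenMetric.zeroConn_liftESec hC hH hε Y y (a y)
  unfold GenConnection.curv
  rw [h1, h1, GenMetric.zeroConn_liftESec hC hH hε, GenMetric.zeroConn_liftESec hC hH hε,
    GenMetric.zeroConn_liftESec hC hH hε, C.anchor_bracket, ← map_sub, ← map_sub]
  rfl

/-! ### The generalised Riemann tensor in terms of the Riemann tensor -/

/-- The Riemann tensor of the induced metric. -/
def GenMetric.baseRiem (G : C.GenMetric) (hC : C.IsExact) (A B V W : VF d M) (x : M) : ℝ :=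
  G.baseMetric hC x (A x) ((G.baseNabla hC).curv V W B x)

include hH in
-- Inherited from the skewness of the curvature of `D⁰`, which for `H = 0` is the lift of that of
-- `∇`.
theorem GenMetric.baseRiem_skew_left (A B V W : VF d M) (x : M) :
    G.baseRiem hC A B V W x = -G.baseRiem hC B A V W x := by
  have h := (G.zeroConn hC).curv_skew (G.liftESec hC 1 V) (G.liftESec hC 1 W)
    (G.liftESec hC 1 B) (G.liftESec hC 1 A) x
  have hV : ∀ V, C.anchorSec (G.liftESec hC 1 V) = V := fun V => by ext y; simp
  rw [GenMetric.curv_zeroConn hC hH (Or.inl rfl), GenMetric.curv_zeroConn hC hH (Or.inl rfl),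
    hV, hV, C.pairing_symm] at h
  exact h

theorem GenMetric.baseRiem_skew_right (A B V W : VF d M) (x : M) :
    G.baseRiem hC A B V W x = -G.baseRiem hC A B W V x := by
  unfold GenMetric.baseRiem AffineConnection.curv
  rw [VectorField.mlieBracket_swap_apply]
  simp only [map_sub, map_neg]
  ring

include hH in
-- The classical argument: combine four instances of the Bianchi identity, one for each argument in
-- the first slot, with the two skew-symmetries.
theorem GenMetric.baseRiem_pair_symm (A B V W : VF d M) (x : M) :
    G.baseRiem hC W V B A x = G.baseRiem hC A B V W x := by
  have bi : ∀ A B V W, G.baseRiem hC A B V W x + G.baseRiem hC A V W B x +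
      G.baseRiem hC A W B V x = 0 := fun A B V W => by
    have h := (G.baseNabla_isLeviCivita hC).bianchi V W B x
    unfold GenMetric.baseRiem
    rw [← map_add, ← map_add, h, map_zero]
  have l := fun A B V W => GenMetric.baseRiem_skew_left hC hH A B V W x
  have r := fun A B V W => GenMetric.baseRiem_skew_right (G := G) hC A B V W x
  linarith [bi A B V W, bi B V W A, bi V W A B, bi W A B V, l A B V W, l A V W B, l A W B V,
    l B V W A, l B W A V, l V W A B, r A B V W, r A B W V, r A V W B, r A V B W, r A W B V,
    r B V W A, r B W A V, r V W A B, r W V B A, r W V A B, r W A B V, r W B V A, r V A B W]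

/-- The Riemann tensor of the induced metric at a point. -/
def GenMetric.baseRiemAt (G : C.GenMetric) (hC : C.IsExact) (x : M) (X : Fin 4 → TM d x) : ℝ :=
  G.baseRiem hC (ext (X 0)) (ext (X 1)) (ext (X 2)) (ext (X 3)) x

include hH in
-- The first curvature term survives only if slots 0 and 1 have equal type, the second only if slots
-- 2 and 3 do, each weighted by the sign of the pairing there. Pair symmetry identifies the two, and
-- the trace term vanishes by `dualInner_anchor`.
theorem GenMetric.zeroConn_rm {η : Fin 4 → ℝ} (hη : ∀ i, η i = 1 ∨ η i = -1) (A B V W : VF d M)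
    (x : M) : (G.zeroConn hC).rm (G.liftESec hC (η 0) A) (G.liftESec hC (η 1) B)
      (G.liftESec hC (η 2) V) (G.liftESec hC (η 3) W) x =
      1 / 2 * ((if η 0 = η 1 then η 0 else 0) + (if η 2 = η 3 then η 2 else 0)) *
        G.baseRiem hC A B V W x := by
  have hη' : ∀ i, η i * η i = 1 := fun i => by rcases hη i with h | h <;> rw [h] <;> norm_num
  have hV : ∀ ε V, C.anchorSec (G.liftESec hC ε V) = V := fun ε V => by ext y; simp
  have hp : ∀ i j X Y, C.pairing x (G.liftE hC (η i) x X) (G.liftE hC (η j) x Y) =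
      (if η i = η j then η i else 0) * G.baseMetric hC x X Y := fun i j X Y => by
    split_ifs with h
    · rw [← h, G.pairing_liftE hC (hη i)]
    · have h' : η j = -η i := by
        rcases hη i with h1 | h1 <;> rcases hη j with h2 | h2 <;> rw [h1, h2] at h ⊢ <;> simp at h ⊢
      rw [h', G.pairing_eq_zero (hη' i) (G.endo_liftE hC (hη' i) x X)
        (G.endo_liftE hC (neg_mul_neg_one (hη' i)) x Y), zero_mul]
  have hS : ∀ i j (Y Z : VF d M), (C.pairing x).flip (G.liftESec hC (η j) Z x) ∘ₗ
      (G.zeroConn hC).toFun (G.liftESec hC (η i) Y) x =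
      ((if η i = η j then η i else 0) • ((G.baseMetric hC x).flip (Z x) ∘ₗ
        (G.baseNabla hC).toFun Y x)) ∘ₗ C.anchor x := fun i j Y Z => by
    ext u
    change C.pairing x ((G.zeroConn hC).toFun (G.liftESec hC (η i) Y) x u)
      (G.liftESec hC (η j) Z x) = (if η i = η j then η i else 0) * _
    rw [GenMetric.zeroConn_liftESec hC hH (hη i), G.liftESec_apply, hp]
    rfl
  rw [GenConnection.rm_eq, hS, hS, dualInner_anchor hC, GenMetric.curv_zeroConn hC hH (hη 1),
    GenMetric.curv_zeroConn hC hH (hη 2), hV, hV, hV, hV, G.liftESec_apply, G.liftESec_apply,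
    hp, hp]
  have h1 := GenMetric.baseRiem_pair_symm hC hH A B V W x
  have h2 : (if η 3 = η 2 then η 3 else 0) = if η 2 = η 3 then η 2 else 0 := by
    by_cases h : η 2 = η 3
    · rw [if_pos h, if_pos h.symm, h]
    · rw [if_neg h, if_neg (Ne.symm h)]
  unfold GenMetric.baseRiem at h1 ⊢
  rw [h2, h1]
  ring

include hH in
theorem GenMetric.zeroConn_rmAt {η : Fin 4 → ℝ} (hη : ∀ i, η i = 1 ∨ η i = -1) (x : M)
    (X : Fin 4 → TM d x) : (G.zeroConn hC).rmAt x (fun k => G.liftE hC (η k) x (X k)) =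
      1 / 2 * ((if η 0 = η 1 then η 0 else 0) + (if η 2 = η 3 then η 2 else 0)) *
        G.baseRiemAt hC x X := by
  refine Eq.trans ?_ (GenMetric.zeroConn_rm hC hH hη (ext (X 0)) (ext (X 1)) (ext (X 2))
    (ext (X 3)) x)
  refine GenConnection.rm_congr _ ?_ ?_ ?_ ?_ <;> rw [ext_apply, G.liftESec_apply, ext_apply]

/-! ### Contraction in a frame adapted to the splitting into `E_+` and `E_-` -/

/-- The isomorphism `TM ⊕ TM ≅ E_+ ⊕ E_- = E`. -/
def GenMetric.liftEquiv (G : C.GenMetric) (hC : C.IsExact) (x : M) :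
    (TM d x × TM d x) ≃ₗ[ℝ] E x where
  toFun X := G.liftE hC 1 x X.1 + G.liftE hC (-1) x X.2
  map_add' X Y := by simp only [Prod.fst_add, Prod.snd_add, map_add]; abel
  map_smul' r X := by simp
  invFun u := (C.anchor x (G.proj 1 x u), C.anchor x (G.proj (-1) x u))
  left_inv X := by
    have h : (1 : ℝ) * 1 = 1 := one_mul 1
    have h' : (-1 : ℝ) * -1 = 1 := neg_mul_neg_one h
    have e1 := G.endo_liftE hC h x X.1
    have e2 := G.endo_liftE hC h' x X.2
    simp only [map_add, G.proj_eq_self h e1, G.proj_eq_zero h e2, G.proj_eq_self h' e2,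
      G.proj_neg_eq_zero h e1, G.anchor_liftE, add_zero, zero_add, Prod.mk.eta]
  right_inv u := by
    have h : (1 : ℝ) * 1 = 1 := one_mul 1
    change G.liftE hC 1 x (C.anchor x (G.proj 1 x u)) +
      G.liftE hC (-1) x (C.anchor x (G.proj (-1) x u)) = u
    rw [← G.eq_liftE hC h (G.endo_proj h x u),
      ← G.eq_liftE hC (neg_mul_neg_one h) (G.endo_proj (neg_mul_neg_one h) x u),
      G.proj_add_proj]

/-- The sign `± 1`. -/
def signOf (s : Bool) : ℝ := bif s then -1 else 1

theorem signOf_eq (s : Bool) : signOf s = 1 ∨ signOf s = -1 := by cases s <;> simp [signOf]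

theorem sum_fin_four_bool (f : Bool → Bool → Bool → Bool → ℝ) :
    ∑ s : Fin 4 → Bool, f (s 0) (s 1) (s 2) (s 3) = ∑ p, ∑ q, ∑ r, ∑ t, f p q r t := by
  rw [← (Fin.consEquiv (fun _ : Fin 4 => Bool)).sum_comp, Fintype.sum_prod_type]
  refine Finset.sum_congr rfl fun p _ => ?_
  rw [← (Fin.consEquiv (fun _ : Fin 3 => Bool)).sum_comp, Fintype.sum_prod_type]
  refine Finset.sum_congr rfl fun q _ => ?_
  rw [← (Fin.consEquiv (fun _ : Fin 2 => Bool)).sum_comp, Fintype.sum_prod_type]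
  refine Finset.sum_congr rfl fun r _ => ?_
  rw [← (Fin.consEquiv (fun _ : Fin 1 => Bool)).sum_comp, Fintype.sum_prod_type]
  refine Finset.sum_congr rfl fun t _ => ?_
  simp only [Fintype.sum_unique]
  rfl

/-- Two patterns, all signs equal, contribute 1 each. Eight patterns with exactly one of the two
pairs equal contribute 1/4 each. The remaining six contribute 0. -/
theorem sum_sign_sq : ∑ s : Fin 4 → Bool, (1 / 2 * ((if signOf (s 0) = signOf (s 1) then
    signOf (s 0) else 0) + (if signOf (s 2) = signOf (s 3) then signOf (s 2) else 0))) ^ 2 = 4 := by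
  rw [sum_fin_four_bool (fun p q r t => (1 / 2 * ((if signOf p = signOf q then
    signOf p else 0) + (if signOf r = signOf t then signOf r else 0))) ^ 2)]
  have h : (-1 : ℝ) ≠ 1 := by norm_num
  simp only [Fintype.sum_bool, signOf, cond_true, cond_false, if_true, h, h.symm, if_false]
  norm_num

theorem dualVec_eq_of_apply {V : Type*} [AddCommGroup V] [Module ℝ V] {ι : Type*} [Fintype ι]
    [DecidableEq ι] (b : Module.Basis ι ℝ V) {B : LinearMap.BilinForm ℝ V}
    (hn : ∀ u, (∀ v, B u v = 0) → u = 0) {i : ι} {v : V}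
    (h : ∀ j, B v (b j) = if i = j then 1 else 0) : dualVec b B i = v := by
  rw [← sub_eq_zero]
  refine hn _ fun w => ?_
  have : B (dualVec b B i - v) = 0 := b.ext fun j => by simp [dualVec_apply b hn, h]
  rw [this]; rfl

section LiftBasis

variable {ι : Type*} [Fintype ι] [DecidableEq ι] {x : M} (b : Module.Basis ι ℝ (TM d x))

/-- The basis of `E` adapted to `E = E_+ ⊕ E_-` defined by a basis of `TM`. -/
def GenMetric.liftBasis (G : C.GenMetric) (hC : C.IsExact) : Module.Basis (Bool × ι) ℝ (E x) :=
  ((b.prod b).map (G.liftEquiv hC x)).reindex (Equiv.boolProdEquivSum _).symm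

theorem GenMetric.liftBasis_apply (s : Bool) (i : ι) :
    G.liftBasis b hC (s, i) = G.liftE hC (signOf s) x (b i) := by
  cases s <;> simp [GenMetric.liftBasis, GenMetric.liftEquiv, signOf]

/-- On `E_±` the pairing is `± g`, so `𝒢` is `g` on both summands; lifting commutes with taking dual
bases, without a sign. -/
theorem GenMetric.dualVec_liftBasis (s : Bool) (i : ι) :
    dualVec (G.liftBasis b hC) (G.form x) (s, i) =
      G.liftE hC (signOf s) x (dualVec b (G.baseMetric hC x) i) := by
  have hσ : ∀ s, signOf s * signOf s = 1 := fun s => by cases s <;> simp [signOf]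
  refine dualVec_eq_of_apply _ (G.form_nondeg x) ?_
  rintro ⟨t, j⟩
  rw [GenMetric.liftBasis_apply, G.form_apply, G.endo_liftE hC (hσ s), map_smul,
    LinearMap.smul_apply, smul_eq_mul]
  by_cases hst : s = t
  · subst hst
    rw [G.pairing_liftE hC (signOf_eq s), ← mul_assoc, hσ, one_mul,
      dualVec_apply b (G.baseMetric_nondeg hC x)]
    simp
  · have ht : signOf t = -signOf s := by cases s <;> cases t <;> simp [signOf] at hst ⊢
    rw [ht, G.pairing_eq_zero (hσ s) (G.endo_liftE hC (hσ s) x _)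
      (G.endo_liftE hC (neg_mul_neg_one (hσ s)) x _), mul_zero, if_neg (by simp [hst])]

include hH in
-- Read off from `ℛm` on `E_+`, where the sign factor is `(1 + 1)/2 = 1`.
theorem GenMetric.exists_multilinear_baseRiemAt (x : M) :
    ∃ R : MultilinearMap ℝ (fun _ : Fin 4 => TM d x) ℝ, ⇑R = G.baseRiemAt hC x := by
  refine ⟨((G.zeroConn hC).rmMulti x).compLinearMap fun _ => G.liftE hC 1 x, funext fun X => ?_⟩
  refine Eq.trans (GenMetric.zeroConn_rmAt hC hH (η := fun _ => 1) (fun _ => Or.inl rfl) x X) ?_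
  rw [if_pos rfl]
  ring

include hH in
theorem GenMetric.contraction_liftBasis :
    contraction (G.liftBasis b hC) (G.form x) 4 ((G.zeroConn hC).rmAt x) ((G.zeroConn hC).rmAt x) =
      4 * contraction b (G.baseMetric hC x) 4 (G.baseRiemAt hC x) (G.baseRiemAt hC x) := by
  obtain ⟨R, hR⟩ := GenMetric.exists_multilinear_baseRiemAt hC hH x
  have h1 := contraction_eq_sum b (B := G.baseMetric hC x) (G.baseRiemAt hC x) R
  have h2 := contraction_eq_sum (G.liftBasis b hC) (B := G.form x) ((G.zeroConn hC).rmAt x)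
    ((G.zeroConn hC).rmMulti x)
  rw [hR] at h1
  refine h2.trans ?_
  rw [h1, ← (Equiv.arrowProdEquivProdArrow (Fin 4) (fun _ => Bool) (fun _ => ι)).symm.sum_comp,
    Fintype.sum_prod_type, ← sum_sign_sq, Finset.sum_mul]
  refine Finset.sum_congr rfl fun s _ => ?_
  rw [Finset.mul_sum]
  refine Finset.sum_congr rfl fun I _ => ?_
  have e1 : (fun k => G.liftBasis b hC ((Equiv.arrowProdEquivProdArrow (Fin 4) (fun _ => Bool)
      (fun _ => ι)).symm (s, I) k)) = fun k => G.liftE hC (signOf (s k)) x (b (I k)) :=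
    funext fun k => GenMetric.liftBasis_apply hC b _ _
  have e2 : (fun k => dualVec (G.liftBasis b hC) (G.form x)
      ((Equiv.arrowProdEquivProdArrow (Fin 4) (fun _ => Bool) (fun _ => ι)).symm (s, I) k)) =
      fun k => G.liftE hC (signOf (s k)) x (dualVec b (G.baseMetric hC x) (I k)) :=
    funext fun k => GenMetric.dualVec_liftBasis hC b _ _
  rw [e1, e2]
  have k := GenMetric.zeroConn_rmAt hC hH (η := fun k => signOf (s k)) (fun k => signOf_eq _) x
  have k1 := k fun k => b (I k)
  have k2 := k fun k => dualVec b (G.baseMetric hC x) (I k)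
  refine (congrArg₂ (· * ·) k1 k2).trans ?_
  exact (mul_mul_mul_comm _ _ _ _).trans (congrArg₂ (· * ·) (sq _).symm rfl)

end LiftBasis

include hH in
theorem GenMetric.kretschmann_zeroConn (x : M) : (G.zeroConn hC).kretschmann G x =
    4 * (G.baseNabla hC).riemNormSq (G.baseMetric hC) x := by
  have : FiniteDimensional ℝ (TM d x) :=
    VectorBundle.finiteDimensional ℝ (EuclideanSpace ℝ (Fin d)) (fun x : M => TM d x) x
  rw [← GenConnection.contraction_rmAt _ G x
    (G.liftBasis (Module.finBasis ℝ (TM d x)) hC), GenMetric.contraction_liftBasis hC hH]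
  rfl

/-- The Kretschmann scalar of the canonical connection for `H = 0` and metric divergence. -/
theorem GenConnection.IsCanonical.kretschmann_eq {dv : C.Divergence} {D : C.GenConnection}
    (hC : C.IsExact) (hd : 2 ≤ d) (hD : D.IsCanonical G dv) {Q : InducedGeometry C G}
    (hQ : Q.H = 0) (hdv : Q.IsMetricDivergence dv) (x : M) :
    D.kretschmann G x = 4 * Q.nabla.riemNormSq Q.g x := by
  obtain rfl := Q.eq_induced G hC
  obtain rfl := hD.eq_canonConn hC hd
  rw [GenMetric.canonConn_eq_zeroConn hC hQ hdv, GenMetric.kretschmann_zeroConn hC hQ]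
  rfl

end CourantAlgebroid

end FluxFree

end GenGeom
end

open Bundle Manifold
open scoped ContDiff
noncomputable section
set_option linter.unusedSectionVars false
namespace GenGeom

/-! ### The standard Courant algebroid over the plane -/

section Dorfman

variable {A : Type*} [CommRing A] [Algebra ℝ A] (D : Fin 2 → Derivation ℝ A A)

/-- The Dorfman bracket of two generalised vector fields `(X⁰, X¹, ξ₀, ξ₁)` with components in
an algebra with two derivations. -/
def dorfman (a b : Fin 4 → A) : Fin 4 → A :=
  ![a 0 * D 0 (b 0) + a 1 * D 1 (b 0) - (b 0 * D 0 (a 0) + b 1 * D 1 (a 0)),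
    a 0 * D 0 (b 1) + a 1 * D 1 (b 1) - (b 0 * D 0 (a 1) + b 1 * D 1 (a 1)),
    a 0 * D 0 (b 2) + a 1 * D 1 (b 2) - (b 0 * D 0 (a 2) + b 1 * D 1 (a 2)) +
      (D 0 (a 0) * b 2 + D 0 (a 1) * b 3 + D 0 (a 2) * b 0 + D 0 (a 3) * b 1),
    a 0 * D 0 (b 3) + a 1 * D 1 (b 3) - (b 0 * D 0 (a 3) + b 1 * D 1 (a 3)) +
      (D 1 (a 0) * b 2 + D 1 (a 1) * b 3 + D 1 (a 2) * b 0 + D 1 (a 3) * b 1)]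

variable {D}

/-- Over an abstract algebra with commuting derivations the Courant algebroid axioms become
polynomial identities. The plane is the case of smooth functions and partial derivatives. -/
theorem dorfman_jacobi (h : ∀ f, D 1 (D 0 f) = D 0 (D 1 f)) (a b c : Fin 4 → A) :
    dorfman D a (dorfman D b c) = dorfman D (dorfman D a b) c + dorfman D b (dorfman D a c) := by
  funext k
  fin_cases k <;>
  simp only [dorfman, Pi.add_apply, Matrix.cons_val, map_add, map_sub, Derivation.leibniz,
    smul_eq_mul, h, Fin.mk_one, Fin.zero_eta, Fin.reduceFinMk] <;> ring

theorem dorfman_add_left (a a' b : Fin 4 → A) :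
    dorfman D (a + a') b = dorfman D a b + dorfman D a' b := by
  funext k
  fin_cases k <;>
  simp only [dorfman, Pi.add_apply, Matrix.cons_val, map_add, Fin.mk_one, Fin.zero_eta,
    Fin.reduceFinMk] <;> ring

theorem dorfman_add_right (a b b' : Fin 4 → A) :
    dorfman D a (b + b') = dorfman D a b + dorfman D a b' := by
  funext k
  fin_cases k <;>
  simp only [dorfman, Pi.add_apply, Matrix.cons_val, map_add, Fin.mk_one, Fin.zero_eta,
    Fin.reduceFinMk] <;> ring

theorem dorfman_smul_left (r : ℝ) (a b : Fin 4 → A) :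
    dorfman D (r • a) b = r • dorfman D a b := by
  funext k
  fin_cases k <;>
  (simp only [dorfman, Pi.smul_apply, Matrix.cons_val, Derivation.map_smul, Fin.mk_one,
    Fin.zero_eta, Fin.reduceFinMk]
   simp only [Algebra.smul_def]
   ring)

theorem dorfman_smul_right (r : ℝ) (a b : Fin 4 → A) :
    dorfman D a (r • b) = r • dorfman D a b := by
  funext k
  fin_cases k <;>
  (simp only [dorfman, Pi.smul_apply, Matrix.cons_val, Derivation.map_smul, Fin.mk_one,
    Fin.zero_eta, Fin.reduceFinMk]
   simp only [Algebra.smul_def]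
   ring)

theorem dorfman_mul_right (a b : Fin 4 → A) (f : A) (k : Fin 4) :
    dorfman D a (fun k => f * b k) k =
      (a 0 * D 0 f + a 1 * D 1 f) * b k + f * dorfman D a b k := by
  fin_cases k <;>
  simp only [dorfman, Matrix.cons_val, Derivation.leibniz, smul_eq_mul, Fin.mk_one, Fin.zero_eta,
    Fin.reduceFinMk] <;> ring

/-- The scalar product of two generalised vector fields. -/
def dorfmanPair (a b : Fin 4 → A) : A := a 0 * b 2 + a 2 * b 0 + a 1 * b 3 + a 3 * b 1

theorem dorfmanPair_dorfman (a b c : Fin 4 → A) :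
    a 0 * D 0 (dorfmanPair b c) + a 1 * D 1 (dorfmanPair b c) =
      dorfmanPair (dorfman D a b) c + dorfmanPair b (dorfman D a c) := by
  simp only [dorfmanPair, dorfman, Matrix.cons_val, map_add, Derivation.leibniz, smul_eq_mul]
  ring

theorem dorfmanPair_dorfman_self (a b : Fin 4 → A) :
    dorfmanPair (dorfman D a a) b + dorfmanPair (dorfman D a a) b =
      b 0 * D 0 (dorfmanPair a a) + b 1 * D 1 (dorfmanPair a a) := by
  simp only [dorfmanPair, dorfman, Matrix.cons_val, map_add, Derivation.leibniz, smul_eq_mul]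
  ring

variable (D) in
/-- The divergence of the plane, shifted by a multiple of a generalised vector field. -/
def dorfmanDiv (f : A) (a : Fin 4 → A) : A := D 0 (a 0) + D 1 (a 1) - f * (a 0 + a 2)

theorem dorfmanDiv_add (f : A) (a b : Fin 4 → A) :
    dorfmanDiv D f (a + b) = dorfmanDiv D f a + dorfmanDiv D f b := by
  simp only [dorfmanDiv, Pi.add_apply, map_add]; ring

theorem dorfmanDiv_smul (f : A) (r : ℝ) (a : Fin 4 → A) :
    dorfmanDiv D f (r • a) = r • dorfmanDiv D f a := by
  simp only [dorfmanDiv, Pi.smul_apply, Derivation.map_smul]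
  simp only [Algebra.smul_def]
  ring

theorem dorfmanDiv_mul (f h : A) (a : Fin 4 → A) :
    dorfmanDiv D f (fun k => h * a k) =
      h * dorfmanDiv D f a + (a 0 * D 0 h + a 1 * D 1 h) := by
  simp only [dorfmanDiv, Derivation.leibniz, smul_eq_mul]; ring

end Dorfman

section Plane

/-- The plane `ℝ²`. -/
abbrev Plane := EuclideanSpace ℝ (Fin 2)

/-- Sections of the trivial bundle of rank four over the plane. -/
abbrev PlaneSec := Sec 2 (EuclideanSpace ℝ (Fin 4))
  (Bundle.Trivial Plane (EuclideanSpace ℝ (Fin 4)))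

theorem contMDiff_trivial_iff
    {s : ∀ x : Plane, Bundle.Trivial Plane (EuclideanSpace ℝ (Fin 4)) x} :
    ContMDiff (𝓡 2) ((𝓡 2).prod 𝓘(ℝ, EuclideanSpace ℝ (Fin 4))) ∞
      (fun x => TotalSpace.mk' (EuclideanSpace ℝ (Fin 4)) x (s x)) ↔
    ContDiff ℝ ∞ (fun x => (s x : EuclideanSpace ℝ (Fin 4))) := by
  rw [← contMDiff_iff_contDiff]
  refine forall_congr' fun x => ?_
  rw [Bundle.contMDiffAt_section]
  rfl

/-- The components of a section. -/
def PlaneSec.comp (a : PlaneSec) (k : Fin 4) : Fun 2 Plane :=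
  ⟨fun x => (a x : EuclideanSpace ℝ (Fin 4)) k,
    (contDiff_euclidean.1 (contMDiff_trivial_iff.1 a.contMDiff) k).contMDiff⟩

/-- The section with given components. -/
def PlaneSec.mk (f : Fin 4 → Fun 2 Plane) : PlaneSec :=
  ⟨fun x => WithLp.toLp 2 fun k => f k x, contMDiff_trivial_iff.2
    (contDiff_euclidean.2 fun k => (f k).contMDiff.contDiff)⟩

theorem PlaneSec.ext_comp {a b : PlaneSec} (h : a.comp = b.comp) : a = b := by
  ext x : 1
  ext k
  exact congrArg (fun f : Fin 4 → Fun 2 Plane => f k x) h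

theorem Plane.fun_differentiableAt (f : Fun 2 Plane) (x : Plane) : DifferentiableAt ℝ f x :=
  f.contMDiff.contDiff.differentiable (by simp) x

/-- The partial derivatives on the plane. -/
def Plane.pd (i : Fin 2) : Derivation ℝ (Fun 2 Plane) (Fun 2 Plane) :=
  Derivation.mk'
    { toFun f := ⟨fun x => fderiv ℝ f x (EuclideanSpace.single i 1), (ContDiff.contMDiff
        ((f.contMDiff.contDiff.fderiv_right (m := ∞) (by simp)).clm_apply contDiff_const))⟩
      map_add' f g := by
        ext x
        change fderiv ℝ (fun y => f y + g y) x _ = fderiv ℝ f x _ + fderiv ℝ g x _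
        rw [fderiv_fun_add (Plane.fun_differentiableAt f x) (Plane.fun_differentiableAt g x)]; rfl
      map_smul' r f := by
        ext x
        change fderiv ℝ (r • ⇑f) x _ = r * fderiv ℝ f x _
        rw [fderiv_const_smul (Plane.fun_differentiableAt f x)]; rfl }
    fun f g => by
      ext x
      change fderiv ℝ (⇑f * ⇑g) x _ = f x * fderiv ℝ g x _ + g x * fderiv ℝ f x _
      rw [fderiv_mul (Plane.fun_differentiableAt f x) (Plane.fun_differentiableAt g x)]; rfl

theorem Plane.pd_apply (i : Fin 2) (f : Fun 2 Plane) (x : Plane) :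
    Plane.pd i f x = fderiv ℝ f x (EuclideanSpace.single i 1) := rfl

theorem Plane.fderiv_eq (f : Fun 2 Plane) (x u : Plane) :
    fderiv ℝ f x u = u 0 * Plane.pd 0 f x + u 1 * Plane.pd 1 f x := by
  have h : u = u 0 • EuclideanSpace.single 0 1 + u 1 • EuclideanSpace.single 1 1 := by
    ext k; fin_cases k <;> simp
  conv_lhs => rw [h]
  simp only [map_add, map_smul, smul_eq_mul, Plane.pd_apply]

theorem Plane.mvfderiv_eq (f : Fun 2 Plane) (x u : Plane) :
    mvfderiv (𝓡 2) f x u = u 0 * Plane.pd 0 f x + u 1 * Plane.pd 1 f x := by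
  rw [← Plane.fderiv_eq]
  have := mfderiv_eq_fderiv (𝕜 := ℝ) (f := (f : Plane → ℝ)) (x := x)
  unfold mvfderiv
  rw [this]
  rfl

theorem Plane.pd_comm (f : Fun 2 Plane) :
    Plane.pd 1 (Plane.pd 0 f) = Plane.pd 0 (Plane.pd 1 f) := by
  ext x
  have h : ∀ i j : Fin 2, Plane.pd i (Plane.pd j f) x =
      fderiv ℝ (fderiv ℝ f) x (EuclideanSpace.single i 1) (EuclideanSpace.single j 1) := by
    intro i j
    change fderiv ℝ (fun y => fderiv ℝ f y (EuclideanSpace.single j 1)) x _ = _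
    have h1 : DifferentiableAt ℝ (fderiv ℝ f) x :=
      (f.contMDiff.contDiff.fderiv_right (m := ∞) (by simp)).differentiable (by simp) x
    rw [fderiv_clm_apply h1 (differentiableAt_const _)]
    simp
  rw [h, h]
  exact (f.contMDiff.contDiff.contDiffAt (x := x)).isSymmSndFDerivAt (by
    rw [minSmoothness_of_isRCLikeNormedField]; exact ENat.LEInfty.out) _ _

namespace Plane

/-- The Dorfman bracket of sections. -/
def bracketSec (a b : PlaneSec) : PlaneSec := PlaneSec.mk (dorfman pd a.comp b.comp)

/-- The standard scalar product on `ℝ² ⊕ (ℝ²)^*`. -/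
def stdPairing : LinearMap.BilinForm ℝ (EuclideanSpace ℝ (Fin 4)) :=
  LinearMap.mk₂ ℝ (fun u v => u 0 * v 2 + u 2 * v 0 + u 1 * v 3 + u 3 * v 1)
    (fun u u' v => by simp only [PiLp.add_apply]; ring)
    (fun r u v => by simp only [PiLp.smul_apply, smul_eq_mul]; ring)
    (fun u v v' => by simp only [PiLp.add_apply]; ring)
    (fun r u v => by simp only [PiLp.smul_apply, smul_eq_mul]; ring)

theorem stdPairing_apply (u v : EuclideanSpace ℝ (Fin 4)) :
    stdPairing u v = u 0 * v 2 + u 2 * v 0 + u 1 * v 3 + u 3 * v 1 := rfl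

/-- The projection `ℝ² ⊕ (ℝ²)^* → ℝ²`. -/
def stdAnchor : EuclideanSpace ℝ (Fin 4) →ₗ[ℝ] Plane where
  toFun u := !₂[u 0, u 1]
  map_add' u v := by ext k; fin_cases k <;> simp
  map_smul' r u := by ext k; fin_cases k <;> simp

/-- The interchange of the summands of `ℝ² ⊕ (ℝ²)^*`. -/
def stdSwap : EuclideanSpace ℝ (Fin 4) →ₗ[ℝ] EuclideanSpace ℝ (Fin 4) where
  toFun u := !₂[u 2, u 3, u 0, u 1]
  map_add' u v := by ext k; fin_cases k <;> simp
  map_smul' r u := by ext k; fin_cases k <;> simp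

theorem fderiv_coord {W : Plane → Plane} {x : Plane} (h : DifferentiableAt ℝ W x) (u : Plane)
    (k : Fin 2) : fderiv ℝ W x u k = fderiv ℝ (fun y => W y k) x u := by
  have := ((EuclideanSpace.proj k : Plane →L[ℝ] ℝ).hasFDerivAt.comp x h.hasFDerivAt).fderiv
  exact (congrArg (fun L : Plane →L[ℝ] ℝ => L u) this).symm

theorem contDiff_stdAnchor (a : PlaneSec) :
    ContDiff ℝ ∞ (fun y => stdAnchor (a y : EuclideanSpace ℝ (Fin 4))) :=
  contDiff_euclidean.2 fun k => by
    fin_cases k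
    · exact (PlaneSec.comp a 0).contMDiff.contDiff
    · exact (PlaneSec.comp a 1).contMDiff.contDiff

theorem plane_ext {X Y : Plane} (h0 : X 0 = Y 0) (h1 : X 1 = Y 1) : X = Y := by
  ext k; fin_cases k
  · exact h0
  · exact h1

theorem mlieBracket_eq (V W : ∀ x : Plane, TM 2 x) (x : Plane) :
    VectorField.mlieBracket (𝓡 2) V W x =
      VectorField.lieBracket ℝ (V : Plane → Plane) (W : Plane → Plane) x := by
  rw [← VectorField.mlieBracketWithin_univ, VectorField.mlieBracketWithin_eq_lieBracketWithin]
  exact congrFun VectorField.lieBracketWithin_univ x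

theorem anchor_bracketSec (a b : PlaneSec) (x : Plane) :
    (stdAnchor (bracketSec a b x) : TM 2 x) = VectorField.mlieBracket (𝓡 2)
      (fun y => (stdAnchor (a y : EuclideanSpace ℝ (Fin 4)) : TM 2 y))
      (fun y => (stdAnchor (b y : EuclideanSpace ℝ (Fin 4)) : TM 2 y)) x := by
  have h1 : ∀ (a b : PlaneSec) (x : Plane) (k : Fin 4) (i : Fin 2),
      (∀ y : Plane, stdAnchor (b y : EuclideanSpace ℝ (Fin 4)) i = PlaneSec.comp b k y) →
      fderiv ℝ (fun y : Plane => stdAnchor (b y : EuclideanSpace ℝ (Fin 4))) x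
        (stdAnchor (a x : EuclideanSpace ℝ (Fin 4))) i =
      PlaneSec.comp a 0 x * pd 0 (PlaneSec.comp b k) x +
        PlaneSec.comp a 1 x * pd 1 (PlaneSec.comp b k) x := fun a b x k i h => by
    rw [fderiv_coord ((contDiff_stdAnchor b).differentiable (by simp) x), funext h]
    exact fderiv_eq _ _ _
  refine Eq.trans ?_ (mlieBracket_eq _ _ x).symm
  refine plane_ext ?_ ?_
  · exact (congrArg₂ (· - ·) (h1 a b x 0 0 fun y => rfl) (h1 b a x 0 0 fun y => rfl)).symm
  · exact (congrArg₂ (· - ·) (h1 a b x 1 1 fun y => rfl) (h1 b a x 1 1 fun y => rfl)).symm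

/-- The standard Courant algebroid over the plane. -/
def courant : CourantAlgebroid 2 (EuclideanSpace ℝ (Fin 4))
    (Bundle.Trivial Plane (EuclideanSpace ℝ (Fin 4))) where
  pairing _ := stdPairing
  pairing_symm x u v := by rw [stdPairing_apply, stdPairing_apply]; ring
  pairing_nondeg x u h := by
    have h' := fun k => h (EuclideanSpace.single k 1)
    simp only [stdPairing_apply] at h'
    have h0 := h' 0
    have h1 := h' 1
    have h2 := h' 2
    have h3 := h' 3
    simp at h0 h1 h2 h3
    ext k
    fin_cases k <;> simp [h0, h1, h2, h3]
  pairing_smooth a b := (dorfmanPair (PlaneSec.comp a) (PlaneSec.comp b)).contMDiff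
  anchor _ := stdAnchor
  anchor_smooth a := contMDiff_vectorSpace_iff_contDiff.2 (contDiff_stdAnchor a)
  bracket := LinearMap.mk₂ ℝ bracketSec
    (fun a a' b => PlaneSec.ext_comp (dorfman_add_left (PlaneSec.comp a) (PlaneSec.comp a')
      (PlaneSec.comp b)))
    (fun r a b => PlaneSec.ext_comp (dorfman_smul_left r (PlaneSec.comp a) (PlaneSec.comp b)))
    (fun a b b' => PlaneSec.ext_comp (dorfman_add_right (PlaneSec.comp a) (PlaneSec.comp b)
      (PlaneSec.comp b')))
    (fun r a b => PlaneSec.ext_comp (dorfman_smul_right r (PlaneSec.comp a) (PlaneSec.comp b)))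
  jacobi a b c := PlaneSec.ext_comp (dorfman_jacobi pd_comm (PlaneSec.comp a) (PlaneSec.comp b)
    (PlaneSec.comp c))
  anchor_bracket := anchor_bracketSec
  bracket_fsmul a b f x := by
    ext k
    exact (congrArg (fun g : Fun 2 Plane => g x)
      (dorfman_mul_right (PlaneSec.comp a) (PlaneSec.comp b) f k)).trans
      (congrArg (fun t : ℝ => t * PlaneSec.comp b k x + f x * PlaneSec.comp (bracketSec a b) k x)
        (mvfderiv_eq f x (stdAnchor (a x))).symm)
  bracket_pairing a b c x :=
    (mvfderiv_eq (dorfmanPair (PlaneSec.comp b) (PlaneSec.comp c)) x (stdAnchor (a x))).trans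
      (congrArg (fun g : Fun 2 Plane => g x)
        (dorfmanPair_dorfman (PlaneSec.comp a) (PlaneSec.comp b) (PlaneSec.comp c)))
  bracket_self a b x := (two_mul _).trans <|
    (congrArg (fun g : Fun 2 Plane => g x)
      (dorfmanPair_dorfman_self (D := pd) (PlaneSec.comp a) (PlaneSec.comp b))).trans
    (mvfderiv_eq (dorfmanPair (PlaneSec.comp a) (PlaneSec.comp a)) x (stdAnchor (b x))).symm

theorem isExact_courant : courant.IsExact where
  surjective x (X : Plane) :=
    ⟨(!₂[X 0, X 1, 0, 0] : EuclideanSpace ℝ (Fin 4)), plane_ext rfl rfl⟩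
  ker_eq x u := by
    constructor
    · intro h
      refine ⟨(u 2 : ℝ) • (EuclideanSpace.proj 0 : Plane →L[ℝ] ℝ).toLinearMap +
        (u 3 : ℝ) • (EuclideanSpace.proj 1 : Plane →L[ℝ] ℝ).toLinearMap, fun v => ?_⟩
      have h0 : u 0 = 0 := congrArg (fun X : Plane => X 0) h
      have h1 : u 1 = 0 := congrArg (fun X : Plane => X 1) h
      change u 0 * v 2 + u 2 * v 0 + u 1 * v 3 + u 3 * v 1 = u 2 * v 0 + u 3 * v 1
      rw [h0, h1]; ring
    · rintro ⟨ξ, h⟩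
      have h' : ∀ v : EuclideanSpace ℝ (Fin 4), stdAnchor v = 0 →
          u 0 * v 2 + u 2 * v 0 + u 1 * v 3 + u 3 * v 1 = 0 := fun v hv =>
        (h v).trans ((congrArg ξ hv).trans (map_zero ξ))
      have h0 := h' (EuclideanSpace.single 2 1) (by ext k; fin_cases k <;> simp [stdAnchor])
      have h1 := h' (EuclideanSpace.single 3 1) (by ext k; fin_cases k <;> simp [stdAnchor])
      simp at h0 h1
      exact plane_ext h0 h1

theorem contMDiff_stdSwap (a : PlaneSec) :
    ContMDiff (𝓡 2) ((𝓡 2).prod 𝓘(ℝ, EuclideanSpace ℝ (Fin 4))) ∞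
      (fun x : Plane => TotalSpace.mk' (E := Bundle.Trivial Plane (EuclideanSpace ℝ (Fin 4)))
        (EuclideanSpace ℝ (Fin 4)) x (stdSwap (a x : EuclideanSpace ℝ (Fin 4)))) :=
  (PlaneSec.mk ![PlaneSec.comp a 2, PlaneSec.comp a 3, PlaneSec.comp a 0,
    PlaneSec.comp a 1]).contMDiff.congr fun x => by
      congr 1; ext k; fin_cases k <;> rfl

/-- The generalised metric of the Euclidean plane. -/
def metric : courant.GenMetric where
  endo _ := stdSwap
  endo_smooth := contMDiff_stdSwap
  endo_endo x u := by ext k; fin_cases k <;> rfl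
  endo_symm x u v := by
    change u 2 * v 2 + u 0 * v 0 + u 3 * v 3 + u 1 * v 1 =
      u 0 * v 0 + u 2 * v 2 + u 1 * v 1 + u 3 * v 3
    ring
  nondeg_ker x u hu h := by
    have h0 : u 0 = 0 := congrArg (fun X : Plane => X 0) hu
    have h1 : u 1 = 0 := congrArg (fun X : Plane => X 1) hu
    have h2 : u 2 * u 2 + u 0 * u 0 + u 3 * u 3 + u 1 * u 1 = 0 := h u hu
    rw [h0, h1] at h2
    ext k
    fin_cases k
    · exact h0
    · exact h1
    · change u 2 = 0; nlinarith
    · change u 3 = 0; nlinarith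

theorem metric_form (x : Plane) (u v : EuclideanSpace ℝ (Fin 4)) :
    metric.form x u v = u 2 * v 2 + u 0 * v 0 + u 3 * v 3 + u 1 * v 1 := rfl

/-- The divergence operator of the Euclidean plane, shifted by the section `f (dx⁰ + ∂₀)`. -/
def shiftedDiv (f : Fun 2 Plane) : courant.Divergence where
  toFun :=
    { toFun a := dorfmanDiv pd f (PlaneSec.comp a)
      map_add' a b := dorfmanDiv_add f (PlaneSec.comp a) (PlaneSec.comp b)
      map_smul' r a := dorfmanDiv_smul f r (PlaneSec.comp a) }
  leibniz h a x :=
    (congrArg (fun g : Fun 2 Plane => g x) (dorfmanDiv_mul f h (PlaneSec.comp a))).trans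
      (congrArg (fun t : ℝ => h x * dorfmanDiv pd f (PlaneSec.comp a) x + t)
        (mvfderiv_eq h x (courant.anchor x (a x))).symm)

/-! ### The plane with shifted divergence, evaluated on constant sections -/

/-- The constant sections. -/
def const (u : EuclideanSpace ℝ (Fin 4)) : PlaneSec :=
  ⟨fun _ => u, contMDiff_trivial_iff.2 contDiff_const⟩

theorem pd_const (i : Fin 2) (u : EuclideanSpace ℝ (Fin 4)) (k : Fin 4) :
    pd i (PlaneSec.comp (const u) k) = 0 := by
  ext x
  change fderiv ℝ (fun _ => u k) x _ = 0
  rw [fderiv_const_apply]; rfl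

theorem bracket_const (u v : EuclideanSpace ℝ (Fin 4)) :
    courant.bracket (const u) (const v) = 0 := by
  refine PlaneSec.ext_comp ?_
  change dorfman pd _ _ = _
  funext k
  fin_cases k <;> simp [dorfman, pd_const] <;> rfl

open CourantAlgebroid

theorem projSec_const (ε : ℝ) (u : EuclideanSpace ℝ (Fin 4)) :
    metric.projSec ε (const u) = const ((1 / 2 : ℝ) • (u + ε • stdSwap u)) := rfl

theorem lift_anchor (x : Plane) (u : EuclideanSpace ℝ (Fin 4)) :
    metric.lift isExact_courant x (courant.anchor x u) =
      (!₂[u 0, u 1, 0, 0] : EuclideanSpace ℝ (Fin 4)) :=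
  (metric.eq_lift isExact_courant (x := x)
    (v := (!₂[u 0, u 1, 0, 0] : EuclideanSpace ℝ (Fin 4))) (plane_ext rfl rfl)).symm

theorem reflSec_const (u : EuclideanSpace ℝ (Fin 4)) : ∃ v : EuclideanSpace ℝ (Fin 4),
    metric.reflSec isExact_courant (const u) = const v := by
  refine ⟨(2 : ℝ) • !₂[u 0, u 1, 0, 0] - u, ?_⟩
  ext x : 1
  rw [GenMetric.reflSec_apply, GenMetric.refl_apply]
  exact congrArg (fun t : EuclideanSpace ℝ (Fin 4) => (2 : ℝ) • t - u) (lift_anchor x u)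

theorem mixed_const (ε : ℝ) (u v : EuclideanSpace ℝ (Fin 4)) :
    metric.mixed ε (const u) (const v) = 0 := by
  rw [GenMetric.mixed, projSec_const, projSec_const, bracket_const]
  ext x : 1
  simp

theorem partConn_const (ε : ℝ) (u v : EuclideanSpace ℝ (Fin 4)) :
    metric.partConn isExact_courant ε (const u) (const v) = 0 := by
  obtain ⟨u', hu⟩ := reflSec_const u
  obtain ⟨v', hv⟩ := reflSec_const v
  rw [GenMetric.partConn, hu, hv, mixed_const, mixed_const, mixed_const]
  ext x : 1
  simp

/-- Reflection and projections map constant sections to constant sections, whose brackets vanish; so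
`D⁰` is the flat derivative. -/
theorem zeroConn_const (v u : EuclideanSpace ℝ (Fin 4)) (x : Plane) :
    (metric.zeroConn isExact_courant).toFun (const v) x u = 0 := by
  have := metric.zeroConn_apply isExact_courant (const u) (const v) x
  rw [GenMetric.zeroSec, partConn_const, partConn_const, add_zero] at this
  exact this

/-- The vector `∂₀ + dx⁰`. -/
def normal : EuclideanSpace ℝ (Fin 4) := !₂[1, 0, 1, 0]

/-- The vector `∂₁ + dx¹`. -/
def tangent : EuclideanSpace ℝ (Fin 4) := !₂[0, 1, 0, 1]

/-- On constant sections `D⁰` is trace-free and the shifted divergence is `-f ⟨normal, ·⟩`; the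
factor `(1 - d)⁻¹ = -1` removes the sign. -/
theorem divVec_eq (f : Fun 2 Plane) (x : Plane) :
    (metric.zeroConn isExact_courant).divVec (shiftedDiv f) x = f x • normal := by
  refine sub_eq_zero.1 (courant.pairing_nondeg x _ fun v => ?_)
  rw [map_sub, LinearMap.sub_apply, sub_eq_zero]
  have h := (metric.zeroConn isExact_courant).pairing_divVec (shiftedDiv f) (const v) x
  have h0 : (metric.zeroConn isExact_courant).toFun (const v) x = 0 :=
    LinearMap.ext fun u => zeroConn_const v u x
  rw [h0, map_zero] at h
  refine h.trans ?_
  have h1 : (shiftedDiv f).toFun (const v) = -(f * (PlaneSec.comp (const v) 0 +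
      PlaneSec.comp (const v) 2)) := by
    change pd 0 _ + pd 1 _ - _ = _
    rw [pd_const, pd_const]; ring
  rw [h1]
  change (1 - 2 : ℝ)⁻¹ * (-(f x * (v 0 + v 2)) - 0) = (f x * 1) * v 2 + (f x * 1) * v 0 +
    (f x * 0) * v 3 + (f x * 0) * v 1
  ring

/-- The canonical connection of the shifted divergence, at constant sections and up to a
function. -/
def weylNormal : EuclideanSpace ℝ (Fin 4) →ₗ[ℝ] EuclideanSpace ℝ (Fin 4) →ₗ[ℝ]
    EuclideanSpace ℝ (Fin 4) := metric.weyl 0 normal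

theorem weylNormal_apply (u v : EuclideanSpace ℝ (Fin 4)) : weylNormal u v = (1 / 2 : ℝ) •
    (stdPairing u v • normal + stdPairing (stdSwap u) v • stdSwap normal -
      stdPairing normal v • u - stdPairing (stdSwap normal) v • stdSwap u) := rfl

variable (f : Fun 2 Plane)

/-- The canonical connection of the shifted divergence. -/
def conn : courant.GenConnection := metric.canonConn isExact_courant (shiftedDiv f)

theorem conn_const (u v : EuclideanSpace ℝ (Fin 4)) (x : Plane) :
    (conn f).toFun (const v) x u = f x • weylNormal u v := by
  rw [conn, GenMetric.canonConn, GenConnection.addWeyl_apply, zeroConn_const, divVec_eq, zero_add]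
  have h : ∀ (r : ℝ) (e : EuclideanSpace ℝ (Fin 4)),
      metric.weyl x (r • e) u v = r • metric.weyl x e u v := fun r e => by
    simp only [metric.weyl_apply, map_smul, LinearMap.smul_apply, smul_eq_mul]
    module
  exact h _ _

theorem deriv_const (u v : EuclideanSpace ℝ (Fin 4)) :
    (conn f).deriv (const u) (const v) = fsmul f (const (weylNormal u v)) := by
  ext x : 1
  exact conn_const f u v x

variable {f} {x : Plane} (hf : f x = 0)

include hf in
-- At a zero of `f` the terms quadratic in the connection carry a factor `f` and vanish, and only
-- the derivative of `f` remains.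
theorem curv_const (u v w : EuclideanSpace ℝ (Fin 4)) :
    (conn f).curv (const u) (const v) (const w) x =
      (u 0 * pd 0 f x + u 1 * pd 1 f x) • weylNormal v w -
        (v 0 * pd 0 f x + v 1 * pd 1 f x) • weylNormal u w := by
  rw [GenConnection.curv, bracket_const, deriv_const, deriv_const, (conn f).leibniz',
    (conn f).leibniz', conn_const, conn_const, hf]
  have h1 := mvfderiv_eq f x (stdAnchor u)
  have h2 := mvfderiv_eq f x (stdAnchor v)
  refine Eq.trans ?_ (congrArg₂ (fun r s : ℝ => r • weylNormal v w - s • weylNormal u w) h1 h2)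
  simp
  rfl

include hf in
theorem rm_const (a b v w : EuclideanSpace ℝ (Fin 4)) :
    (conn f).rm (const a) (const b) (const v) (const w) x = 1 / 2 *
      (stdPairing a ((v 0 * pd 0 f x + v 1 * pd 1 f x) • weylNormal w b -
        (w 0 * pd 0 f x + w 1 * pd 1 f x) • weylNormal v b) +
      stdPairing w ((b 0 * pd 0 f x + b 1 * pd 1 f x) • weylNormal a v -
        (a 0 * pd 0 f x + a 1 * pd 1 f x) • weylNormal b v)) := by
  have h : (conn f).toFun (const v) x = 0 := LinearMap.ext fun u => by
    rw [conn_const, hf, zero_smul]; rfl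
  have h2 := courant.dualInner_smul_left x 0 0 ((courant.pairing x).flip (const a x) ∘ₗ
    (conn f).toFun (const b) x)
  rw [zero_smul, zero_mul] at h2
  rw [GenConnection.rm_eq, curv_const hf, curv_const hf, h, LinearMap.comp_zero, h2, add_zero]
  rfl

include hf in
theorem rm_const_eq_zero (h0 : pd 0 f x = 0) (h1 : pd 1 f x = 0)
    (a b v w : EuclideanSpace ℝ (Fin 4)) :
    (conn f).rm (const a) (const b) (const v) (const w) x = 0 := by
  rw [rm_const hf, h0, h1]
  simp

include hf in
theorem rm_normal_tangent :
    (conn f).rm (const normal) (const tangent) (const normal) (const tangent) x =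
      4 * pd 0 f x := by
  rw [rm_const hf]
  simp only [weylNormal_apply, stdPairing_apply]
  simp [normal, tangent, stdSwap]
  ring

/-- The standard basis of the fibre. -/
def fibreBasis : Module.Basis (Fin 4) ℝ (Bundle.Trivial Plane (EuclideanSpace ℝ (Fin 4)) x) :=
  PiLp.basisFun 2 ℝ (Fin 4)

/-- The standard basis is orthonormal for this positive definite `𝒢`. Hence the scalar vanishes only
where all of `ℛm` does, and a single nonzero component suffices. -/
theorem kretschmann_eq_sum (D : courant.GenConnection) (x : Plane) :
    D.kretschmann metric x = ∑ I : Fin 4 → Fin 4,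
      D.rmAt x (fun k => fibreBasis (x := x) (I k)) ^ 2 := by
  have h : ∀ i, dualVec (fibreBasis (x := x)) (metric.form x) i = fibreBasis i := fun i => by
    refine dualVec_eq_of_apply _ (metric.form_nondeg x) fun j => ?_
    change metric.form x (PiLp.basisFun 2 ℝ (Fin 4) i) (PiLp.basisFun 2 ℝ (Fin 4) j) = _
    rw [metric_form]
    fin_cases i <;> fin_cases j <;> simp
  rw [← D.contraction_rmAt metric x (fibreBasis (x := x))]
  refine (contraction_eq_sum _ _ (D.rmMulti x)).trans ?_
  refine Finset.sum_congr rfl fun I _ => ?_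
  simp only [h, sq]
  rfl

include hf in
theorem kretschmann_eq_zero (h0 : pd 0 f x = 0) (h1 : pd 1 f x = 0) :
    (conn f).kretschmann metric x = 0 := by
  rw [kretschmann_eq_sum]
  refine Finset.sum_eq_zero fun I _ => ?_
  have := (conn f).rm_eq_rmAt (const (fibreBasis (x := x) (I 0)))
    (const (fibreBasis (x := x) (I 1))) (const (fibreBasis (x := x) (I 2)))
    (const (fibreBasis (x := x) (I 3))) x
  rw [rm_const_eq_zero hf h0 h1] at this
  rw [sq_eq_zero_iff]
  refine Eq.trans (congrArg _ ?_) this.symm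
  funext k
  fin_cases k <;> rfl

theorem multilinear_eq_zero {V : Type*} [AddCommGroup V] [Module ℝ V] {ι : Type*} [Finite ι]
    (b : Module.Basis ι ℝ V) {n : ℕ} (m : MultilinearMap ℝ (fun _ : Fin n => V) ℝ)
    (h : ∀ I : Fin n → ι, m (fun k => b (I k)) = 0) (u : Fin n → V) : m u = 0 := by
  have : m = 0 := Module.Basis.ext_multilinear (fun _ => b) fun I => h I
  rw [this]
  rfl

include hf in
theorem kretschmann_ne_zero (h0 : pd 0 f x ≠ 0) : (conn f).kretschmann metric x ≠ 0 := by
  rw [kretschmann_eq_sum]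
  intro h
  rw [Finset.sum_eq_zero_iff_of_nonneg fun _ _ => sq_nonneg _] at h
  have h' : ∀ I : Fin 4 → Fin 4, (conn f).rmAt x (fun k => fibreBasis (x := x) (I k)) = 0 :=
    fun I => pow_eq_zero_iff two_ne_zero |>.1 (h I (Finset.mem_univ I))
  have h2 : ∀ u, (conn f).rmAt x u = 0 := multilinear_eq_zero fibreBasis ((conn f).rmMulti x) h'
  have h3 := (conn f).rm_eq_rmAt (const normal) (const tangent) (const normal) (const tangent) x
  rw [rm_normal_tangent hf, h2] at h3
  exact h0 (by linarith)

/-- The first coordinate. -/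
def coord : Fun 2 Plane :=
  ⟨fun x => x 0, (contDiff_euclidean.1 contDiff_id 0).contMDiff⟩

theorem pd_coord (i : Fin 2) : pd i coord = if i = 0 then 1 else 0 := by
  ext x
  change fderiv ℝ (fun y : Plane => id y 0) x _ = _
  rw [← fderiv_coord differentiableAt_id, fderiv_id]
  fin_cases i <;> simp

theorem exists_kretschmann_ne : ∃ (f : Fun 2 Plane) (x y : Plane),
    (conn f).kretschmann metric x ≠ (conn f).kretschmann metric y := by
  have h0 : pd 0 (coord * coord * coord - coord * coord) =
      coord * coord + coord * coord + coord * coord - (coord + coord) := by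
    rw [map_sub, Derivation.leibniz, Derivation.leibniz, pd_coord, if_pos rfl]
    simp only [smul_eq_mul]; ring
  have h1 : pd 1 (coord * coord * coord - coord * coord) = 0 := by
    rw [map_sub, Derivation.leibniz, Derivation.leibniz, pd_coord, if_neg one_ne_zero]
    simp
  -- With `t` the first coordinate, `t³ - t²` has a double zero at `t = 0` and a simple zero at `t =
  -- 1`. So `f` vanishes at both points, while `∂₀ f` is 0 at the first and 1 at the second.
  refine ⟨coord * coord * coord - coord * coord, 0, EuclideanSpace.single 0 1, ?_⟩
  rw [kretschmann_eq_zero]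
  · refine (kretschmann_ne_zero ?_ ?_).symm
    · change (EuclideanSpace.single 0 1 : Plane) 0 * (EuclideanSpace.single 0 1 : Plane) 0 *
        (EuclideanSpace.single 0 1 : Plane) 0 - (EuclideanSpace.single 0 1 : Plane) 0 *
        (EuclideanSpace.single 0 1 : Plane) 0 = (0 : ℝ)
      simp
    · rw [h0]
      change (EuclideanSpace.single 0 1 : Plane) 0 * (EuclideanSpace.single 0 1 : Plane) 0 +
        (EuclideanSpace.single 0 1 : Plane) 0 * (EuclideanSpace.single 0 1 : Plane) 0 +
        (EuclideanSpace.single 0 1 : Plane) 0 * (EuclideanSpace.single 0 1 : Plane) 0 -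
        ((EuclideanSpace.single 0 1 : Plane) 0 + (EuclideanSpace.single 0 1 : Plane) 0) ≠ (0 : ℝ)
      norm_num
  · change (0 : ℝ) * 0 * 0 - 0 * 0 = 0
    norm_num
  · rw [h0]
    change (0 : ℝ) * 0 + 0 * 0 + 0 * 0 - (0 + 0) = 0
    norm_num
  · rw [h1]; rfl

end Plane

end Plane

end GenGeom
end

/-! ### The main theorem -/

open GenGeom CourantAlgebroid in
theorem mainTheorem7
    {d : ℕ} (hd : 2 ≤ d)
    {M : Type*} [TopologicalSpace M] [ChartedSpace (EuclideanSpace ℝ (Fin d)) M]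
    [IsManifold (𝓡 d) ∞ M] [T2Space M] [SigmaCompactSpace M]
    {F : Type*} [NormedAddCommGroup F] [NormedSpace ℝ F] [FiniteDimensional ℝ F]
    {E : M → Type*} [∀ x, AddCommGroup (E x)] [∀ x, Module ℝ (E x)]
    [∀ x, TopologicalSpace (E x)] [TopologicalSpace (TotalSpace F E)]
    [FiberBundle F E] [VectorBundle ℝ F E] [ContMDiffVectorBundle ∞ F E (𝓡 d)]
    (C : CourantAlgebroid d F E) (hC : C.IsExact) (G : C.GenMetric) (dv : C.Divergence) :
    -- the canonical connection `D` exists and is unique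
    (∃! D : C.GenConnection, D.IsCanonical G dv) ∧
    -- its generalised Riemann tensor is a tensor, and its contraction is independent of the frame
    (∀ D : C.GenConnection, D.IsCanonical G dv →
      (∀ (a b v w : Sec d F E) (x : M), D.rm a b v w x = D.rmAt x ![a x, b x, v x, w x]) ∧
      ∀ (x : M) (ι : Type) [Fintype ι] [DecidableEq ι] (b : Module.Basis ι ℝ (E x)),
        contraction b (G.form x) 4 (D.rmAt x) (D.rmAt x) = D.kretschmann G x) ∧
    -- invariance under isomorphisms
    (∀ {M' : Type*} [TopologicalSpace M'] [ChartedSpace (EuclideanSpace ℝ (Fin d)) M']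
      [IsManifold (𝓡 d) ∞ M'] [T2Space M'] [SigmaCompactSpace M']
      {F' : Type*} [NormedAddCommGroup F'] [NormedSpace ℝ F'] [FiniteDimensional ℝ F']
      {E' : M' → Type*} [∀ x, AddCommGroup (E' x)] [∀ x, Module ℝ (E' x)]
      [∀ x, TopologicalSpace (E' x)] [TopologicalSpace (TotalSpace F' E')]
      [FiberBundle F' E'] [VectorBundle ℝ F' E'] [ContMDiffVectorBundle ∞ F' E' (𝓡 d)]
      (C' : CourantAlgebroid d F' E') (_ : C'.IsExact) (G' : C'.GenMetric) (dv' : C'.Divergence)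
      (Φ : BundleIso d F E F' E'), Φ.IsCourantIso C C' → Φ.MapsPair G dv G' dv' →
      ∀ (D : C.GenConnection) (D' : C'.GenConnection),
        D.IsCanonical G dv → D'.IsCanonical G' dv' →
        ∀ x, D'.kretschmann G' (Φ.base x) = D.kretschmann G x) ∧
    -- the value for `H = 0` and `e = 0`
    (∀ D : C.GenConnection, D.IsCanonical G dv →
      ∀ Q : InducedGeometry C G, Q.H = 0 → Q.IsMetricDivergence dv →
        ∀ x, D.kretschmann G x = 4 * Q.nabla.riemNormSq Q.g x) ∧
    -- non-triviality
    (∃ (C₀ : CourantAlgebroid 2 (EuclideanSpace ℝ (Fin 4))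
        (Bundle.Trivial (EuclideanSpace ℝ (Fin 2)) (EuclideanSpace ℝ (Fin 4))))
      (G₀ : C₀.GenMetric) (dv₀ : C₀.Divergence) (D₀ : C₀.GenConnection),
      C₀.IsExact ∧ D₀.IsCanonical G₀ dv₀ ∧
        ∃ x y, D₀.kretschmann G₀ x ≠ D₀.kretschmann G₀ y) := by
  refine ⟨exists_unique_isCanonical hC hd G dv, fun D _ => ⟨D.rm_eq_rmAt, fun x ι _ _ b =>
    D.contraction_rmAt G x b⟩, ?_, ?_, ?_⟩
  · intro M' _ _ _ _ _ F' _ _ _ E' _ _ _ _ _ _ _ C' hC' G' dv' Φ hΦ h D D' hD hD' x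
    obtain rfl := hD.eq_canonConn hC hd
    obtain rfl := hD'.eq_canonConn hC' hd
    exact hΦ.kretschmann (fun a a' ha => h.canonConn hΦ hC hC' ha) h.metric x
  · exact fun D hD Q hQ hdv x => hD.kretschmann_eq hC hd hQ hdv x
  · obtain ⟨f, x, y, h⟩ := Plane.exists_kretschmann_ne
    exact ⟨Plane.courant, Plane.metric, Plane.shiftedDiv f, Plane.conn f, Plane.isExact_courant,
      GenMetric.canonConn_isCanonical Plane.isExact_courant le_rfl _, x, y, h⟩
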